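/- Let $(M,\varphi)$ be a connected $G_2$ manifold: $\varphi$ is a smooth $3$-form on the $7$-manifold $M$, pointwise isomorphic to the standard form $\varphi_0$ on $\mathbb R^7$, and $\varphi$ and $*_\varphi\varphi$ are closed. Let $\mathbb T^2\times SU(2)$ act smoothly on $M$, preserving $\varphi$, with cohomogeneity two (the maximal orbit dimension is $5$). Let $U_1,U_2$ and $V_1,V_2,V_3$ be the vector fields generated by bases of $\mathfrak t^2$ and $\mathfrak{su}(2)$, with $[V_i,V_j]=\epsilon_{ijk}V_k$, and let $U_1\times U_2$ be the $\varphi$-cross product of the first two. Let $\nu:M\to\mathbb R$ and $\mu:M\to\mathbb R^3$ be the multi-moment maps, $$d\nu=\varphi(U_1,U_2,\cdot),\qquad d\mu_i={*_\varphi\varphi}(U_1,U_2,V_i,\cdot),$$ (they exist, for instance, if $M$ is simply connected), where the additive constants of $\mu$ are chosen so that $\mu_k=-{*_\varphi\varphi}(U_1,U_2,V_i,V_j)$ for $(i,j,k)$ cyclic. Let $M_P$ be the principal set of the action, $B=M_P/(\mathbb T^2\times SU(2))$, $\pi_{\mathbb T^2}:M_P\to M_P/\mathbb T^2$ the projection,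 $\Gamma$ the kernel of the action, $\tilde\Gamma_2$ the projection of $\Gamma$ to $SU(2)$, and $G^{SU(2)}=SU(2)/\tilde\Gamma_2$. The field $U_1\times U_2$ and the function $|\mu|$ are invariant and are denoted in the same way on the quotients. Let $\mathcal H$ be a connection on the principal $G^{SU(2)}$-bundle $M_P/\mathbb T^2\to B$ with $U_1\times U_2\in\mathcal H$. 1. Let $\gamma:J\to M_P/\mathbb T^2$ be a regular smooth curve on an open interval $J$ (regular: its velocity vanishes nowhere). The following are equivalent: (i) $\pi_{\mathbb T^2}^{-1}(\operatorname{im}\gamma)$ is a $\mathbb T^2$-invariant (embedded) associative submanifold of $M_P$; (ii) up to a smooth regular reparametrisation, $\gamma$ is an integral curve of $U_1\times U_2$; (iii) $\gamma$ is a horizontal lift of a regular curve in $B$ that parametrises a relatively open part of a level set of $|\mu|$ on $B$. 2. The map $\gamma\mapsto\pi_{\mathbb T^2}^{-1}(\operatorname{im}\gamma)$ is a bijection from the integral curves of $U_1\times U_2$ in $M_P/\mathbb T^2$ on nonempty open intervals, modulo translations of time, to the connected (nonempty) $\mathbb T^2$-invariant associative submanifolds of $M_P$. 3. Let $\beta:J\to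 B$ be an integral curve of $U_1\times U_2$ on an open interval. The integral curves $\gamma:J\to M_P/\mathbb T^2$ of $U_1\times U_2$ that project to $\beta$ form a $G^{SU(2)}$-family: there is at least one, and $G^{SU(2)}$ acts freely and transitively on them. The preimages in $M_P$ of the images of these curves are $\mathbb T^2$-invariant associatives, and distinct curves have distinct preimages. -/

import Mathlib

open Set Filter
open scoped Manifold ContDiff Topology Quaternion

noncomputable section

namespace AssocLevelSets

/-! ### The linear model -/

/-- The model space `ℝ⁷ = ℝ³ ⊕ ℝ⁴`; the coordinates `(x₁, x₂, x₃, a₀, a₁, a₂, a₃)` have the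
indices `0, …, 6`. -/
abbrev E7 := EuclideanSpace ℝ (Fin 7)

/-- The constant form `dx_{I 0} ∧ … ∧ dx_{I (k-1)}` on `ℝ⁷`. -/
def dx {k : ℕ} (I : Fin k → Fin 7) : E7 [⋀^Fin k]→L[ℝ] ℝ :=
  { (Matrix.detRowAlternating (R := ℝ) (n := Fin k)).compLinearMap
      (LinearMap.pi fun b => (EuclideanSpace.proj (𝕜 := ℝ) (I b)).toLinearMap) with
    cont := by
      change Continuous fun v : Fin k → E7 =>
        Matrix.det (Matrix.of fun a b => v a (I b))
      fun_prop }

theorem dx_apply {k : ℕ} (I : Fin k → Fin 7) (v : Fin k → E7) :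
    dx I v = Matrix.det (Matrix.of fun a b => v a (I b)) := rfl

/-- The associative form `φ₀ = dx₁₂₃ + ∑ dx_i ∧ Ω_i` with `Ω_i = da₀ ∧ da_i - da_j ∧ da_k`,
`(i, j, k)` cyclic. -/
def phi0 : E7 [⋀^Fin 3]→L[ℝ] ℝ :=
  dx ![0, 1, 2] + (dx ![0, 3, 4] - dx ![0, 5, 6]) + (dx ![1, 3, 5] - dx ![1, 6, 4])
    + (dx ![2, 3, 6] - dx ![2, 4, 5])

/-- The coassociative form `∗φ₀ = da₀₁₂₃ - ∑ dx_j ∧ dx_k ∧ Ω_i`, `(i, j, k)` cyclic. -/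
def starPhi0 : E7 [⋀^Fin 4]→L[ℝ] ℝ :=
  dx ![3, 4, 5, 6] - (dx ![1, 2, 3, 4] - dx ![1, 2, 5, 6])
    - (dx ![2, 0, 3, 5] - dx ![2, 0, 6, 4]) - (dx ![0, 1, 3, 6] - dx ![0, 1, 4, 5])

/-! ### The group `𝕋² × SU(2)` -/

/-- `𝕋²`. -/
abbrev Torus := Circle × Circle

/-- `SU(2)`, as the Lie group of unit quaternions. -/
abbrev SU2 := Metric.sphere (0 : ℍ[ℝ]) 1

/-- `𝕋² × SU(2)`. -/
abbrev Grp := Torus × SU2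

instance instFactFinrankQuaternion : Fact (Module.finrank ℝ ℍ[ℝ] = 3 + 1) :=
  ⟨Quaternion.finrank_eq_four⟩

instance instGroupSU2 : Group SU2 := Metric.unitSphere.instGroup

instance instGroupGrp : Group Grp := Prod.instGroup

instance instMonoidGrp : Monoid Grp := instGroupGrp.toMonoid

/-- The model with corners of the manifold `𝕋² × SU(2)`. -/
abbrev modelGrp := ((𝓡 1).prod (𝓡 1)).prod (𝓡 3)

/-- A basis `u₀, u₁` of `𝔱² = ℝ²` and a basis `v₀, v₁, v₂` of `𝔰𝔲(2) = Im ℍ` with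
`[v_i, v_j] = ε_{ijk} v_k`. -/
structure AdaptedBasis where
  u : Fin 2 → ℝ × ℝ
  v : Fin 3 → ℍ[ℝ]
  u_indep : LinearIndependent ℝ u
  v_indep : LinearIndependent ℝ v
  v_re : ∀ i, (v i).re = 0
  v_bracket : ∀ i, v i * v (i + 1) - v (i + 1) * v i = v (i + 2)

/-- The one-parameter subgroup `t ↦ exp (t a)` of `𝕋²`, in `𝕋² × SU(2)`. -/
def torusExp (a : ℝ × ℝ) (t : ℝ) : Grp :=
  ((Circle.exp (t * a.1), Circle.exp (t * a.2)), 1)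

/-- The one-parameter subgroup `t ↦ exp (t w)` of `SU(2)`, in `𝕋² × SU(2)`, for a purely imaginary
quaternion `w`. -/
def su2Exp (w : ℍ[ℝ]) (hw : w.re = 0) (t : ℝ) : Grp :=
  (1, ⟨NormedSpace.exp (t • w), by simp [Quaternion.norm_exp, hw]⟩)

/-- The subgroup `𝕋² × {1}` of `𝕋² × SU(2)`. -/
abbrev torusSubgroup : Subgroup Grp := Subgroup.prod ⊤ ⊥

section Manifold

variable {M : Type*} [TopologicalSpace M] [ChartedSpace E7 M]

/-! ### Differential forms and `G₂`-structures -/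

/-- A (not necessarily continuous) `k`-form on `M`. -/
abbrev Form (M : Type*) [TopologicalSpace M] [ChartedSpace E7 M] (k : ℕ) :=
  ∀ x : M, TangentSpace (𝓡 7) x [⋀^Fin k]→L[ℝ] ℝ

/-- The expression of a form in the chart at `x₀`. -/
def chartForm {k : ℕ} (α : Form M k) (x₀ : M) : E7 → E7 [⋀^Fin k]→L[ℝ] ℝ := fun y =>
  (α ((extChartAt (𝓡 7) x₀).symm y)).compContinuousLinearMap
    (mfderiv 𝓘(ℝ, E7) (𝓡 7) (extChartAt (𝓡 7) x₀).symm y)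

/-- Smoothness of a form. -/
def IsSmoothForm {k : ℕ} (α : Form M k) : Prop :=
  ∀ x₀ : M, ContDiffOn ℝ ∞ (chartForm α x₀) (extChartAt (𝓡 7) x₀).target

/-- Closedness of a form: `dα = 0`, computed in charts. -/
def IsClosedForm {k : ℕ} (α : Form M k) : Prop :=
  ∀ x₀ : M, ∀ y ∈ (extChartAt (𝓡 7) x₀).target, extDeriv (chartForm α x₀) y = 0

/-- A `G₂`-structure: a smooth `3`-form that is pointwise identified with `φ₀`. -/
structure G2Structure (M : Type*) [TopologicalSpace M] [ChartedSpace E7 M] where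
  form : Form M 3
  smooth : IsSmoothForm form
  exists_frame : ∀ x : M, ∃ p : E7 ≃L[ℝ] TangentSpace (𝓡 7) x,
    ∀ w : Fin 3 → E7, form x (fun i => p (w i)) = phi0 w

namespace G2Structure

variable (φ : G2Structure M)

/-- An isomorphism `p_x : ℝ⁷ → T_xM` with `p_x^* φ = φ₀`. The objects defined with it below do not
depend on its choice. -/
def frame (x : M) : E7 ≃L[ℝ] TangentSpace (𝓡 7) x := (φ.exists_frame x).choose

theorem form_frame (x : M) (w : Fin 3 → E7) :
    φ.form x (fun i => φ.frame x (w i)) = phi0 w := (φ.exists_frame x).choose_spec w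

/-- The metric `g_φ`. -/
def metric (x : M) (v w : TangentSpace (𝓡 7) x) : ℝ :=
  inner ℝ ((φ.frame x).symm v) ((φ.frame x).symm w)

/-- The form `∗_φ φ`. -/
def star : Form M 4 := fun x =>
  starPhi0.compContinuousLinearMap ((φ.frame x).symm : TangentSpace (𝓡 7) x →L[ℝ] E7)

/-- The cross product `v × w = (φ(v, w, ·))^#`, written in the orthonormal frame `p_x e_i`. -/
def cross (x : M) (v w : TangentSpace (𝓡 7) x) : TangentSpace (𝓡 7) x :=
  ∑ i : Fin 7, φ.form x ![v, w, φ.frame x (EuclideanSpace.single i 1)] •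
    φ.frame x (EuclideanSpace.single i 1)

/-- The cross product is characterised by `g(v × w, z) = φ(v, w, z)`. -/
theorem metric_cross (x : M) (v w z : TangentSpace (𝓡 7) x) :
    φ.metric x (φ.cross x v w) z = φ.form x ![v, w, z] := by
  obtain ⟨z, rfl⟩ := (φ.frame x).surjective z
  have hz : z = ∑ i : Fin 7, z i • EuclideanSpace.single i (1 : ℝ) := by
    ext j
    simp [Finset.sum_apply, Pi.single_apply]
  have hlin : ∀ c : TangentSpace (𝓡 7) x,
      φ.form x ![v, w, c] = (φ.form x).toMultilinearMap.toLinearMap ![v, w, 0] 2 c := by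
    intro c
    simp only [MultilinearMap.toLinearMap_apply]
    change φ.form x _ = φ.form x _
    congr 1
    ext i
    fin_cases i <;> rfl
  have h1 : φ.form x ![v, w, φ.frame x z] =
      ∑ i : Fin 7, z i * φ.form x ![v, w, φ.frame x (EuclideanSpace.single i 1)] := by
    conv_lhs => rw [hz]
    simp only [hlin, map_sum, map_smul, smul_eq_mul]
  rw [h1]
  simp [metric, cross, sum_inner, inner_smul_left, EuclideanSpace.inner_single_left, mul_comm]

/-- `(M, φ)` is a `G₂` manifold: `φ` and `∗_φ φ` are closed. -/
def IsTorsionFree : Prop := IsClosedForm φ.form ∧ IsClosedForm φ.star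

/-- A linear subspace of `T_xM` is an associative plane if it has an orthonormal basis `e₀, e₁, e₂`
with `φ(e₀, e₁, e₂) = 1`, i.e. if it is three-dimensional and, for one of its two orientations,
`φ` restricts to its volume form. -/
def IsAssociativePlane (x : M) (F : Submodule ℝ (TangentSpace (𝓡 7) x)) : Prop :=
  ∃ e : Fin 3 → TangentSpace (𝓡 7) x,
    (∀ i j, φ.metric x (e i) (e j) = if i = j then 1 else 0) ∧
    Submodule.span ℝ (range e) = F ∧ φ.form x e = 1

end G2Structure

/-! ### Submanifolds -/

/-- `F : Ω → S ∩ V` is a smooth local parametrisation of the set `S ⊆ M` by an open subset `Ω` of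
`ℝᵏ`: an immersion and a homeomorphism onto `S ∩ V`, with `V` open in `M`. -/
structure IsLocalParam {k : ℕ} (S V : Set M) (Ω : Set (EuclideanSpace ℝ (Fin k)))
    (F : EuclideanSpace ℝ (Fin k) → M) : Prop where
  isOpen_V : IsOpen V
  isOpen_Ω : IsOpen Ω
  smooth : ContMDiffOn (𝓡 k) (𝓡 7) ∞ F Ω
  immersion : ∀ y ∈ Ω, Function.Injective (mfderiv (𝓡 k) (𝓡 7) F y)
  image : F '' Ω = S ∩ V
  embedding : Topology.IsEmbedding (Ω.domRestrict F)

/-- `S` is an (embedded, three-dimensional) associative submanifold: near each of its points it has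
a local parametrisation, whose differential there has an associative plane as range (the tangent
space of `S`). -/
def IsAssociative (φ : G2Structure M) (S : Set M) : Prop :=
  ∀ x ∈ S, ∃ (V : Set M) (Ω : Set (EuclideanSpace ℝ (Fin 3))) (F : EuclideanSpace ℝ (Fin 3) → M),
    IsLocalParam S V Ω F ∧ ∃ y ∈ Ω, F y = x ∧
      φ.IsAssociativePlane (F y) (mfderiv (𝓡 3) (𝓡 7) F y).range

/-- The velocity of a curve in `M`. -/
def velocity (c : ℝ → M) (t : ℝ) : TangentSpace (𝓡 7) (c t) :=
  mfderiv 𝓘(ℝ, ℝ) (𝓡 7) c t (1 : ℝ)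

/-! ### The action -/

variable [MulAction Grp M]

/-- The vector at `x` generated by a one-parameter subgroup `c`, i.e. `d/dt|₀ (c (-t) • x)`. The
curve starts at `c 0 • x = x`. -/
def generator (c : ℝ → Grp) (x : M) : TangentSpace (𝓡 7) x :=
  (velocity (fun t : ℝ => c (-t) • x) 0 : E7)

/-- The generators `U₁, U₂` (indices `0, 1`) of the `𝕋²`-action. -/
def U (A : AdaptedBasis) (l : Fin 2) (x : M) : TangentSpace (𝓡 7) x :=
  generator (torusExp (A.u l)) x

/-- The generators `V₁, V₂, V₃` (indices `0, 1, 2`) of the `SU(2)`-action. -/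
def V (A : AdaptedBasis) (i : Fin 3) (x : M) : TangentSpace (𝓡 7) x :=
  generator (su2Exp (A.v i) (A.v_re i)) x

/-- The tangent space at `x` of the `𝕋²`-orbit of `x`. -/
def torusTangent (A : AdaptedBasis) (x : M) : Submodule ℝ (TangentSpace (𝓡 7) x) :=
  Submodule.span ℝ (range fun l => U A l x)

/-- The tangent space at `x` of the `𝕋² × SU(2)`-orbit of `x`. -/
def orbitTangent (A : AdaptedBasis) (x : M) : Submodule ℝ (TangentSpace (𝓡 7) x) :=
  torusTangent A x ⊔ Submodule.span ℝ (range fun i => V A i x)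

/-- The action has cohomogeneity two: the maximal dimension of its orbits is `5`. -/
def CohomogeneityTwo (M : Type*) [TopologicalSpace M] [ChartedSpace E7 M] [MulAction Grp M]
    (A : AdaptedBasis) : Prop :=
  IsGreatest (range fun x : M => Module.finrank ℝ (orbitTangent A x)) 5

/-- The action preserves the `G₂`-structure. -/
def G2Structure.IsInvariant (φ : G2Structure M) : Prop :=
  ∀ (g : Grp) (x : M) (w : Fin 3 → TangentSpace (𝓡 7) x),
    φ.form (g • x) (fun i => mfderiv (𝓡 7) (𝓡 7) (fun y : M => g • y) x (w i)) = φ.form x w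

/-- The principal set `M_P`: the points whose stabiliser is, up to conjugation, contained in every
stabiliser. (The stabilisers of the points `g • x` are the conjugates of the stabiliser of `x`.) -/
def principalSet (M : Type*) [MulAction Grp M] : Set M :=
  {x | ∀ y : M, ∃ g : Grp, MulAction.stabilizer Grp (g • x) ≤ MulAction.stabilizer Grp y}

/-- The vector field `U₁ × U₂`. -/
def crossField (φ : G2Structure M) (A : AdaptedBasis) (x : M) : TangentSpace (𝓡 7) x :=
  φ.cross x (U A 0 x) (U A 1 x)

/-- `ν` and `μ` are the multi-moment maps with `dν = φ(U₁, U₂, ·)` and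
`dμ_i = ∗φ(U₁, U₂, V_i, ·)`. The additive constants of `μ` are fixed by requiring at one point that
`μ_k = -∗φ(U₁, U₂, V_i, V_j)`, `(i, j, k)` cyclic. -/
structure IsMultiMoment (φ : G2Structure M) (A : AdaptedBasis) (ν : M → ℝ)
    (μ : M → EuclideanSpace ℝ (Fin 3)) : Prop where
  smooth_nu : ContMDiff (𝓡 7) 𝓘(ℝ, ℝ) ∞ ν
  smooth_mu : ContMDiff (𝓡 7) 𝓘(ℝ, EuclideanSpace ℝ (Fin 3)) ∞ μ
  d_nu : ∀ (x : M) (w : TangentSpace (𝓡 7) x),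
    mvfderiv (𝓡 7) ν x w = φ.form x ![U A 0 x, U A 1 x, w]
  d_mu : ∀ (x : M) (i : Fin 3) (w : TangentSpace (𝓡 7) x),
    mvfderiv (𝓡 7) (fun y => μ y i) x w = φ.star x ![U A 0 x, U A 1 x, V A i x, w]
  normalised : ∃ x : M, ∀ k : Fin 3,
    μ x k = -φ.star x ![U A 0 x, U A 1 x, V A (k + 1) x, V A (k + 2) x]

/-! ### The orbit spaces -/

/-- `M/𝕋²`. -/
abbrev TorusQuotient (M : Type*) [MulAction Grp M] := MulAction.orbitRel.Quotient torusSubgroup M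

/-- `M/(𝕋² × SU(2))`. -/
abbrev FullQuotient (M : Type*) [MulAction Grp M] := MulAction.orbitRel.Quotient Grp M

/-- The projection `π_{𝕋²} : M → M/𝕋²`. -/
def toTorusQuotient (x : M) : TorusQuotient M := Quotient.mk'' x

/-- The projection `M → M/(𝕋² × SU(2))`. -/
def toFullQuotient (x : M) : FullQuotient M := Quotient.mk'' x

/-- The projection `M/𝕋² → M/(𝕋² × SU(2))`. -/
def quotientProj : TorusQuotient M → FullQuotient M :=
  Quotient.map' id fun _ _ h => by
    obtain ⟨a, ha⟩ := h
    exact ⟨(a : Grp), ha⟩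

/-- `M_P/𝕋²`. -/
def principalTorusQuotient (M : Type*) [MulAction Grp M] : Set (TorusQuotient M) :=
  toTorusQuotient '' principalSet M

/-- The surface `B = M_P/(𝕋² × SU(2))`. -/
def baseB (M : Type*) [MulAction Grp M] : Set (FullQuotient M) :=
  toFullQuotient '' principalSet M

/-- The level set of value `r`, on `B`, of the function that `|μ|` induces there. -/
def levelSetB (μ : M → EuclideanSpace ℝ (Fin 3)) (r : ℝ) : Set (FullQuotient M) :=
  toFullQuotient '' {x | x ∈ principalSet M ∧ ‖μ x‖ = r}

/-! ### The group `G^{SU(2)}` -/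

/-- `Γ̃₂`, the projection to `SU(2)` of the kernel `Γ` of the action of `𝕋² × SU(2)`. -/
def gammaTilde (M : Type*) [MulAction Grp M] : Subgroup SU2 :=
  (MulAction.toPermHom Grp M).ker.map (MonoidHom.snd Torus SU2)

instance gammaTilde_normal (M : Type*) [MulAction Grp M] : (gammaTilde M).Normal :=
  Subgroup.Normal.map inferInstance _ Prod.snd_surjective

/-- `G^{SU(2)} = SU(2)/Γ̃₂`. -/
abbrev GSU2 (M : Type*) [MulAction Grp M] := SU2 ⧸ gammaTilde M

/-- The action of `SU(2)` on `M/𝕋²`. -/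
def su2Act (b : SU2) : TorusQuotient M → TorusQuotient M :=
  Quotient.map' (fun x => ((1, b) : Grp) • x) fun x y h => by
    obtain ⟨⟨⟨a, b'⟩, ha⟩, rfl⟩ := h
    obtain rfl : b' = 1 := by simpa [Subgroup.mem_prod] using ha
    refine ⟨⟨(a, 1), ha⟩, ?_⟩
    simp [Subgroup.smul_def, smul_smul]

theorem su2Act_mk {M : Type*} [MulAction Grp M] (b : SU2) (x : M) :
    su2Act b (toTorusQuotient x) = toTorusQuotient (((1, b) : Grp) • x) := rfl

/-- The action of `G^{SU(2)}` on `M/𝕋²` induced by the action of `SU(2)` on `M`. -/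
instance instMulActionGSU2 (M : Type*) [MulAction Grp M] : MulAction (GSU2 M) (TorusQuotient M) where
  smul g q := Quotient.liftOn' g (fun b => su2Act b q) fun b b' h => by
    obtain ⟨⟨a, k⟩, hk, hkb⟩ := (QuotientGroup.leftRel_apply.mp h : b⁻¹ * b' ∈ gammaTilde M)
    have hb : b' = b * k := by
      rw [show k = b⁻¹ * b' from hkb, mul_inv_cancel_left]
    induction q using Quotient.inductionOn' with
    | h x =>
      change toTorusQuotient _ = toTorusQuotient _
      have hx : ((a, k) : Grp) • x = x := by
        have := MonoidHom.mem_ker.mp hk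
        exact congrArg (fun e : Equiv.Perm M => e x) this
      apply Quotient.sound'
      refine ⟨⟨(a, 1), by simp [Subgroup.mem_prod]⟩, ?_⟩
      change ((a, 1) : Grp) • ((1, b') : Grp) • x = ((1, b) : Grp) • x
      conv_rhs => rw [← hx]
      simp [smul_smul, hb]
  one_smul q := by
    induction q using Quotient.inductionOn' with
    | h x =>
      change toTorusQuotient (((1, 1) : Grp) • x) = toTorusQuotient x
      rw [show ((1, 1) : Grp) = 1 from rfl, one_smul]
  mul_smul g g' q := by
    induction q using Quotient.inductionOn' with
    | h x =>
      induction g using Quotient.inductionOn' with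
      | h b =>
        induction g' using Quotient.inductionOn' with
        | h b' =>
          change toTorusQuotient (((1, b * b') : Grp) • x) =
            toTorusQuotient (((1, b) : Grp) • ((1, b') : Grp) • x)
          simp [smul_smul]

/-! ### Curves in the quotients

An orbit space carries the quotient smooth structure: a curve in it is smooth if it lifts locally to
smooth curves in `M`. The tangent space of the quotient at the class of `x` is the quotient of
`T_xM` by the tangent space at `x` of the orbit, and the velocity of a curve is represented in it by
the velocity of a lift through `x`. -/

/-- `J` is a nonempty open interval. -/
def IsOpenInterval (J : Set ℝ) : Prop := IsOpen J ∧ J.OrdConnected ∧ J.Nonempty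

/-- Near `t`, the curve `c` in `M` is smooth and lifts the curve `γ` along `p`. -/
def IsLocalLift {Q : Type*} (p : M → Q) (γ : ℝ → Q) (t : ℝ) (c : ℝ → M) : Prop :=
  ∀ᶠ s in 𝓝 t, ContMDiffAt 𝓘(ℝ, ℝ) (𝓡 7) ∞ c s ∧ p (c s) = γ s

/-- `γ`, on `J`, is a regular curve (smooth, with nowhere vanishing velocity) in `M_P/𝕋²`. -/
def IsRegularCurveT (A : AdaptedBasis) (γ : ℝ → TorusQuotient M) (J : Set ℝ) : Prop :=
  ∀ t ∈ J, γ t ∈ principalTorusQuotient M ∧ ∃ c : ℝ → M, IsLocalLift toTorusQuotient γ t c ∧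
    (torusTangent A (c t)).mkQ (velocity c t) ≠ 0

/-- `β`, on `J`, is a regular curve in `B`. -/
def IsRegularCurveB (A : AdaptedBasis) (β : ℝ → FullQuotient M) (J : Set ℝ) : Prop :=
  ∀ t ∈ J, β t ∈ baseB M ∧ ∃ c : ℝ → M, IsLocalLift toFullQuotient β t c ∧
    (orbitTangent A (c t)).mkQ (velocity c t) ≠ 0

/-- `γ`, on `J`, is an integral curve in `M_P/𝕋²` of the vector field induced by `U₁ × U₂`. -/
def IsIntegralCurveT (φ : G2Structure M) (A : AdaptedBasis) (γ : ℝ → TorusQuotient M)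
    (J : Set ℝ) : Prop :=
  ∀ t ∈ J, γ t ∈ principalTorusQuotient M ∧ ∃ c : ℝ → M, IsLocalLift toTorusQuotient γ t c ∧
    (torusTangent A (c t)).mkQ (velocity c t) =
      (torusTangent A (c t)).mkQ (crossField φ A (c t))

/-- `β`, on `J`, is an integral curve in `B` of the vector field induced by `U₁ × U₂`. -/
def IsIntegralCurveB (φ : G2Structure M) (A : AdaptedBasis) (β : ℝ → FullQuotient M)
    (J : Set ℝ) : Prop :=
  ∀ t ∈ J, β t ∈ baseB M ∧ ∃ c : ℝ → M, IsLocalLift toFullQuotient β t c ∧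
    (orbitTangent A (c t)).mkQ (velocity c t) =
      (orbitTangent A (c t)).mkQ (crossField φ A (c t))

/-- `γ : J → M_P/𝕋²` is, up to a smooth reparametrisation, an integral curve of `U₁ × U₂`. -/
def IsUnparamIntegralCurveT (φ : G2Structure M) (A : AdaptedBasis) (γ : ℝ → TorusQuotient M)
    (J : Set ℝ) : Prop :=
  ∃ (J' : Set ℝ) (σ : ℝ → ℝ), IsOpenInterval J' ∧ ContDiffOn ℝ ∞ σ J' ∧
    (∀ s ∈ J', deriv σ s ≠ 0) ∧ σ '' J' = J ∧ IsIntegralCurveT φ A (γ ∘ σ) J'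

/-! ### Connections -/

/-- The tangent space `T_xM / T_x(𝕋² x)` of `M/𝕋²` at the orbit of `x`. -/
abbrev QuotTangent (A : AdaptedBasis) (x : M) := TangentSpace (𝓡 7) x ⧸ torusTangent A x

/-- `𝓗` is a connection on the principal `G^{SU(2)}`-bundle `M_P/𝕋² → B`: a smooth distribution on
`M_P/𝕋²` that is complementary to the tangent spaces of the fibres and invariant. The invariance
under `𝕋²` says that `𝓗 x` only depends on the point of `M_P/𝕋²` that `x` represents. -/
structure IsPrincipalConnection [IsManifold (𝓡 7) ∞ M] (A : AdaptedBasis)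
    (𝓗 : ∀ x : M, Submodule ℝ (QuotTangent A x)) : Prop where
  isCompl : ∀ x ∈ principalSet M, IsCompl (𝓗 x) ((orbitTangent A x).map (torusTangent A x).mkQ)
  invariant : ∀ (g : Grp), ∀ x ∈ principalSet M,
    ((𝓗 x).comap (torusTangent A x).mkQ).map
        (mfderiv (𝓡 7) (𝓡 7) (fun y : M => g • y) x).toLinearMap =
      (𝓗 (g • x)).comap (torusTangent A (g • x)).mkQ
  smooth : ∀ x₀ ∈ principalSet M, ∃ Y : Fin 2 → ∀ x : M, TangentSpace (𝓡 7) x,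
    ∀ᶠ x in 𝓝 x₀,
      (∀ i, ContMDiffAt (𝓡 7) (𝓡 7).tangent ∞
        (fun y => (⟨y, Y i y⟩ : TangentBundle (𝓡 7) M)) x) ∧
      𝓗 x = Submodule.span ℝ (range fun i => (torusTangent A x).mkQ (Y i x))

/-- `γ`, on `J`, is a horizontal lift of the curve `β` in `B`. -/
def IsHorizontalLift (A : AdaptedBasis) (𝓗 : ∀ x : M, Submodule ℝ (QuotTangent A x))
    (γ : ℝ → TorusQuotient M) (β : ℝ → FullQuotient M) (J : Set ℝ) : Prop :=
  ∀ t ∈ J, quotientProj (γ t) = β t ∧ ∃ c : ℝ → M, IsLocalLift toTorusQuotient γ t c ∧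
    (torusTangent A (c t)).mkQ (velocity c t) ∈ 𝓗 (c t)

/-- `β`, on `J`, is a regular parametrisation of an open arc of a level set of `|μ|` on `B`. -/
def IsLevelSetCurveB (A : AdaptedBasis) (μ : M → EuclideanSpace ℝ (Fin 3))
    (β : ℝ → FullQuotient M) (J : Set ℝ) : Prop :=
  IsRegularCurveB A β J ∧ ∃ (r : ℝ) (O : Set (FullQuotient M)), IsOpen O ∧
    β '' J = O ∩ levelSetB μ r

/-- `S` is a `𝕋²`-invariant associative submanifold of `M_P`. -/
def IsTorusInvariantAssociative (φ : G2Structure M) (S : Set M) : Prop :=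
  S ⊆ principalSet M ∧ (∀ (a : Torus), ∀ x ∈ S, ((a, 1) : Grp) • x ∈ S) ∧ IsAssociative φ S

end Manifold

end AssocLevelSets

end

open Set Filter
open scoped Manifold ContDiff Topology Quaternion

noncomputable section

set_option linter.unusedSectionVars false

namespace AssocLevelSets

/-! ### Linear algebra of the standard forms -/

/-! Write Z for U₁ × U₂ and G for 𝕋² × SU(2). At a principal point the fields U₁, U₂ are
independent, and an associative plane is closed under the cross product. Hence exactly one
associative plane contains U₁ and U₂, namely the span of U₁, U₂ and Z. A torus-invariant associative
is therefore tangent to Z, and is locally swept out by the torus orbits of the points of an integral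
curve of Z; conversely, such a sweep is an embedded associative. Connected associatives are
exhausted by one maximal integral curve: the union of its torus orbits is open and closed in the
submanifold.

The link with |μ| rests on two invariant functions. One has dν(Z) = |Z|² > 0, while d|μ|²
annihilates Z. Both differentials vanish on the G-orbits: for ν because the orbits are compact
(`dnu_inf`), for |μ|² because the formula for μ holds everywhere on the connected M (`mu_eq`). At
principal points their common kernel is exactly the tangent space of the orbit
(`mem_orbitTan_of_dnu_of_drho`), so near such a point ν and |μ| together separate orbits
(`exists_nhds_same_orbit`). On B the field Z thus runs along the level curves of |μ|, with ν as a
clock. A horizontal curve over a level curve has velocity kZ modulo the torus directions, since the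
only ambiguity left is vertical.

Three technical points carry the rest. The frames of the G₂-structure are chosen point by point,
without any continuity. An automorphism of φ₀ is orthogonal (`inner_of_preserves`), so metric, cross
product and ∗φ do not depend on the frame, and `crossOf` expresses the cross product by an explicit
smooth formula in φ, so that Z is a smooth field.

Next, the stabiliser of a principal point acts trivially on all of M (`smul_eq_of_smul_eq`).
Consequently the torus acts near such a point like a free proper group modulo the kernel
(`exists_tube`), and G^{SU(2)} acts freely on M_P/𝕋².

Finally, curves in the quotients are only known through local smooth lifts. Two lifts have the same
velocity modulo the torus (`sub_mem_torusTan`), although the torus element that relates them need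
not depend continuously on time. Integral curves in either quotient lift to integral curves of Z in
M: from M_P/𝕋² by correcting a lift by a torus-valued function (`exists_torus_adjust`), from B by
comparing with an integral curve by means of ν (`IsIntegralCurveB.exists_local_isZ`). Uniqueness of
integral curves and G-invariance of Z then give the G^{SU(2)}-family, and strict monotonicity of ν
rules out distinct parametrisations other than translations of time. -/

theorem phi0_apply (a b c : E7) : phi0 ![a, b, c] =
    (dx ![0, 1, 2] ![a, b, c] + (dx ![0, 3, 4] ![a, b, c] - dx ![0, 5, 6] ![a, b, c])
      + (dx ![1, 3, 5] ![a, b, c] - dx ![1, 6, 4] ![a, b, c])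
      + (dx ![2, 3, 6] ![a, b, c] - dx ![2, 4, 5] ![a, b, c])) := rfl

/-- The cross product of `ℝ⁷` given by `φ₀`. -/
def cross0 (a b : E7) : E7 :=
  let p : Fin 7 → Fin 7 → ℝ := fun i j => a i * b j - a j * b i
  !₂[p 1 2 + p 3 4 - p 5 6, p 2 0 + p 3 5 + p 4 6, p 0 1 + p 3 6 - p 4 5,
    p 4 0 + p 5 1 + p 6 2, p 0 3 + p 6 1 - p 5 2, p 1 3 - p 6 0 - p 2 4, p 1 4 - p 0 5 + p 2 3]

theorem inner_eq_sum (a b : E7) : inner ℝ a b = a 0 * b 0 + a 1 * b 1 + a 2 * b 2 + a 3 * b 3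
    + a 4 * b 4 + a 5 * b 5 + a 6 * b 6 := by
  simp [PiLp.inner_apply, Fin.sum_univ_seven, mul_comm]

theorem phi0_eq_inner_cross0 (a b c : E7) : phi0 ![a, b, c] = inner ℝ (cross0 a b) c := by
  rw [phi0_apply, inner_eq_sum]
  simp only [dx_apply, Matrix.det_fin_three, Matrix.of_apply, Matrix.cons_val_zero,
    Matrix.cons_val_one, Matrix.cons_val, cross0]
  ring

theorem cross0_add_left (a b c : E7) : cross0 (a + b) c = cross0 a c + cross0 b c := by
  ext i; fin_cases i <;> simp [cross0] <;> ring

theorem cross0_smul_left (r : ℝ) (a c : E7) : cross0 (r • a) c = r • cross0 a c := by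
  ext i; fin_cases i <;> simp [cross0] <;> ring

theorem cross0_swap (a b : E7) : cross0 a b = -cross0 b a := by
  ext i; fin_cases i <;> simp [cross0] <;> ring

theorem cross0_self (a : E7) : cross0 a a = 0 := by
  ext i; fin_cases i <;> simp [cross0] <;> ring

theorem cross0_add_right (a b c : E7) : cross0 a (b + c) = cross0 a b + cross0 a c := by
  rw [cross0_swap, cross0_add_left, cross0_swap b, cross0_swap c]; abel

theorem cross0_smul_right (r : ℝ) (a c : E7) : cross0 a (r • c) = r • cross0 a c := by
  rw [cross0_swap, cross0_smul_left, cross0_swap c, smul_neg, neg_neg]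

theorem cross0_cross0 (a b : E7) :
    cross0 a (cross0 a b) = (inner ℝ a b : ℝ) • a - (inner ℝ a a : ℝ) • b := by
  simp only [inner_eq_sum]
  ext i; fin_cases i <;> simp [cross0] <;> ring

theorem inner_cross0_left (a b : E7) : inner ℝ (cross0 a b) a = 0 := by
  simp [cross0, inner_eq_sum]; ring

theorem inner_cross0_right (a b : E7) : inner ℝ (cross0 a b) b = 0 := by
  simp [cross0, inner_eq_sum]; ring

theorem inner_cross0_swap (a b c : E7) : inner ℝ (cross0 a b) c = -inner ℝ (cross0 a c) b := by
  simp [cross0, inner_eq_sum]; ring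

theorem inner_cross0_cross0 (a b : E7) : inner ℝ (cross0 a b) (cross0 a b) =
    inner ℝ a a * inner ℝ b b - inner ℝ a b ^ 2 := by
  rw [inner_cross0_swap, cross0_cross0, inner_sub_left, inner_smul_left, inner_smul_left]
  simp; ring

theorem dx_four_apply (I : Fin 4 → Fin 7) (a b c d : E7) : dx I ![a, b, c, d] =
    a (I 0) * (b (I 1) * (c (I 2) * d (I 3) - c (I 3) * d (I 2))
      - b (I 2) * (c (I 1) * d (I 3) - c (I 3) * d (I 1))
      + b (I 3) * (c (I 1) * d (I 2) - c (I 2) * d (I 1)))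
    - a (I 1) * (b (I 0) * (c (I 2) * d (I 3) - c (I 3) * d (I 2))
      - b (I 2) * (c (I 0) * d (I 3) - c (I 3) * d (I 0))
      + b (I 3) * (c (I 0) * d (I 2) - c (I 2) * d (I 0)))
    + a (I 2) * (b (I 0) * (c (I 1) * d (I 3) - c (I 3) * d (I 1))
      - b (I 1) * (c (I 0) * d (I 3) - c (I 3) * d (I 0))
      + b (I 3) * (c (I 0) * d (I 1) - c (I 1) * d (I 0)))
    - a (I 3) * (b (I 0) * (c (I 1) * d (I 2) - c (I 2) * d (I 1))
      - b (I 1) * (c (I 0) * d (I 2) - c (I 2) * d (I 0))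
      + b (I 2) * (c (I 0) * d (I 1) - c (I 1) * d (I 0))) := by
  rw [dx_apply]
  simp [Matrix.det_succ_row_zero, Fin.sum_univ_succ, Fin.succAbove]
  ring

set_option maxHeartbeats 1000000 in
-- Writing ∗φ₀ through the cross product and the inner product shows that whatever preserves these
-- two preserves ∗φ₀. It also exhibits the endomorphism that represents ∗φ₀(u, v, ·, ·).
theorem starPhi0_eq (a b c d : E7) : starPhi0 ![a, b, c, d] =
    inner ℝ (cross0 a (cross0 b c)) d + inner ℝ a b * inner ℝ c d
      - inner ℝ a c * inner ℝ b d := by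
  have h : starPhi0 ![a, b, c, d] = dx ![3, 4, 5, 6] ![a, b, c, d] - (dx ![1, 2, 3, 4] ![a, b, c, d]
    - dx ![1, 2, 5, 6] ![a, b, c, d]) - (dx ![2, 0, 3, 5] ![a, b, c, d]
    - dx ![2, 0, 6, 4] ![a, b, c, d]) - (dx ![0, 1, 3, 6] ![a, b, c, d]
    - dx ![0, 1, 4, 5] ![a, b, c, d]) := rfl
  rw [h]
  simp only [inner_eq_sum, dx_four_apply, cross0, Matrix.cons_val, WithLp.ofLp_toLp]
  ring

/-! ### Multilinear bookkeeping -/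

section Multilinear

variable {E : Type*} [AddCommGroup E] [Module ℝ E] [TopologicalSpace E]

theorem form3_add (θ : E [⋀^Fin 3]→L[ℝ] ℝ) (a b c d : E) :
    θ ![a, b, c + d] = θ ![a, b, c] + θ ![a, b, d] := by
  have h := θ.map_update_add ![a, b, 0] 2 c d
  have e : ∀ z, Function.update ![a, b, 0] 2 z = ![a, b, z] := by
    intro z; ext i; fin_cases i <;> rfl
  simpa only [e] using h

theorem form3_smul (θ : E [⋀^Fin 3]→L[ℝ] ℝ) (a b c : E) (r : ℝ) :
    θ ![a, b, r • c] = r * θ ![a, b, c] := by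
  have h := θ.map_update_smul ![a, b, 0] 2 r c
  have e : ∀ z, Function.update ![a, b, 0] 2 z = ![a, b, z] := by
    intro z; ext i; fin_cases i <;> rfl
  simpa only [e, smul_eq_mul] using h

/-- A three-form with its first two arguments fixed. -/
def form3Lin (θ : E [⋀^Fin 3]→L[ℝ] ℝ) (a b : E) : E →ₗ[ℝ] ℝ where
  toFun c := θ ![a, b, c]
  map_add' := form3_add θ a b
  map_smul' r c := form3_smul θ a b c r

theorem form3_swap12 (θ : E [⋀^Fin 3]→L[ℝ] ℝ) (a b c : E) :
    θ ![a, b, c] = -θ ![a, c, b] := by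
  have h := θ.toAlternatingMap.map_swap ![a, b, c] (i := 1) (j := 2) (by decide)
  have e : ![a, b, c] ∘ (Equiv.swap (1 : Fin 3) 2) = ![a, c, b] := by
    ext i; fin_cases i <;> rfl
  rw [e] at h
  change θ ![a, c, b] = -θ ![a, b, c] at h
  rw [h, neg_neg]

theorem form3_swap01 (θ : E [⋀^Fin 3]→L[ℝ] ℝ) (a b c : E) :
    θ ![a, b, c] = -θ ![b, a, c] := by
  have h := θ.toAlternatingMap.map_swap ![a, b, c] (i := 0) (j := 1) (by decide)
  have e : ![a, b, c] ∘ (Equiv.swap (0 : Fin 3) 1) = ![b, a, c] := by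
    ext i; fin_cases i <;> rfl
  rw [e] at h
  change θ ![b, a, c] = -θ ![a, b, c] at h
  rw [h, neg_neg]

theorem form3_rotate (θ : E [⋀^Fin 3]→L[ℝ] ℝ) (a b c : E) :
    θ ![a, b, c] = θ ![b, c, a] := by
  rw [form3_swap01, form3_swap12, neg_neg]

theorem form3_sum {ι : Type*} (s : Finset ι) (θ : E [⋀^Fin 3]→L[ℝ] ℝ) (a b : E) (r : ι → ℝ)
    (c : ι → E) : θ ![a, b, ∑ i ∈ s, r i • c i] = ∑ i ∈ s, r i * θ ![a, b, c i] := by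
  have h := map_sum (form3Lin θ a b) (fun i => r i • c i) s
  simp only [map_smul, smul_eq_mul] at h
  exact h

theorem form3_sum_mid {ι : Type*} (s : Finset ι) (θ : E [⋀^Fin 3]→L[ℝ] ℝ) (a b : E) (r : ι → ℝ)
    (c : ι → E) : θ ![a, ∑ i ∈ s, r i • c i, b] = ∑ i ∈ s, r i * θ ![a, c i, b] := by
  rw [form3_swap12, form3_sum, ← Finset.sum_neg_distrib]
  exact Finset.sum_congr rfl fun i _ => by rw [form3_swap12 θ a b]; ring

theorem form3_sum_left {ι : Type*} (s : Finset ι) (θ : E [⋀^Fin 3]→L[ℝ] ℝ) (a b : E) (r : ι → ℝ)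
    (c : ι → E) : θ ![∑ i ∈ s, r i • c i, a, b] = ∑ i ∈ s, r i * θ ![c i, a, b] := by
  rw [form3_rotate, form3_sum]
  exact Finset.sum_congr rfl fun i _ => by rw [form3_rotate θ (c i)]

end Multilinear

/-! ### The metric of a three-form -/

/-- The standard basis of `ℝ⁷`. -/
abbrev e7 (i : Fin 7) : E7 := EuclideanSpace.single i 1

theorem sum_e7 (a : E7) : ∑ i, a i • e7 i = a := by
  ext j; simp [Finset.sum_apply, Pi.single_apply]

theorem inner_e7 (a : E7) (i : Fin 7) : inner ℝ a (e7 i) = a i := by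
  simp [EuclideanSpace.inner_single_right]

theorem inner_eq_dotProduct (a b : E7) : inner ℝ a b = (a : Fin 7 → ℝ) ⬝ᵥ (b : Fin 7 → ℝ) := by
  simp [PiLp.inner_apply, dotProduct, mul_comm]

theorem inner_cross0_cross0' (a b c : E7) : inner ℝ (cross0 a b) (cross0 a c) =
    inner ℝ a a * inner ℝ b c - inner ℝ a b * inner ℝ a c := by
  rw [inner_cross0_swap, cross0_cross0, inner_sub_left, inner_smul_left, inner_smul_left,
    real_inner_comm b c]
  simp only [conj_trivial]; ring

open Matrix in
-- A shear of determinant one that fixes L moves α to a multiple of a, the kernel direction of L.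
-- The remaining matrix times its transpose is a rank-one perturbation of a scalar matrix, whose
-- determinant is explicit.
theorem det_add_vecMulVec_sq {n : Type*} [Fintype n] [DecidableEq n] (L : Matrix n n ℝ)
    (a α : n → ℝ) (hL : Lᵀ = -L) (hLa : L *ᵥ a = 0)
    (hLL : L * Lᵀ = (a ⬝ᵥ a) • (1 : Matrix n n ℝ) - vecMulVec a a) (ht : a ⬝ᵥ α ≠ 0) :
    (L + vecMulVec α α).det ^ 2 * (a ⬝ᵥ a) ^ 3 = (a ⬝ᵥ a) ^ Fintype.card n * (a ⬝ᵥ α) ^ 4 := by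
  have haa : a ⬝ᵥ a ≠ 0 := fun h => ht (by rw [dotProduct_self_eq_zero.mp h, zero_dotProduct])
  set s := a ⬝ᵥ a with hs
  set t := a ⬝ᵥ α with htd
  set k := t / s with hk
  set v : n → ℝ := t⁻¹ • (k • a - α) with hv
  have hav : v ⬝ᵥ a = 0 := by
    rw [hv, smul_dotProduct, sub_dotProduct, smul_dotProduct, ← hs, dotProduct_comm α, ← htd, hk]
    simp [haa]
  have haL : a ᵥ* L = 0 := by
    rw [← mulVec_transpose, hL, neg_mulVec, hLa, neg_zero]
  -- The vector v is orthogonal to a, so the shear has determinant one. It is normalised so that Sᵀα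
  -- = k a, and it leaves L unchanged because L annihilates a from both sides.
  set S : Matrix n n ℝ := 1 + vecMulVec a v with hS
  have hdetS : S.det = 1 := by
    rw [hS, vecMulVec_eq Unit, det_one_add_replicateCol_mul_replicateRow, hav, add_zero]
  have hST : Sᵀ = 1 + vecMulVec v a := by
    rw [hS, transpose_add, transpose_one, transpose_vecMulVec]
  have hSα : Sᵀ *ᵥ α = k • a := by
    rw [hST, add_mulVec, one_mulVec, vecMulVec_mulVec, ← htd, hv]
    ext i
    simp [ht]
  have h1 : Sᵀ * (L + vecMulVec α α) * S = L + (k ^ 2) • vecMulVec a a := by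
    have e1 : Sᵀ * L * S = L := by
      rw [hST, hS, add_mul, one_mul, vecMulVec_mul, haL, mul_add, mul_one, add_mul, mul_vecMulVec,
        hLa]
      simp
    have e2 : Sᵀ * vecMulVec α α * S = (k ^ 2) • vecMulVec a a := by
      rw [mul_vecMulVec, hSα, vecMulVec_mul, ← mulVec_transpose, hSα]
      ext i j
      simp [vecMulVec_apply]; ring
    rw [Matrix.mul_add Sᵀ, Matrix.add_mul _ _ S, e1, e2]
  have h2 : (L + (k ^ 2) • vecMulVec a a).det = (L + vecMulVec α α).det := by
    rw [← h1, det_mul, det_mul, det_transpose, hdetS]; ring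
  -- The mixed terms vanish because L a = 0; the rest is s − aaᵀ + k⁴s aaᵀ.
  have h3 : (L + (k ^ 2) • vecMulVec a a) * (L + (k ^ 2) • vecMulVec a a)ᵀ =
      s • (1 + vecMulVec a (((k ^ 4 * s - 1) / s) • a)) := by
    rw [transpose_add, transpose_smul, transpose_vecMulVec, mul_add, add_mul, add_mul, hLL,
      mul_smul_comm, mul_vecMulVec, hLa, hL, smul_mul_assoc, mul_neg, vecMulVec_mul, haL,
      smul_mul_assoc, mul_smul_comm, vecMulVec_mul_vecMulVec]
    ext i j
    simp [vecMulVec_apply, ← hs]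
    field_simp
    ring
  have h4 := congrArg det h3
  rw [det_mul, det_transpose, h2, det_smul, vecMulVec_eq Unit a (_ • a),
    det_one_add_replicateCol_mul_replicateRow, smul_dotProduct, ← hs] at h4
  rw [pow_two, h4, hk]
  simp only [smul_eq_mul]
  field_simp
  ring

/-- The bilinear form `φ(a, ·, ·) + α ⊗ α` in the standard basis. -/
def auxMat (θ : E7 [⋀^Fin 3]→L[ℝ] ℝ) (a α : E7) : Matrix (Fin 7) (Fin 7) ℝ :=
  Matrix.of fun i j => θ ![a, e7 i, e7 j] + α i * α j

open Matrix in
-- The skew matrix of φ₀(a, ·, ·) is the matrix of the cross product by a. The cross-product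
-- identities give its kernel vector a and its square, which are the hypotheses of
-- `det_add_vecMulVec_sq`. The outcome recovers |a| from φ₀ alone; without the rank-one term the
-- determinant would vanish.
theorem det_auxMat_phi0 (a α : E7) (h : inner ℝ a α ≠ 0) :
    (auxMat phi0 a α).det ^ 2 = (inner ℝ a a) ^ 4 * (inner ℝ a α) ^ 4 := by
  set L : Matrix (Fin 7) (Fin 7) ℝ := of fun i j => phi0 ![a, e7 i, e7 j] with hL
  have hLij : ∀ i j, L i j = cross0 a (e7 i) j := fun i j => by
    rw [hL, of_apply, phi0_eq_inner_cross0, inner_e7]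
  have haa : (a : Fin 7 → ℝ) ⬝ᵥ a ≠ 0 := fun h' =>
    h (by rw [inner_eq_dotProduct, dotProduct_self_eq_zero.mp h', zero_dotProduct])
  have key := det_add_vecMulVec_sq L a α ?_ ?_ ?_ (by rwa [inner_eq_dotProduct] at h)
  · have e : L + vecMulVec (α : Fin 7 → ℝ) α = auxMat phi0 a α := by
      ext i j; simp [auxMat, hL, vecMulVec_apply]
    rw [e, Fintype.card_fin] at key
    rw [inner_eq_dotProduct, inner_eq_dotProduct]
    have h3 := pow_ne_zero 3 haa
    apply mul_right_cancel₀ h3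
    rw [key]; ring
  · ext i j
    rw [transpose_apply, neg_apply, hL, of_apply, of_apply, form3_swap12]
  · ext i
    have : (L *ᵥ (a : Fin 7 → ℝ)) i = inner ℝ (cross0 a (e7 i)) a := by
      rw [inner_eq_dotProduct, mulVec, dotProduct, dotProduct]
      exact Finset.sum_congr rfl fun j _ => by rw [hLij]
    rw [this, inner_cross0_left]; rfl
  · ext i j
    have : (L * Lᵀ) i j = inner ℝ (cross0 a (e7 i)) (cross0 a (e7 j)) := by
      rw [inner_eq_dotProduct, mul_apply, dotProduct]
      exact Finset.sum_congr rfl fun k _ => by rw [transpose_apply, hLij, hLij]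
    rw [this, inner_cross0_cross0', inner_e7, inner_e7, inner_eq_dotProduct a a, inner_e7]
    simp [vecMulVec_apply, one_apply, eq_comm]

/-- The matrix of a linear automorphism of `ℝ⁷`. -/
def matOf (q : E7 →L[ℝ] E7) : Matrix (Fin 7) (Fin 7) ℝ := Matrix.of fun i j => q (e7 j) i

theorem apply_e7 (q : E7 →L[ℝ] E7) (j : Fin 7) : q (e7 j) = ∑ k, matOf q k j • e7 k := by
  conv_lhs => rw [← sum_e7 (q (e7 j))]
  rfl

theorem matOf_comp (q r : E7 →L[ℝ] E7) : matOf (q.comp r) = matOf q * matOf r := by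
  ext i j
  change q (r (e7 j)) i = _
  rw [apply_e7 r, map_sum, Matrix.mul_apply]
  simp [matOf, mul_comm]

theorem matOf_id : matOf (.id ℝ E7) = 1 := by
  ext i j; simp [matOf, Matrix.one_apply]

theorem det_matOf_mul_symm (q : E7 ≃L[ℝ] E7) :
    (matOf (q : E7 →L[ℝ] E7)).det * (matOf (q.symm : E7 →L[ℝ] E7)).det = 1 := by
  rw [← Matrix.det_mul, ← matOf_comp, ContinuousLinearEquiv.coe_comp_coe_symm, matOf_id,
    Matrix.det_one]

open Matrix in
-- Transport of the model formula by the change of basis q: the matrix of the bilinear form changes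
-- by congruence, which produces the factor det(q)⁴ after squaring.
theorem det_auxMat {θ : E7 [⋀^Fin 3]→L[ℝ] ℝ} {q : E7 ≃L[ℝ] E7}
    (hq : ∀ w : Fin 3 → E7, θ (fun i => q (w i)) = phi0 w) (b α : E7) (h : inner ℝ b α ≠ 0) :
    (matOf (q : E7 →L[ℝ] E7)).det ^ 4 * (auxMat θ b α).det ^ 2 =
      (inner ℝ (q.symm b) (q.symm b)) ^ 4 * (inner ℝ b α) ^ 4 := by
  obtain ⟨a, rfl⟩ := q.surjective b
  rw [q.symm_apply_apply]
  set A := matOf (q : E7 →L[ℝ] E7) with hA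
  -- This is the pullback qᵀα of the covector α.
  set α' : E7 := WithLp.toLp 2 fun i => inner ℝ (q (e7 i)) α with hα'
  have hq3 : ∀ u v w, θ ![q u, q v, q w] = phi0 ![u, v, w] := fun u v w => by
    rw [← hq]; congr 1; ext i; fin_cases i <;> rfl
  have e1 : Aᵀ * auxMat θ (q a) α * A = auxMat phi0 a α' := by
    ext i j
    have e2 : α' i = ∑ k, A k i * α k := by
      change inner ℝ (q (e7 i)) α = _
      rw [inner_eq_dotProduct]; rfl
    have e2' : α' j = ∑ k, A k j * α k := by
      change inner ℝ (q (e7 j)) α = _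
      rw [inner_eq_dotProduct]; rfl
    change _ = phi0 ![a, e7 i, e7 j] + α' i * α' j
    have e4 : ∀ j, q (e7 j) = ∑ k, A k j • e7 k := apply_e7 (q : E7 →L[ℝ] E7)
    rw [← hq3, e4 i, e4 j, form3_sum, e2', e2, mul_apply]
    simp only [form3_sum_mid, Finset.mul_sum, mul_apply, Finset.sum_mul, auxMat, of_apply,
      transpose_apply]
    rw [← Finset.sum_add_distrib]
    refine Finset.sum_congr rfl fun k _ => ?_
    rw [← Finset.sum_add_distrib]
    exact Finset.sum_congr rfl fun l _ => by ring
  have e3 : inner ℝ a α' = inner ℝ (q a) α := by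
    conv_rhs => rw [← sum_e7 a, map_sum, sum_inner]
    rw [inner_eq_dotProduct, dotProduct]
    exact Finset.sum_congr rfl fun k _ => by rw [map_smul, inner_smul_left]; rfl
  have e5 := det_auxMat_phi0 a α' (by rwa [e3])
  rw [← e1, det_mul, det_mul, det_transpose, e3] at e5
  rw [← e5]; ring

/-- The determinant of φ₀(qa, ·, ·) + qa ⊗ qa is computed in two ways, directly and by transport
through q. Comparison gives the fourth power of the identity. -/
theorem normSq_of_preserves {q : E7 ≃L[ℝ] E7}
    (hq : ∀ w : Fin 3 → E7, phi0 (fun i => q (w i)) = phi0 w) (a : E7) :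
    |(matOf (q : E7 →L[ℝ] E7)).det| * inner ℝ (q a) (q a) = inner ℝ a a := by
  by_cases ha : a = 0
  · simp [ha]
  have hqa : inner ℝ (q a) (q a) ≠ 0 := by simpa using ha
  have h1 := det_auxMat hq (q a) (q a) hqa
  rw [det_auxMat_phi0 _ _ hqa, q.symm_apply_apply] at h1
  have h2 : (|(matOf (q : E7 →L[ℝ] E7)).det| * inner ℝ (q a) (q a)) ^ 4 = (inner ℝ a a) ^ 4 := by
    apply mul_right_cancel₀ (pow_ne_zero 4 hqa)
    rw [← h1, mul_pow, ← abs_pow, abs_of_nonneg (by positivity)]; ring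
  exact (pow_left_inj₀ (mul_nonneg (abs_nonneg _) real_inner_self_nonneg) real_inner_self_nonneg
    (by norm_num)).mp h2

/-- A linear automorphism that preserves `φ₀` is orthogonal. -/
theorem inner_of_preserves {q : E7 ≃L[ℝ] E7}
    (hq : ∀ w : Fin 3 → E7, phi0 (fun i => q (w i)) = phi0 w) (a b : E7) :
    inner ℝ (q a) (q b) = inner ℝ a b := by
  set d := |(matOf (q : E7 →L[ℝ] E7)).det| with hd
  have hpol : ∀ a b, d * inner ℝ (q a) (q b) = inner ℝ a b := fun a b => by
    have h1 := normSq_of_preserves hq (a + b)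
    have h2 := normSq_of_preserves hq a
    have h3 := normSq_of_preserves hq b
    simp only [map_add, inner_add_left, inner_add_right] at h1
    rw [real_inner_comm a b, real_inner_comm (q a) (q b)] at h1
    rw [← hd] at h1 h2 h3
    linarith
  have hd0 : 0 ≤ d := abs_nonneg _
  -- In matrix form d·qᵀq = 1. Taking determinants yields d⁷·d² = 1, hence d = 1.
  have hm : d • (Matrix.transpose (matOf (q : E7 →L[ℝ] E7)) * matOf (q : E7 →L[ℝ] E7)) = 1 := by
    ext i j
    have h := hpol (e7 i) (e7 j)
    rw [inner_e7] at h
    rw [Matrix.smul_apply, Matrix.mul_apply, smul_eq_mul, Matrix.one_apply]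
    rw [inner_eq_dotProduct] at h
    change d * (∑ k, _) = _ at h
    refine h.trans ?_
    simp [eq_comm]
  have hdet := congrArg Matrix.det hm
  rw [Matrix.det_smul, Matrix.det_mul, Matrix.det_transpose, Matrix.det_one, Fintype.card_fin,
    ← pow_two, ← sq_abs, ← hd] at hdet
  have hd1 : d = 1 := by
    have : d ^ 9 = 1 ^ 9 := by rw [one_pow, ← hdet]; ring
    exact (pow_left_inj₀ hd0 zero_le_one (by norm_num)).mp this
  have := hpol a b
  rwa [hd1, one_mul] at this

theorem cross0_of_preserves {q : E7 ≃L[ℝ] E7}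
    (hq : ∀ w : Fin 3 → E7, phi0 (fun i => q (w i)) = phi0 w) (a b : E7) :
    cross0 (q a) (q b) = q (cross0 a b) := by
  refine ext_inner_right ℝ fun c => ?_
  obtain ⟨c, rfl⟩ := q.surjective c
  rw [inner_of_preserves hq, ← phi0_eq_inner_cross0, ← phi0_eq_inner_cross0, ← hq ![a, b, c]]
  congr 1; ext i; fin_cases i <;> rfl

theorem starPhi0_of_preserves {q : E7 ≃L[ℝ] E7}
    (hq : ∀ w : Fin 3 → E7, phi0 (fun i => q (w i)) = phi0 w) (a b c d : E7) :
    starPhi0 ![q a, q b, q c, q d] = starPhi0 ![a, b, c, d] := by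
  simp only [starPhi0_eq, cross0_of_preserves hq, inner_of_preserves hq]

/-- For a form `θ` with `q^*θ = φ₀`, this is `|q⁻¹ a|² / |det q|`. -/
def conformalNormSq (θ : E7 [⋀^Fin 3]→L[ℝ] ℝ) (a : E7) : ℝ :=
  ((auxMat θ a a).det ^ 2) ^ (1 / 4 : ℝ) / inner ℝ a a

theorem conformalNormSq_eq {θ : E7 [⋀^Fin 3]→L[ℝ] ℝ} {q : E7 ≃L[ℝ] E7}
    (hq : ∀ w : Fin 3 → E7, θ (fun i => q (w i)) = phi0 w) {a : E7} (ha : a ≠ 0) :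
    conformalNormSq θ a =
      |(matOf (q : E7 →L[ℝ] E7)).det|⁻¹ * inner ℝ (q.symm a) (q.symm a) := by
  have haa : inner ℝ a a ≠ 0 := by simpa using ha
  have h1 := det_auxMat hq a a haa
  have hd : (matOf (q : E7 →L[ℝ] E7)).det ≠ 0 := left_ne_zero_of_mul_eq_one (det_matOf_mul_symm q)
  set d := |(matOf (q : E7 →L[ℝ] E7)).det| with hdd
  have hd' : d ≠ 0 := abs_ne_zero.mpr hd
  have hdpos : 0 < d := abs_pos.mpr hd
  have h2 : (auxMat θ a a).det ^ 2 = (d⁻¹ * inner ℝ (q.symm a) (q.symm a) * inner ℝ a a) ^ 4 := by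
    have : (matOf (q : E7 →L[ℝ] E7)).det ^ 4 = d ^ 4 := by
      rw [hdd, ← abs_pow, abs_of_nonneg (by positivity)]
    rw [this] at h1
    rw [mul_pow, mul_pow, inv_pow]
    field_simp
    linarith
  have hpos : 0 ≤ d⁻¹ * inner ℝ (q.symm a) (q.symm a) * inner ℝ a a :=
    mul_nonneg (mul_nonneg (inv_nonneg.mpr hdpos.le) real_inner_self_nonneg) real_inner_self_nonneg
  rw [conformalNormSq, h2, ← Real.rpow_natCast, ← Real.rpow_mul hpos]
  norm_num
  field_simp

/-- Keeps the base of the fourth root in `conformalNormSq` away from zero, where that root is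
smooth. -/
theorem auxMat_det_ne_zero {θ : E7 [⋀^Fin 3]→L[ℝ] ℝ} {q : E7 ≃L[ℝ] E7}
    (hq : ∀ w : Fin 3 → E7, θ (fun i => q (w i)) = phi0 w) {a : E7} (ha : a ≠ 0) :
    (auxMat θ a a).det ^ 2 ≠ 0 := by
  have haa : inner ℝ a a ≠ 0 := by simpa using ha
  have h1 := det_auxMat hq a a haa
  intro h
  rw [h, mul_zero] at h1
  have : inner ℝ (q.symm a) (q.symm a) ≠ 0 := by simpa using ha
  exact (mul_ne_zero (pow_ne_zero 4 this) (pow_ne_zero 4 haa)) h1.symm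

/-- The polarisation of `conformalNormSq` in the standard basis. -/
def conformalGram (θ : E7 [⋀^Fin 3]→L[ℝ] ℝ) : Matrix (Fin 7) (Fin 7) ℝ := Matrix.of fun i j =>
  (conformalNormSq θ (e7 i + e7 j) - conformalNormSq θ (e7 i) - conformalNormSq θ (e7 j)) / 2

theorem e7_ne_zero (i : Fin 7) : e7 i ≠ 0 := by simp

theorem e7_add_ne_zero (i j : Fin 7) : e7 i + e7 j ≠ 0 := by
  intro h
  have := congrArg (fun v : E7 => v i) h
  by_cases hij : i = j <;> simp [hij] at this

open Matrix in
theorem conformalGram_eq {θ : E7 [⋀^Fin 3]→L[ℝ] ℝ} {q : E7 ≃L[ℝ] E7}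
    (hq : ∀ w : Fin 3 → E7, θ (fun i => q (w i)) = phi0 w) :
    conformalGram θ = |(matOf (q : E7 →L[ℝ] E7)).det|⁻¹ •
      ((matOf (q.symm : E7 →L[ℝ] E7))ᵀ * matOf (q.symm : E7 →L[ℝ] E7)) := by
  ext i j
  have h : ((matOf (q.symm : E7 →L[ℝ] E7))ᵀ * matOf (q.symm : E7 →L[ℝ] E7)) i j =
      inner ℝ (q.symm (e7 i)) (q.symm (e7 j)) := by
    rw [inner_eq_dotProduct]; rfl
  rw [Matrix.smul_apply, h, conformalGram, of_apply, conformalNormSq_eq hq (e7_add_ne_zero i j),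
    conformalNormSq_eq hq (e7_ne_zero i), conformalNormSq_eq hq (e7_ne_zero j)]
  simp only [map_add, inner_add_left, inner_add_right, smul_eq_mul]
  rw [real_inner_comm (q.symm (e7 i)) (q.symm (e7 j))]
  ring

/-- The Gram matrix of the metric determined by a form of type `G₂`. -/
def gramOf (θ : E7 [⋀^Fin 3]→L[ℝ] ℝ) : Matrix (Fin 7) (Fin 7) ℝ :=
  (conformalGram θ).det ^ (-1 / 9 : ℝ) • conformalGram θ

open Matrix in
-- Seven powers of |det q|⁻¹ come from the scalar factor and two from the Gram matrix of q⁻¹. This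
-- explains the exponent −1/9 in `gramOf`: it restores exactly the missing factor |det q|.
theorem det_conformalGram {θ : E7 [⋀^Fin 3]→L[ℝ] ℝ} {q : E7 ≃L[ℝ] E7}
    (hq : ∀ w : Fin 3 → E7, θ (fun i => q (w i)) = phi0 w) :
    (conformalGram θ).det = (|(matOf (q : E7 →L[ℝ] E7)).det| ^ 9)⁻¹ := by
  have hd : (matOf (q : E7 →L[ℝ] E7)).det ≠ 0 := left_ne_zero_of_mul_eq_one (det_matOf_mul_symm q)
  have hB : (matOf (q.symm : E7 →L[ℝ] E7)).det = (matOf (q : E7 →L[ℝ] E7)).det⁻¹ :=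
    eq_inv_of_mul_eq_one_right (det_matOf_mul_symm q)
  rw [conformalGram_eq hq, det_smul, det_mul, det_transpose, hB, Fintype.card_fin, ← mul_inv,
    ← pow_two, ← sq_abs]
  have := abs_ne_zero.mpr hd
  field_simp

theorem det_conformalGram_pos {θ : E7 [⋀^Fin 3]→L[ℝ] ℝ} {q : E7 ≃L[ℝ] E7}
    (hq : ∀ w : Fin 3 → E7, θ (fun i => q (w i)) = phi0 w) : 0 < (conformalGram θ).det := by
  have hd : (matOf (q : E7 →L[ℝ] E7)).det ≠ 0 := left_ne_zero_of_mul_eq_one (det_matOf_mul_symm q)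
  rw [det_conformalGram hq]
  have := abs_pos.mpr hd
  positivity

open Matrix in
theorem gramOf_eq {θ : E7 [⋀^Fin 3]→L[ℝ] ℝ} {q : E7 ≃L[ℝ] E7}
    (hq : ∀ w : Fin 3 → E7, θ (fun i => q (w i)) = phi0 w) :
    gramOf θ = (matOf (q.symm : E7 →L[ℝ] E7))ᵀ * matOf (q.symm : E7 →L[ℝ] E7) := by
  have hd : (matOf (q : E7 →L[ℝ] E7)).det ≠ 0 := left_ne_zero_of_mul_eq_one (det_matOf_mul_symm q)
  have hdp := abs_pos.mpr hd
  have h1 : (conformalGram θ).det ^ (-1 / 9 : ℝ) = |(matOf (q : E7 →L[ℝ] E7)).det| := by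
    rw [det_conformalGram hq, ← inv_pow, ← Real.rpow_natCast, ← Real.rpow_mul (by positivity)]
    rw [show ((9 : ℕ) : ℝ) * (-1 / 9) = -1 by norm_num, Real.rpow_neg_one, inv_inv]
  rw [gramOf, h1, conformalGram_eq hq, smul_smul, mul_inv_cancel₀ hdp.ne', one_smul]

theorem det_gramOf_ne_zero {θ : E7 [⋀^Fin 3]→L[ℝ] ℝ} {q : E7 ≃L[ℝ] E7}
    (hq : ∀ w : Fin 3 → E7, θ (fun i => q (w i)) = phi0 w) : (gramOf θ).det ≠ 0 := by
  have hB : (matOf (q.symm : E7 →L[ℝ] E7)).det ≠ 0 :=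
    right_ne_zero_of_mul_eq_one (det_matOf_mul_symm q)
  rw [gramOf_eq hq, Matrix.det_mul, Matrix.det_transpose]
  exact mul_ne_zero hB hB

/-- The cross product determined by a form of type `G₂`. -/
def crossOf (θ : E7 [⋀^Fin 3]→L[ℝ] ℝ) (u v : E7) : E7 :=
  WithLp.toLp 2 (Matrix.mulVec (gramOf θ)⁻¹ fun i => θ ![u, v, e7 i])

open Matrix in
-- The Gram matrix sends the cross product to the covector θ(u, v, ·), so its inverse recovers the
-- cross product. The left side is an explicit formula in θ, hence smooth in θ, whereas q may be an
-- arbitrary pointwise choice.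
theorem crossOf_eq {θ : E7 [⋀^Fin 3]→L[ℝ] ℝ} {q : E7 ≃L[ℝ] E7}
    (hq : ∀ w : Fin 3 → E7, θ (fun i => q (w i)) = phi0 w) (u v : E7) :
    crossOf θ u v = q (cross0 (q.symm u) (q.symm v)) := by
  set c := cross0 (q.symm u) (q.symm v) with hc
  have h1 : (fun i => θ ![u, v, e7 i]) = (gramOf θ) *ᵥ (q c : Fin 7 → ℝ) := by
    ext i
    have e1 : θ ![u, v, e7 i] = inner ℝ (q.symm (e7 i)) c := by
      rw [real_inner_comm, hc, ← phi0_eq_inner_cross0, ← hq]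
      congr 1; ext j; fin_cases j <;> simp
    have e2 : c = ∑ j, (q c) j • q.symm (e7 j) := by
      conv_lhs => rw [← q.symm_apply_apply c, ← sum_e7 (q c), map_sum]
      simp only [map_smul]
    rw [e1]
    conv_lhs => rw [e2, inner_sum]
    rw [mulVec, dotProduct]
    refine Finset.sum_congr rfl fun j _ => ?_
    rw [inner_smul_right, gramOf_eq hq, inner_eq_dotProduct, mul_comm]
    rfl
  rw [crossOf, h1, mulVec_mulVec, nonsing_inv_mul _ (isUnit_iff_ne_zero.mpr (det_gramOf_ne_zero hq)),
    one_mulVec]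

/-! ### Smooth dependence of the cross product on the form. -/

section Smooth

variable {X : Type*} [NormedAddCommGroup X] [NormedSpace ℝ X]

theorem contDiffAt_det {n : Type*} [Fintype n] [DecidableEq n] {A : X → Matrix n n ℝ} {x : X}
    (h : ∀ i j, ContDiffAt ℝ ∞ (fun y => A y i j) x) : ContDiffAt ℝ ∞ (fun y => (A y).det) x := by
  simp only [Matrix.det_apply]
  exact ContDiffAt.sum fun σ _ => (contDiffAt_prod fun i _ => h _ _).const_smul _

theorem contDiffAt_inv_apply {n : Type*} [Fintype n] [DecidableEq n] {A : X → Matrix n n ℝ} {x : X}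
    (h : ∀ i j, ContDiffAt ℝ ∞ (fun y => A y i j) x) (hx : (A x).det ≠ 0) (i j : n) :
    ContDiffAt ℝ ∞ (fun y => (A y)⁻¹ i j) x := by
  simp only [Matrix.inv_def, Matrix.smul_apply, smul_eq_mul, Ring.inverse_eq_inv',
    Matrix.adjugate_apply]
  refine ((contDiffAt_det h).inv hx).mul (contDiffAt_det fun k l => ?_)
  simp only [Matrix.updateRow_apply]
  split_ifs
  · exact contDiffAt_const
  · exact h k l

theorem contDiffAt_form3 {θ : X → E7 [⋀^Fin 3]→L[ℝ] ℝ} {u v w : X → E7} {x : X}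
    (hθ : ContDiffAt ℝ ∞ θ x) (hu : ContDiffAt ℝ ∞ u x) (hv : ContDiffAt ℝ ∞ v x)
    (hw : ContDiffAt ℝ ∞ w x) : ContDiffAt ℝ ∞ (fun y => θ y ![u y, v y, w y]) x := by
  have e : ∀ y, θ y ![u y, v y, w y] =
      ∑ k, w y k * ∑ j, v y j * ∑ i, u y i * θ y ![e7 i, e7 j, e7 k] := fun y => by
    conv_lhs => rw [← sum_e7 (u y), ← sum_e7 (v y), ← sum_e7 (w y)]
    simp only [form3_sum, form3_sum_mid, form3_sum_left]
  simp only [e]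
  have hc : ∀ (f : X → E7), ContDiffAt ℝ ∞ f x → ∀ i, ContDiffAt ℝ ∞ (fun y => f y i) x :=
    fun f hf i => ((EuclideanSpace.proj (𝕜 := ℝ) i).contDiff.contDiffAt).comp x hf
  refine ContDiffAt.sum fun k _ => (hc w hw k).mul <| ContDiffAt.sum fun j _ =>
    (hc v hv j).mul <| ContDiffAt.sum fun i _ => (hc u hu i).mul ?_
  exact ((ContinuousAlternatingMap.apply ℝ E7 ℝ ![e7 i, e7 j, e7 k]).contDiff.contDiffAt).comp x hθ

/-- The formula only involves polynomials, real powers of quantities that do not vanish at x, and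
the inverse of a matrix invertible at x. A frame is needed at the single point x, to verify the
nonvanishing. -/
theorem contDiffAt_crossOf {θ : X → E7 [⋀^Fin 3]→L[ℝ] ℝ} {u v : X → E7} {x : X}
    (hθ : ContDiffAt ℝ ∞ θ x) (hu : ContDiffAt ℝ ∞ u x) (hv : ContDiffAt ℝ ∞ v x)
    {q : E7 ≃L[ℝ] E7} (hq : ∀ w : Fin 3 → E7, θ x (fun i => q (w i)) = phi0 w) :
    ContDiffAt ℝ ∞ (fun y => crossOf (θ y) (u y) (v y)) x := by
  have hN : ∀ a : E7, a ≠ 0 → ContDiffAt ℝ ∞ (fun y => conformalNormSq (θ y) a) x := fun a ha => by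
    refine ContDiffAt.div_const (ContDiffAt.rpow_const_of_ne (ContDiffAt.pow ?_ 2) ?_) _
    · exact contDiffAt_det fun i j =>
        (contDiffAt_form3 hθ contDiffAt_const contDiffAt_const contDiffAt_const).add
          contDiffAt_const
    · exact auxMat_det_ne_zero hq ha
  have hK : ∀ i j, ContDiffAt ℝ ∞ (fun y => conformalGram (θ y) i j) x := fun i j =>
    (((hN _ (e7_add_ne_zero i j)).sub (hN _ (e7_ne_zero i))).sub
      (hN _ (e7_ne_zero j))).div_const 2
  have hG : ∀ i j, ContDiffAt ℝ ∞ (fun y => gramOf (θ y) i j) x := fun i j =>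
    (ContDiffAt.rpow_const_of_ne (contDiffAt_det hK) (det_conformalGram_pos hq).ne').mul (hK i j)
  rw [contDiffAt_euclidean]
  intro i
  change ContDiffAt ℝ ∞ (fun y => ∑ j, (gramOf (θ y))⁻¹ i j * θ y ![u y, v y, e7 j]) x
  refine ContDiffAt.sum fun j _ => (contDiffAt_inv_apply hG (det_gramOf_ne_zero hq) i j).mul ?_
  exact contDiffAt_form3 hθ hu hv contDiffAt_const

end Smooth

/-! ### Pointwise geometry of a `G₂`-structure -/

section Pointwise

variable {M : Type*} [TopologicalSpace M] [ChartedSpace E7 M] (φ : G2Structure M)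

namespace G2Structure

theorem form_frame3 (x : M) (a b c : E7) :
    φ.form x ![φ.frame x a, φ.frame x b, φ.frame x c] = phi0 ![a, b, c] := by
  rw [← φ.form_frame]; congr 1; ext i; fin_cases i <;> rfl

theorem form_eq (x : M) (a b c : TangentSpace (𝓡 7) x) : φ.form x ![a, b, c] =
    inner ℝ (cross0 ((φ.frame x).symm a) ((φ.frame x).symm b)) ((φ.frame x).symm c) := by
  rw [← phi0_eq_inner_cross0, ← form_frame3 φ x]; simp

theorem cross_eq (x : M) (a b : TangentSpace (𝓡 7) x) :
    φ.cross x a b = φ.frame x (cross0 ((φ.frame x).symm a) ((φ.frame x).symm b)) := by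
  conv_rhs => rw [← sum_e7 (cross0 _ _), map_sum]
  refine Finset.sum_congr rfl fun i _ => ?_
  rw [map_smul, form_eq, ContinuousLinearEquiv.symm_apply_apply, inner_e7]

theorem star_eq (x : M) (a b c d : TangentSpace (𝓡 7) x) : φ.star x ![a, b, c, d] =
    starPhi0 ![(φ.frame x).symm a, (φ.frame x).symm b, (φ.frame x).symm c,
      (φ.frame x).symm d] := by
  change starPhi0 _ = _
  congr 1; ext i; fin_cases i <;> rfl

variable {φ} in
/-- The composition of the frames with a linear isomorphism that preserves the form. -/
theorem preserves_aux {x y : M} {P : TangentSpace (𝓡 7) x ≃L[ℝ] TangentSpace (𝓡 7) y}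
    (hP : ∀ w : Fin 3 → TangentSpace (𝓡 7) x, φ.form y (fun i => P (w i)) = φ.form x w)
    (w : Fin 3 → E7) :
    phi0 (fun i => (((φ.frame x).trans P).trans (φ.frame y).symm) (w i)) = phi0 w := by
  rw [← φ.form_frame x w, ← hP, ← φ.form_frame y]
  simp

variable {φ} in
-- The chosen frames at x and y turn P into an automorphism of φ₀, to which `cross0_of_preserves`
-- applies; no compatibility between the two frames is required.
theorem cross_of_preserves {x y : M} {P : TangentSpace (𝓡 7) x ≃L[ℝ] TangentSpace (𝓡 7) y}
    (hP : ∀ w : Fin 3 → TangentSpace (𝓡 7) x, φ.form y (fun i => P (w i)) = φ.form x w)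
    (a b : TangentSpace (𝓡 7) x) : φ.cross y (P a) (P b) = P (φ.cross x a b) := by
  have h := cross0_of_preserves (preserves_aux hP) ((φ.frame x).symm a) ((φ.frame x).symm b)
  simp only [ContinuousLinearEquiv.trans_apply, ContinuousLinearEquiv.apply_symm_apply] at h
  rw [cross_eq, h, cross_eq, ContinuousLinearEquiv.apply_symm_apply]

variable {φ} in
theorem star_of_preserves {x y : M} {P : TangentSpace (𝓡 7) x ≃L[ℝ] TangentSpace (𝓡 7) y}
    (hP : ∀ w : Fin 3 → TangentSpace (𝓡 7) x, φ.form y (fun i => P (w i)) = φ.form x w)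
    (a b c d : TangentSpace (𝓡 7) x) :
    φ.star y ![P a, P b, P c, P d] = φ.star x ![a, b, c, d] := by
  have h := starPhi0_of_preserves (preserves_aux hP) ((φ.frame x).symm a) ((φ.frame x).symm b)
    ((φ.frame x).symm c) ((φ.frame x).symm d)
  simp only [ContinuousLinearEquiv.trans_apply, ContinuousLinearEquiv.apply_symm_apply] at h
  rw [star_eq, h, star_eq]

end G2Structure

end Pointwise

/-! ### Consequences for associative planes -/

/-- The plane spanned by `u`, `v` and `u × v`. -/
abbrev assoc0 (u v : E7) : Submodule ℝ E7 := Submodule.span ℝ {u, v, cross0 u v}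

theorem inner_self_mul_sub_pos {u v : E7} (h : LinearIndependent ℝ ![u, v]) :
    0 < inner ℝ (cross0 u v) (cross0 u v) := by
  rw [real_inner_self_pos]
  intro h0
  rw [LinearIndependent.pair_iff] at h
  have hh := cross0_cross0 u v
  rw [h0] at hh
  have hz : cross0 u 0 = 0 := by simpa using cross0_smul_right 0 u 0
  rw [hz] at hh
  obtain ⟨-, h2⟩ := h (inner ℝ u v) (-inner ℝ u u) (by rw [neg_smul, ← sub_eq_add_neg, ← hh])
  have hu : u = 0 := by simpa using h2
  have := h 1 0 (by simp [hu])
  exact one_ne_zero this.1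

theorem cross0_zero_right (u : E7) : cross0 u 0 = 0 := by
  simpa using cross0_smul_right 0 u 0

/-- The endomorphism that represents `∗φ₀(u, v, ·, ·)`. -/
def starEnd (u v : E7) : E7 →ₗ[ℝ] E7 where
  toFun w := cross0 u (cross0 v w) + (inner ℝ u v : ℝ) • w - (inner ℝ u w : ℝ) • v
  map_add' w z := by
    rw [cross0_add_right, cross0_add_right, inner_add_right, smul_add, add_smul]; abel
  map_smul' r w := by
    rw [cross0_smul_right, cross0_smul_right, inner_smul_right, RingHom.id_apply, smul_sub,
      smul_add, smul_smul, smul_smul, smul_smul, mul_comm r, mul_comm r]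

theorem inner_starEnd (u v w z : E7) : inner ℝ (starEnd u v w) z = starPhi0 ![u, v, w, z] := by
  rw [starPhi0_eq]
  change inner ℝ (cross0 u (cross0 v w) + (inner ℝ u v : ℝ) • w - (inner ℝ u w : ℝ) • v) z = _
  rw [inner_sub_left, inner_add_left, inner_smul_left, inner_smul_left]
  simp

theorem starEnd_apply (u v w : E7) : starEnd u v w =
    cross0 u (cross0 v w) + (inner ℝ u v : ℝ) • w - (inner ℝ u w : ℝ) • v := rfl

theorem starEnd_left (u v : E7) : starEnd u v u = 0 := by
  rw [starEnd_apply, cross0_swap v u, ← neg_one_smul ℝ, cross0_smul_right, cross0_cross0]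
  module

theorem starEnd_right (u v : E7) : starEnd u v v = 0 := by
  rw [starEnd_apply, cross0_self, cross0_zero_right]; module

theorem starEnd_cross0 (u v : E7) : starEnd u v (cross0 u v) = 0 := by
  rw [starEnd_apply, cross0_swap u v, ← neg_one_smul ℝ, cross0_smul_right, cross0_cross0,
    inner_smul_right, real_inner_comm (cross0 v u), inner_cross0_right,
    sub_eq_add_neg, sub_eq_add_neg, ← neg_smul, ← neg_smul, smul_add, cross0_add_right]
  simp only [cross0_smul_right, cross0_self, smul_smul]
  rw [cross0_swap u v, real_inner_comm]
  module

theorem assoc0_le_ker_starEnd (u v : E7) : assoc0 u v ≤ LinearMap.ker (starEnd u v) := by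
  rw [Submodule.span_le]
  rintro w (rfl | rfl | rfl)
  · exact starEnd_left w v
  · exact starEnd_right u w
  · exact starEnd_cross0 u v

/-- For w orthogonal to the plane, u × applied to the kernel equation reduces to d × w = 0 with d =
|u|²v − ⟨u, v⟩u. Since d ⊥ w, this forces |d||w| = 0, and d ≠ 0 by independence. A general w is
reduced to this case by removing its component in the plane, which lies in the kernel. -/
theorem ker_starEnd {u v : E7} (h : LinearIndependent ℝ ![u, v]) :
    LinearMap.ker (starEnd u v) = assoc0 u v := by
  refine le_antisymm (fun w hw => ?_) (assoc0_le_ker_starEnd u v)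
  set c := cross0 u v with hcd
  have key : ∀ w : E7, inner ℝ u w = (0 : ℝ) → inner ℝ v w = (0 : ℝ) → inner ℝ c w = (0 : ℝ) →
      starEnd u v w = 0 → w = 0 := by
    intro w h1 h2 h3 h4
    rw [starEnd_apply, h1, zero_smul, sub_zero] at h4
    have e2 := congrArg (cross0 u) h4
    have h5 : inner ℝ u (cross0 v w) = (0 : ℝ) := by
      rw [real_inner_comm, inner_cross0_swap, cross0_swap v u, inner_neg_left, ← hcd, h3]; simp
    rw [cross0_add_right, cross0_cross0, cross0_smul_right, h5, cross0_zero_right] at e2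
    set d := (inner ℝ u u : ℝ) • v - (inner ℝ u v : ℝ) • u with hd
    have e3 : cross0 d w = 0 := by
      rw [hd, sub_eq_add_neg, ← neg_smul, cross0_add_left, cross0_smul_left, cross0_smul_left,
        neg_smul, ← sub_eq_add_neg, ← neg_eq_zero, ← e2]
      module
    have e4 := inner_cross0_cross0 d w
    have hdw : inner ℝ d w = (0 : ℝ) := by
      rw [hd, inner_sub_left, inner_smul_left, inner_smul_left, h1, h2]; simp
    rw [e3, hdw, inner_zero_left] at e4
    have e5 : inner ℝ d d * inner ℝ w w = (0 : ℝ) := by linarith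
    rcases mul_eq_zero.mp e5 with e6 | e6
    · exfalso
      rw [inner_self_eq_zero, hd] at e6
      rw [LinearIndependent.pair_iff] at h
      have hu := (h (-inner ℝ u v) (inner ℝ u u) (by rw [← e6]; module)).2
      rw [inner_self_eq_zero] at hu
      exact one_ne_zero (h 1 0 (by simp [hu])).1
    · exact inner_self_eq_zero.mp e6
  obtain ⟨a, ha, b, hb, rfl⟩ := (assoc0 u v).exists_add_mem_mem_orthogonal w
  have hm : ∀ z ∈ ({u, v, c} : Set E7), inner ℝ z b = (0 : ℝ) := fun z hz =>
    (Submodule.mem_orthogonal _ _).mp hb z (Submodule.subset_span hz)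
  have hb0 : b = 0 := by
    refine key b (hm u (by simp)) (hm v (by simp)) (hm c (by simp)) ?_
    have h1 : starEnd u v a = 0 := assoc0_le_ker_starEnd u v ha
    have h2 : starEnd u v (a + b) = 0 := hw
    rwa [map_add, h1, zero_add] at h2
  rw [hb0, add_zero]; exact ha

theorem linearIndependent_cross0 {u v : E7} (h : LinearIndependent ℝ ![u, v]) :
    LinearIndependent ℝ ![u, v, cross0 u v] := by
  rw [LinearIndependent.pair_iff] at h
  rw [Fintype.linearIndependent_iff]
  intro g hg
  simp only [Fin.sum_univ_three, Matrix.cons_val] at hg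
  have hc := inner_self_mul_sub_pos (LinearIndependent.pair_iff.mpr h)
  have h2 : g 2 = 0 := by
    have := congrArg (fun z => inner ℝ z (cross0 u v)) hg
    simp only [inner_add_left, inner_smul_left, inner_zero_left, conj_trivial] at this
    rw [real_inner_comm (cross0 u v) u, real_inner_comm (cross0 u v) v, inner_cross0_left,
      inner_cross0_right] at this
    simpa only [mul_zero, zero_add, mul_eq_zero, hc.ne', or_false] using this
  rw [h2, zero_smul, add_zero] at hg
  have := h _ _ hg
  intro i; fin_cases i
  exacts [this.1, this.2, h2]

theorem range_triple {E : Type*} (a b c : E) : range ![a, b, c] = {a, b, c} := by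
  simp [Matrix.range_cons, Matrix.range_empty, Set.insert_def, Set.union_def]

theorem finrank_assoc0 {u v : E7} (h : LinearIndependent ℝ ![u, v]) :
    Module.finrank ℝ (assoc0 u v) = 3 := by
  have := finrank_span_eq_card (linearIndependent_cross0 h)
  rwa [range_triple, Fintype.card_fin] at this

theorem cross0_mem_of_span {s : Set E7} {N : Submodule ℝ E7}
    (h : ∀ a ∈ s, ∀ b ∈ s, cross0 a b ∈ N) {a b : E7} (ha : a ∈ Submodule.span ℝ s)
    (hb : b ∈ Submodule.span ℝ s) : cross0 a b ∈ N := by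
  induction ha using Submodule.span_induction with
  | mem x hx =>
    induction hb using Submodule.span_induction with
    | mem y hy => exact h x hx y hy
    | zero => rw [cross0_zero_right]; exact N.zero_mem
    | add y z _ _ hy hz => rw [cross0_add_right]; exact N.add_mem hy hz
    | smul r y _ hy => rw [cross0_smul_right]; exact N.smul_mem r hy
  | zero => rw [cross0_swap, cross0_zero_right, neg_zero]; exact N.zero_mem
  | add y z _ _ hy hz => rw [cross0_add_left]; exact N.add_mem hy hz
  | smul r y _ hy => rw [cross0_smul_left]; exact N.smul_mem r hy

theorem cross0_mem_assoc0 {u v a b : E7} (ha : a ∈ assoc0 u v) (hb : b ∈ assoc0 u v) :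
    cross0 a b ∈ assoc0 u v := by
  have hu : u ∈ assoc0 u v := Submodule.subset_span (by simp)
  have hv : v ∈ assoc0 u v := Submodule.subset_span (by simp)
  have hc : cross0 u v ∈ assoc0 u v := Submodule.subset_span (by simp)
  have huc : cross0 u (cross0 u v) ∈ assoc0 u v := by
    rw [cross0_cross0]; exact sub_mem (Submodule.smul_mem _ _ hu) (Submodule.smul_mem _ _ hv)
  have hvc : cross0 v (cross0 u v) ∈ assoc0 u v := by
    rw [cross0_swap u v, ← neg_one_smul ℝ, cross0_smul_right, cross0_cross0]
    exact Submodule.smul_mem _ _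
      (sub_mem (Submodule.smul_mem _ _ hv) (Submodule.smul_mem _ _ hu))
  refine cross0_mem_of_span ?_ ha hb
  rintro x (rfl | rfl | rfl) y (rfl | rfl | rfl)
  all_goals first
    | (rw [cross0_self]; exact zero_mem _)
    | assumption
    | (rw [cross0_swap]; apply neg_mem; assumption)

/-- An automorphism of `φ₀` that fixes `u`, `v` and a vector outside their associative plane is the
identity. -/
theorem eq_id_of_preserves {q : E7 ≃L[ℝ] E7}
    (hq : ∀ w : Fin 3 → E7, phi0 (fun i => q (w i)) = phi0 w) {u v w : E7}
    (h : LinearIndependent ℝ ![u, v]) (hw : w ∉ assoc0 u v) (hu : q u = u) (hv : q v = v)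
    (hqw : q w = w) (z : E7) : q z = z := by
  obtain ⟨a, ha, b, hb, rfl⟩ := (assoc0 u v).exists_add_mem_mem_orthogonal w
  have hb0 : b ≠ 0 := by rintro rfl; rw [add_zero] at hw; exact hw ha
  have hqA : ∀ a ∈ assoc0 u v, q a = a := by
    intro a ha
    induction ha using Submodule.span_induction with
    | mem x hx =>
      rcases hx with rfl | rfl | rfl
      · exact hu
      · exact hv
      · rw [← cross0_of_preserves hq, hu, hv]
    | zero => exact map_zero q
    | add y z _ _ hy hz => rw [map_add, hy, hz]
    | smul r y _ hy => rw [map_smul, hy]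
  have hqb : q b = b := by
    rw [map_add, hqA a ha] at hqw; exact add_left_cancel hqw
  have hbo : ∀ z ∈ assoc0 u v, inner ℝ z b = (0 : ℝ) := (Submodule.mem_orthogonal _ _).mp hb
  -- With A the associative plane and b the component of w orthogonal to A, the subspaces A, ℝb and
  -- b × A are independent, of dimensions 3 + 1 + 3 = 7. The automorphism is the identity on each of
  -- them.
  let Λ : (assoc0 u v × ℝ × assoc0 u v) →ₗ[ℝ] E7 :=
    { toFun := fun p => p.1 + p.2.1 • b + cross0 b p.2.2
      map_add' := fun p r => by
        simp only [Prod.fst_add, Prod.snd_add, Submodule.coe_add, add_smul, cross0_add_right]; abel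
      map_smul' := fun t p => by
        simp only [Prod.smul_fst, Prod.smul_snd, Submodule.coe_smul, cross0_smul_right, smul_add,
          smul_smul, RingHom.id_apply, smul_eq_mul] }
  have hΛ : Function.Injective Λ := by
    rw [← LinearMap.ker_eq_bot, LinearMap.ker_eq_bot']
    rintro ⟨⟨x, hx⟩, r, ⟨y, hy⟩⟩ h0
    change x + r • b + cross0 b y = 0 at h0
    have hbb : inner ℝ b b ≠ (0 : ℝ) := by simpa using hb0
    have o1 : ∀ x' ∈ assoc0 u v, inner ℝ (cross0 b y) x' = (0 : ℝ) := fun x' hx' => by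
      rw [cross0_swap, inner_neg_left, inner_cross0_swap,
        hbo _ (cross0_mem_assoc0 hy hx'), neg_zero, neg_zero]
    have e1 := congrArg (fun z => inner ℝ z x) h0
    simp only [inner_add_left, inner_smul_left, conj_trivial, inner_zero_left] at e1
    rw [real_inner_comm x b, hbo x hx, o1 x hx] at e1
    have hx0 : x = 0 := by simpa using e1
    have e2 := congrArg (fun z => inner ℝ z b) h0
    simp only [inner_add_left, inner_smul_left, conj_trivial, inner_zero_left] at e2
    rw [hbo x hx, inner_cross0_left] at e2
    have hr : r = 0 := by simpa [hb0] using e2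
    rw [hx0, hr, zero_smul, add_zero, zero_add] at h0
    have e3 := inner_cross0_cross0 b y
    rw [h0, real_inner_comm y b, hbo y hy, inner_zero_left] at e3
    have hy0 : y = 0 := by
      have : inner ℝ b b * inner ℝ y y = (0 : ℝ) := by linarith
      simpa [hb0] using this
    subst hx0 hr hy0
    rfl
  have hr : LinearMap.range Λ = ⊤ := by
    apply Submodule.eq_top_of_finrank_eq
    rw [LinearMap.finrank_range_of_inj hΛ, Module.finrank_prod, Module.finrank_prod,
      finrank_assoc0 h]
    simp
  obtain ⟨⟨⟨x, hx⟩, r, ⟨y, hy⟩⟩, rfl⟩ := LinearMap.range_eq_top.mp hr z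
  change q (x + r • b + cross0 b y) = x + r • b + cross0 b y
  rw [map_add, map_add, hqA x hx, map_smul, hqb, ← cross0_of_preserves hq, hqb, hqA y hy]

theorem exists_orthonormal_assoc0 {u v : E7} (h : LinearIndependent ℝ ![u, v]) :
    ∃ e : Fin 3 → E7, (∀ i j, inner ℝ (e i) (e j) = if i = j then (1 : ℝ) else 0) ∧
      Submodule.span ℝ (range e) = assoc0 u v ∧ phi0 e = 1 := by
  have hu : u ≠ 0 := h.ne_zero 0
  set d := v - ((inner ℝ u v : ℝ) / inner ℝ u u) • u with hd
  have huu : (inner ℝ u u : ℝ) ≠ 0 := by simpa using hu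
  have hd0 : d ≠ 0 := fun h0 => by
    rw [LinearIndependent.pair_iff] at h
    have := (h (-(inner ℝ u v / inner ℝ u u)) 1 (by rw [← h0, hd]; module)).2
    exact one_ne_zero this
  have hud : inner ℝ u d = (0 : ℝ) := by
    rw [hd, inner_sub_right, inner_smul_right]; field_simp; ring
  set a := ‖u‖⁻¹ • u with ha
  set b := ‖d‖⁻¹ • d with hb
  have haa : inner ℝ a a = (1 : ℝ) := by
    rw [real_inner_self_eq_norm_sq, ha, norm_smul, norm_inv, norm_norm,
      inv_mul_cancel₀ (norm_ne_zero_iff.mpr hu), one_pow]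
  have hbb : inner ℝ b b = (1 : ℝ) := by
    rw [real_inner_self_eq_norm_sq, hb, norm_smul, norm_inv, norm_norm,
      inv_mul_cancel₀ (norm_ne_zero_iff.mpr hd0), one_pow]
  have hab : inner ℝ a b = (0 : ℝ) := by
    rw [ha, hb, inner_smul_left, inner_smul_right, hud]; simp
  have hcc : inner ℝ (cross0 a b) (cross0 a b) = (1 : ℝ) := by
    rw [inner_cross0_cross0, haa, hbb, hab]; norm_num
  have hba : inner ℝ b a = (0 : ℝ) := by rw [real_inner_comm, hab]
  have h1 := inner_cross0_left a b
  have h2 := inner_cross0_right a b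
  have h1' : inner ℝ a (cross0 a b) = (0 : ℝ) := by rw [real_inner_comm, h1]
  have h2' : inner ℝ b (cross0 a b) = (0 : ℝ) := by rw [real_inner_comm, h2]
  have horth : ∀ i j, inner ℝ ((![a, b, cross0 a b] : Fin 3 → E7) i)
      ((![a, b, cross0 a b] : Fin 3 → E7) j) = if i = j then (1 : ℝ) else 0 := by
    intro i j
    fin_cases i <;> fin_cases j
    exacts [haa, hab, h1', hba, hbb, h2', h1, h2, hcc]
  refine ⟨![a, b, cross0 a b], horth, ?_, ?_⟩
  · have hlin : LinearIndependent ℝ ![a, b, cross0 a b] :=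
      (orthonormal_iff_ite.mpr horth).linearIndependent
    have hfin := finrank_span_eq_card hlin
    have hua : u ∈ assoc0 u v := Submodule.subset_span (by simp)
    have hva : v ∈ assoc0 u v := Submodule.subset_span (by simp)
    have hma : a ∈ assoc0 u v := Submodule.smul_mem _ _ hua
    have hmb : b ∈ assoc0 u v :=
      Submodule.smul_mem _ _ (sub_mem hva (Submodule.smul_mem _ _ hua))
    apply Submodule.eq_of_le_of_finrank_eq
    · rw [Submodule.span_le, range_triple]
      rintro x (rfl | rfl | rfl)
      exacts [hma, hmb, cross0_mem_assoc0 hma hmb]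
    · rw [hfin, finrank_assoc0 h, Fintype.card_fin]
  · rw [phi0_eq_inner_cross0, hcc]

/-- The condition φ₀(e) = 1 is the equality case of Cauchy–Schwarz for ⟨e₀ × e₁, e₂⟩, so e₂ = e₀ ×
e₁, and cyclically. The span is then closed under the cross product and contains u × v; dimensions
agree. -/
theorem span_eq_assoc0 {e : Fin 3 → E7}
    (he : ∀ i j, inner ℝ (e i) (e j) = if i = j then (1 : ℝ) else 0) (hφ : phi0 e = 1) {u v : E7}
    (h : LinearIndependent ℝ ![u, v]) (hu : u ∈ Submodule.span ℝ (range e))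
    (hv : v ∈ Submodule.span ℝ (range e)) : Submodule.span ℝ (range e) = assoc0 u v := by
  have he3 : e = ![e 0, e 1, e 2] := by ext i; fin_cases i <;> rfl
  have hfin := finrank_span_eq_card (orthonormal_iff_ite.mpr he).linearIndependent
  have hunit : ∀ a b c : E7, inner ℝ a a = (1 : ℝ) → inner ℝ b b = (1 : ℝ) →
      inner ℝ a b = (0 : ℝ) → inner ℝ c c = (1 : ℝ) → phi0 ![a, b, c] = 1 → cross0 a b = c := by
    intro a b c ha hb hab hc h1
    rw [phi0_eq_inner_cross0] at h1
    have : inner ℝ (cross0 a b - c) (cross0 a b - c) = (0 : ℝ) := by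
      rw [inner_sub_left, inner_sub_right, inner_sub_right, inner_cross0_cross0, ha, hb, hab, hc,
        real_inner_comm (cross0 a b) c, h1]; norm_num
    exact sub_eq_zero.mp (inner_self_eq_zero.mp this)
  have hu1 : ∀ i, inner ℝ (e i) (e i) = (1 : ℝ) := fun i => by rw [he, if_pos rfl]
  rw [he3] at hφ
  have c01 : cross0 (e 0) (e 1) = e 2 :=
    hunit _ _ _ (hu1 _) (hu1 _) (by rw [he]; rfl) (hu1 _) hφ
  have c12 : cross0 (e 1) (e 2) = e 0 :=
    hunit _ _ _ (hu1 _) (hu1 _) (by rw [he]; rfl) (hu1 _)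
      (by rw [← form3_rotate, hφ])
  have c20 : cross0 (e 2) (e 0) = e 1 :=
    hunit _ _ _ (hu1 _) (hu1 _) (by rw [he]; rfl) (hu1 _)
      (by rw [form3_rotate, hφ])
  have hm : ∀ i, e i ∈ Submodule.span ℝ (range e) := fun i => Submodule.subset_span ⟨i, rfl⟩
  have hcl : cross0 u v ∈ Submodule.span ℝ (range e) := by
    refine cross0_mem_of_span ?_ hu hv
    rintro x ⟨i, rfl⟩ y ⟨j, rfl⟩
    fin_cases i <;> fin_cases j <;> simp only [Fin.zero_eta, Fin.mk_one, Fin.reduceFinMk]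
    · rw [cross0_self]; exact zero_mem _
    · rw [c01]; exact hm 2
    · rw [cross0_swap, c20]; exact neg_mem (hm 1)
    · rw [cross0_swap, c01]; exact neg_mem (hm 2)
    · rw [cross0_self]; exact zero_mem _
    · rw [c12]; exact hm 0
    · rw [c20]; exact hm 1
    · rw [cross0_swap, c12]; exact neg_mem (hm 0)
    · rw [cross0_self]; exact zero_mem _
  symm
  apply Submodule.eq_of_le_of_finrank_eq
  · rw [Submodule.span_le]
    rintro x (rfl | rfl | rfl)
    exacts [hu, hv, hcl]
  · rw [hfin, finrank_assoc0 h, Fintype.card_fin]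

theorem starPhi0_swap (u v a b : E7) :
    starPhi0 ![u, v, a, b] = -starPhi0 ![u, v, b, a] := by
  have h : ∀ z, starPhi0 ![u, v, z, z] = 0 := fun z =>
    starPhi0.map_eq_zero_of_eq ![u, v, z, z] (i := 2) (j := 3) rfl (by decide)
  have h1 := h (a + b)
  have h2 := h a
  have h3 := h b
  simp only [← inner_starEnd, map_add, inner_add_left, inner_add_right] at *
  linarith

/-- A three-dimensional complement to an associative plane inside a hyperplane is not isotropic. -/
theorem exists_starPhi0_ne_zero {u v : E7} {w : Fin 3 → E7}
    (h : LinearIndependent ℝ ![u, v, cross0 u v, w 0, w 1, w 2]) :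
    ∃ i j, starPhi0 ![u, v, w i, w j] ≠ 0 := by
  by_contra! hz
  have huv : LinearIndependent ℝ ![u, v] := by
    have := h.comp ![(0 : Fin 6), 1] (by decide)
    convert this using 1
    ext i; fin_cases i <;> rfl
  set f := ![u, v, cross0 u v, w 0, w 1, w 2] with hf
  set S := Submodule.span ℝ (range f) with hS
  have hfin : Module.finrank ℝ S = 6 := by
    rw [hS, finrank_span_eq_card h, Fintype.card_fin]
  have hfin' : Module.finrank ℝ Sᗮ = 1 := by
    have := S.finrank_add_finrank_orthogonal
    rw [hfin, finrank_euclideanSpace_fin] at this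
    omega
  have hanti := starPhi0_swap u v
  -- If all values vanish, the vectors that represent ∗φ₀(u, v, wᵢ, ·) are orthogonal to the whole
  -- hyperplane S, hence lie on one line.
  have hmem : ∀ i, starEnd u v (w i) ∈ Sᗮ := by
    intro i
    rw [Submodule.mem_orthogonal']
    intro z hz'
    induction hz' using Submodule.span_induction with
    | mem x hx =>
      obtain ⟨k, rfl⟩ := hx
      rw [inner_starEnd]
      have h0 : ∀ a, starEnd u v a = 0 → starPhi0 ![u, v, w i, a] = 0 := fun a ha => by
        rw [hanti, ← inner_starEnd, ha, inner_zero_left, neg_zero]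
      have hk : f k = u ∨ f k = v ∨ f k = cross0 u v ∨ ∃ j, f k = w j := by
        match k with
        | 0 => exact Or.inl rfl
        | 1 => exact Or.inr (Or.inl rfl)
        | 2 => exact Or.inr (Or.inr (Or.inl rfl))
        | 3 => exact Or.inr (Or.inr (Or.inr ⟨0, rfl⟩))
        | 4 => exact Or.inr (Or.inr (Or.inr ⟨1, rfl⟩))
        | 5 => exact Or.inr (Or.inr (Or.inr ⟨2, rfl⟩))
      rcases hk with hk | hk | hk | ⟨j, hk⟩ <;> rw [hk]
      exacts [h0 _ (starEnd_left u v), h0 _ (starEnd_right u v), h0 _ (starEnd_cross0 u v), hz i j]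
    | zero => exact inner_zero_right _
    | add y z _ _ hy hz => rw [inner_add_right, hy, hz, add_zero]
    | smul r y _ hy => rw [inner_smul_right, hy, mul_zero]
  -- Three vectors on a line are dependent. The corresponding combination of the wᵢ is in the kernel
  -- of `starEnd`, that is in the associative plane, against the independence of the six vectors.
  have hdep : ¬ LinearIndependent ℝ (fun i => (⟨starEnd u v (w i), hmem i⟩ : Sᗮ)) := by
    intro hi
    have := hi.fintype_card_le_finrank
    rw [hfin', Fintype.card_fin] at this
    omega
  rw [Fintype.not_linearIndependent_iff] at hdep
  obtain ⟨g, hg, i, hi⟩ := hdep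
  have hg' : starEnd u v (∑ i, g i • w i) = 0 := by
    rw [map_sum]
    simp only [map_smul]
    have := congrArg (Submodule.subtype Sᗮ) hg
    simpa using this
  have hA : ∑ i, g i • w i ∈ assoc0 u v := by
    rw [← ker_starEnd huv]; exact hg'
  obtain ⟨r, s, t, hrst⟩ := Submodule.mem_span_triple.mp hA
  rw [Fintype.linearIndependent_iff] at h
  have := h ![r, s, t, -g 0, -g 1, -g 2] (by
    rw [Fin.sum_univ_three] at hrst
    rw [hf]
    simp only [Fin.sum_univ_succ, Matrix.cons_val_zero, Matrix.cons_val_succ, Finset.univ_eq_empty,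
      Finset.sum_empty]
    rw [← sub_eq_zero] at hrst
    refine Eq.trans ?_ hrst
    simp; module)
  apply hi
  fin_cases i
  · simpa using this 3
  · simpa using this 4
  · simpa using this 5

/-! ### The exponential map of `𝕋² × SU(2)` -/

/-- The Lie algebra of `𝕋² × SU(2)`, in coordinates. -/
abbrev Par := (ℝ × ℝ) × (Fin 3 → ℝ)

namespace AdaptedBasis

variable (A : AdaptedBasis)

/-- The imaginary quaternion with given coordinates. -/
def vec : (Fin 3 → ℝ) →ₗ[ℝ] ℍ[ℝ] := Fintype.linearCombination ℝ A.v

theorem vec_apply (b : Fin 3 → ℝ) : A.vec b = ∑ i, b i • A.v i := rfl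

theorem vec_re (b : Fin 3 → ℝ) : (A.vec b).re = 0 := by
  simp [vec_apply, Fin.sum_univ_three, A.v_re]

theorem vec_single (i : Fin 3) : A.vec (Pi.single i 1) = A.v i := by
  simp [vec_apply, Pi.single_apply]

theorem vec_injective : Function.Injective A.vec :=
  A.v_indep.fintypeLinearCombination_injective

/-- The real part, as a linear map. -/
def reLin : ℍ[ℝ] →ₗ[ℝ] ℝ where
  toFun q := q.re
  map_add' _ _ := rfl
  map_smul' _ _ := rfl

theorem finrank_ker_reLin : Module.finrank ℝ (LinearMap.ker reLin) = 3 := by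
  have h := reLin.finrank_range_add_finrank_ker
  have hs : LinearMap.range reLin = ⊤ := LinearMap.range_eq_top.mpr fun r => ⟨⟨r, 0, 0, 0⟩, rfl⟩
  rw [hs, finrank_top, Module.finrank_self, Quaternion.finrank_eq_four] at h
  omega

theorem exists_vec {w : ℍ[ℝ]} (hw : w.re = 0) : ∃ b, A.vec b = w := by
  have h : LinearMap.range A.vec = LinearMap.ker reLin := by
    apply Submodule.eq_of_le_of_finrank_eq
    · rintro _ ⟨b, rfl⟩
      exact A.vec_re b
    · rw [finrank_ker_reLin, LinearMap.finrank_range_of_inj A.vec_injective]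
      simp
  have : w ∈ LinearMap.range A.vec := by rw [h]; exact hw
  exact this

/-- The exponential map of `𝕋² × SU(2)`. -/
def expG (p : Par) : Grp := ((Circle.exp p.1.1, Circle.exp p.1.2),
  ⟨NormedSpace.exp (A.vec p.2), by simp [Quaternion.norm_exp, A.vec_re]⟩)

theorem expG_zero : A.expG 0 = 1 := by
  simp only [expG, Prod.fst_zero, Prod.snd_zero, Circle.exp_zero, map_zero, NormedSpace.exp_zero]
  rfl

theorem torusExp_eq (a : ℝ × ℝ) (t : ℝ) : torusExp a t = A.expG (t • (a, 0)) := by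
  refine Prod.ext rfl (Subtype.ext ?_)
  simp [torusExp, expG]

theorem su2Exp_eq (b : Fin 3 → ℝ) (t : ℝ) :
    su2Exp (A.vec b) (A.vec_re b) t = A.expG (t • (0, b)) := by
  refine Prod.ext ?_ (Subtype.ext ?_)
  · simp [su2Exp, expG]; rfl
  · simp [su2Exp, expG]

theorem expG_add_smul (s t : ℝ) (p : Par) :
    A.expG ((s + t) • p) = A.expG (s • p) * A.expG (t • p) := by
  refine Prod.ext (Prod.ext ?_ ?_) (Subtype.ext ?_)
  · simp [expG, add_mul, Circle.exp_add]
  · simp [expG, add_mul, Circle.exp_add]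
  · simp only [expG, add_smul, Prod.snd_add, map_add]
    let +nondep : NormedAlgebra ℚ ℍ := .restrictScalars ℚ ℝ ℍ
    rw [NormedSpace.exp_add_of_commute]
    · rfl
    · simp only [Prod.smul_snd, map_smul]
      exact ((Commute.refl _).smul_left s).smul_right t

theorem expG_neg (p : Par) : A.expG (-p) = (A.expG p)⁻¹ := by
  have := A.expG_add_smul (-1) 1 p
  rw [neg_add_cancel, zero_smul, A.expG_zero, one_smul, neg_one_smul] at this
  exact eq_inv_of_mul_eq_one_left this.symm

theorem expG_torus_add (a b : ℝ × ℝ) : A.expG (a + b, 0) = A.expG (a, 0) * A.expG (b, 0) := by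
  refine Prod.ext (Prod.ext ?_ ?_) (Subtype.ext ?_)
  · simp [expG, Circle.exp_add]
  · simp [expG, Circle.exp_add]
  · simp [expG]

theorem expG_torus_snd (a : ℝ × ℝ) : (A.expG (a, 0)).2 = 1 := by
  apply Subtype.ext; simp [expG]

theorem exists_expG_torus (a : Torus) : ∃ b : ℝ × ℝ, A.expG (b, 0) = (a, 1) := by
  refine ⟨(Complex.arg a.1, Complex.arg a.2), ?_⟩
  refine Prod.ext (Prod.ext ?_ ?_) (A.expG_torus_snd _)
  · exact Circle.exp_arg a.1
  · exact Circle.exp_arg a.2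

/-- Polar form: a unit quaternion is cos θ + (sin θ) n with n an imaginary unit, the exponential of
θn. The real quaternions ±1 are treated apart, since n is not determined there. -/
theorem exists_exp_eq (s : SU2) : ∃ w : ℍ[ℝ], w.re = 0 ∧ NormedSpace.exp w = s := by
  obtain ⟨q, hq⟩ := s
  have hn : q.re ^ 2 + (q.imI ^ 2 + q.imJ ^ 2 + q.imK ^ 2) = 1 := by
    have h1 : ‖q‖ = 1 := by simpa using hq
    have h2 := Quaternion.normSq_eq_norm_mul_self q
    rw [Quaternion.normSq_def', h1] at h2
    linarith
  have him : ‖q.im‖ ^ 2 = q.imI ^ 2 + q.imJ ^ 2 + q.imK ^ 2 := by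
    have h2 := Quaternion.normSq_eq_norm_mul_self q.im
    rw [Quaternion.normSq_def'] at h2
    simp at h2
    nlinarith
  by_cases h0 : q.im = 0
  · rw [h0, norm_zero] at him
    have hre : q.re ^ 2 = 1 := by nlinarith
    have hqr : q = (q.re : ℍ[ℝ]) := by
      conv_lhs => rw [← Quaternion.re_add_im q, h0, add_zero]
    rcases (show q.re = 1 ∨ q.re = -1 by
        rcases mul_eq_zero.mp (show (q.re - 1) * (q.re + 1) = 0 by nlinarith) with h | h
        · left; linarith
        · right; linarith) with h | h
    · refine ⟨0, rfl, ?_⟩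
      change _ = q
      rw [NormedSpace.exp_zero, hqr, h]; rfl
    -- Any imaginary quaternion of norm π exponentiates to −1.
    · let w : ℍ[ℝ] := ⟨0, Real.pi, 0, 0⟩
      have hnorm : ‖w‖ = Real.pi := by
        have h2 := Quaternion.normSq_eq_norm_mul_self w
        rw [Quaternion.normSq_def'] at h2
        simp only [w] at h2
        nlinarith [norm_nonneg w, Real.pi_pos]
      refine ⟨w, rfl, ?_⟩
      change _ = q
      rw [Quaternion.exp_of_re_eq_zero w rfl, hnorm, hqr, h]
      simp
  · have hpos : 0 < ‖q.im‖ := norm_pos_iff.mpr h0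
    set θ := Real.arccos q.re with hθ
    have hle : q.re ^ 2 ≤ 1 := by nlinarith [sq_nonneg ‖q.im‖]
    have hlt := abs_le.mp ((sq_le_one_iff_abs_le_one _).mp hle)
    have hcos : Real.cos θ = q.re := Real.cos_arccos hlt.1 hlt.2
    have hsin : Real.sin θ = ‖q.im‖ := by
      rw [hθ, Real.sin_arccos, show 1 - q.re ^ 2 = ‖q.im‖ ^ 2 by nlinarith,
        Real.sqrt_sq hpos.le]
    have hθ0 : 0 ≤ θ := Real.arccos_nonneg _
    have hθp : θ ≠ 0 := fun h => by rw [h, Real.sin_zero] at hsin; exact hpos.ne hsin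
    have hwn : ‖(θ / ‖q.im‖) • q.im‖ = θ := by
      rw [norm_smul, Real.norm_of_nonneg (by positivity)]
      field_simp
    refine ⟨(θ / ‖q.im‖) • q.im, by simp, ?_⟩
    rw [Quaternion.exp_of_re_eq_zero _ (by simp), hwn, hcos, hsin, smul_smul]
    have : ‖q.im‖ / θ * (θ / ‖q.im‖) = 1 := by field_simp
    rw [this, one_smul, Quaternion.re_add_im]

/-- Every group element lies on a one-parameter subgroup, so the invariance of a function can be
tested by differentiating along such subgroups. -/
theorem expG_surjective : Function.Surjective A.expG := by
  rintro ⟨a, s⟩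
  obtain ⟨w, hw, hs⟩ := exists_exp_eq s
  obtain ⟨b, hb⟩ := A.exists_vec hw
  obtain ⟨c, hc⟩ := A.exists_expG_torus a
  refine ⟨(c, b), Prod.ext ?_ (Subtype.ext ?_)⟩
  · have h := congrArg (fun g : Grp => g.1) hc
    exact h
  · change NormedSpace.exp (A.vec b) = _
    rw [hb, hs]

/-- Conjugation by `g` on the Lie algebra. -/
theorem exists_conj (g : Grp) (p : Par) :
    ∃ b : Fin 3 → ℝ, A.vec b = g.2 * A.vec p.2 * (g.2 : ℍ[ℝ])⁻¹ ∧
      ∀ t : ℝ, g * A.expG (t • p) * g⁻¹ = A.expG (t • (p.1, b)) := by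
  have hn : ‖(g.2 : ℍ[ℝ])‖ = 1 := by simp
  have hg : (g.2 : ℍ[ℝ]) ≠ 0 := by rw [← norm_ne_zero_iff, hn]; exact one_ne_zero
  have hre : ((g.2 : ℍ[ℝ]) * A.vec p.2 * (g.2 : ℍ[ℝ])⁻¹).re = 0 := by
    have hinv : (g.2 : ℍ[ℝ])⁻¹ = star (g.2 : ℍ[ℝ]) := by
      rw [Quaternion.instInv]
      simp [Quaternion.normSq_eq_norm_mul_self, hn]
    rw [hinv]
    have := A.vec_re p.2
    simp [this]
    ring
  obtain ⟨b, hb⟩ := A.exists_vec hre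
  refine ⟨b, hb, fun t => Prod.ext (Prod.ext ?_ ?_) (Subtype.ext ?_)⟩
  · simp [expG, mul_comm]
  · simp [expG, mul_comm]
  · change (g.2 : ℍ[ℝ]) * NormedSpace.exp (A.vec (t • p.2)) * (g.2 : ℍ[ℝ])⁻¹ =
      NormedSpace.exp (A.vec (t • b))
    let +nondep : NormedAlgebra ℚ ℍ := .restrictScalars ℚ ℝ ℍ
    have h := NormedSpace.exp_units_conj (Units.mk0 (g.2 : ℍ[ℝ]) hg) (A.vec (t • p.2))
    rw [Units.val_inv_eq_inv_val, Units.val_mk0] at h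
    rw [← h, map_smul, map_smul, hb]
    simp

/-- An element of `SU(2)` that centralises the Lie algebra is central. -/
theorem mul_comm_of_conj {s : SU2} (h : ∀ b, (s : ℍ[ℝ]) * A.vec b = A.vec b * s) (t : SU2) :
    s * t = t * s := by
  obtain ⟨w, hw, ht⟩ := exists_exp_eq t
  obtain ⟨b, rfl⟩ := A.exists_vec hw
  apply Subtype.ext
  change (s : ℍ[ℝ]) * t = t * s
  rw [← ht]
  let +nondep : NormedAlgebra ℚ ℍ := .restrictScalars ℚ ℝ ℍ
  exact (show Commute (s : ℍ[ℝ]) (A.vec b) from h b).exp_right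

/-- An element exp w commutes with its logarithm w. If the logarithm found is zero, the element is 1
and commutes with everything. -/
theorem exists_fixed (s : SU2) : (∀ b, (s : ℍ[ℝ]) * A.vec b = A.vec b * s) ∨
    ∃ b, b ≠ 0 ∧ (s : ℍ[ℝ]) * A.vec b * (s : ℍ[ℝ])⁻¹ = A.vec b := by
  obtain ⟨w, hw, hs⟩ := exists_exp_eq s
  obtain ⟨b, hb⟩ := A.exists_vec hw
  have hn : ‖(s : ℍ[ℝ])‖ = 1 := by simp
  have hg : (s : ℍ[ℝ]) ≠ 0 := by rw [← norm_ne_zero_iff, hn]; exact one_ne_zero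
  by_cases hb0 : b = 0
  · left
    intro c
    rw [← hs, ← hb, hb0, map_zero, NormedSpace.exp_zero, one_mul, mul_one]
  · right
    refine ⟨b, hb0, ?_⟩
    let +nondep : NormedAlgebra ℚ ℍ := .restrictScalars ℚ ℝ ℍ
    have : (s : ℍ[ℝ]) * A.vec b = A.vec b * s := by
      rw [← hs, hb]; exact ((Commute.refl w).exp_left).eq
    rw [this, mul_assoc, mul_inv_cancel₀ hg, mul_one]

theorem contMDiff_expG : ContMDiff 𝓘(ℝ, Par) modelGrp ∞ A.expG := by
  have hl : ∀ (f : Par → ℝ), ContDiff ℝ ∞ f → ContMDiff 𝓘(ℝ, Par) (𝓡 1) ∞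
      (fun p => Circle.exp (f p)) := fun f hf => contMDiff_circleExp.comp hf.contMDiff
  refine ((hl _ (contDiff_fst.comp contDiff_fst)).prodMk
    (hl _ (contDiff_snd.comp contDiff_fst))).prodMk ?_
  have hv : ContDiff ℝ ∞ fun p : Par => NormedSpace.exp (A.vec p.2) := by
    have h1 : ContDiff ℝ ∞ (fun p : Par => A.vec p.2) :=
      (LinearMap.toContinuousLinearMap A.vec).contDiff.comp contDiff_snd
    have h2 : ContDiff ℝ ∞ (NormedSpace.exp : ℍ[ℝ] → ℍ[ℝ]) :=
      contDiff_iff_contDiffAt.mpr fun x => (NormedSpace.exp_analytic (𝕂 := ℝ) x).contDiffAt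
    exact h2.comp h1
  exact ContMDiff.codRestrict_sphere (n := 3) hv.contMDiff _

end AdaptedBasis

/-! ### Velocities of curves -/

section Velocity

variable {M : Type*} [TopologicalSpace M] [ChartedSpace E7 M]

/-- The curve `c` has velocity `v` at time `s`. -/
def HasVelocity (c : ℝ → M) (s : ℝ) (v : E7) : Prop :=
  HasMFDerivAt 𝓘(ℝ, ℝ) (𝓡 7) c s ((1 : ℝ →L[ℝ] ℝ).smulRight v : ℝ →L[ℝ] E7)

variable {c d : ℝ → M} {s : ℝ} {v : E7}

theorem hasVelocity_of_hasMFDerivAt {L : ℝ →L[ℝ] E7} (h : HasMFDerivAt 𝓘(ℝ, ℝ) (𝓡 7) c s L) :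
    HasVelocity c s (L 1) := by
  have e : L = (1 : ℝ →L[ℝ] ℝ).smulRight (L 1) := by ext1; simp
  exact HasMFDerivAt.congr_mfderiv h e

theorem HasVelocity.velocity_eq (h : HasVelocity c s v) : velocity c s = v := by
  have h1 : velocity c s = ((1 : ℝ →L[ℝ] ℝ).smulRight v : ℝ →L[ℝ] E7) 1 :=
    congrArg (fun L : ℝ →L[ℝ] E7 => L 1) (HasMFDerivAt.mfderiv h)
  exact h1.trans (one_smul ℝ v)

theorem HasVelocity.congr_vel {w : E7} (h : HasVelocity c s v) (e : v = w) : HasVelocity c s w :=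
  e ▸ h

theorem hasVelocity_velocity (h : MDifferentiableAt 𝓘(ℝ, ℝ) (𝓡 7) c s) :
    HasVelocity c s (velocity c s) :=
  hasVelocity_of_hasMFDerivAt h.hasMFDerivAt

theorem HasVelocity.continuousAt (h : HasVelocity c s v) : ContinuousAt c s := HasMFDerivAt.continuousAt h

theorem HasVelocity.unique {w : E7} (h : HasVelocity c s v) (h' : HasVelocity c s w) : v = w :=
  h.velocity_eq.symm.trans h'.velocity_eq

theorem HasVelocity.congr (h : HasVelocity c s v) (hcd : d =ᶠ[𝓝 s] c) : HasVelocity d s v := by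
  have h0 : HasMFDerivAt 𝓘(ℝ, ℝ) (𝓡 7) c s ((1 : ℝ →L[ℝ] ℝ).smulRight v : ℝ →L[ℝ] E7) := h
  exact HasMFDerivAt.congr_of_eventuallyEq h0 hcd

theorem HasVelocity.comp {σ : ℝ → ℝ} {σ' : ℝ} (h : HasVelocity c (σ s) v)
    (hσ : HasDerivAt σ σ' s) : HasVelocity (c ∘ σ) s (σ' • v) := by
  have h2 := hasVelocity_of_hasMFDerivAt
    (L := ((1 : ℝ →L[ℝ] ℝ).smulRight v : ℝ →L[ℝ] E7).comp (.toSpanSingleton ℝ σ'))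
    (HasMFDerivAt.comp s h hσ.hasFDerivAt.hasMFDerivAt)
  refine h2.congr_vel ?_
  simp

theorem HasVelocity.hasMFDerivAt_comp {N : Type*} [TopologicalSpace N] [ChartedSpace E7 N]
    {f : M → N} {L : E7 →L[ℝ] E7} (h : HasVelocity c s v)
    (hf : HasMFDerivAt (𝓡 7) (𝓡 7) f (c s) L) : HasVelocity (f ∘ c) s (L v) := by
  have h2 := hasVelocity_of_hasMFDerivAt (HasMFDerivAt.comp s hf h)
  exact h2.congr_vel (congrArg L (one_smul ℝ v))

theorem HasVelocity.hasDerivAt_comp {f : M → ℝ} (h : HasVelocity c s v)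
    (hf : MDifferentiableAt (𝓡 7) 𝓘(ℝ, ℝ) f (c s)) :
    HasDerivAt (f ∘ c) (mvfderiv (𝓡 7) f (c s) v) s := by
  obtain ⟨L, hL⟩ : ∃ L : E7 →L[ℝ] ℝ, HasMFDerivAt (𝓡 7) 𝓘(ℝ, ℝ) f (c s) L ∧
      mvfderiv (𝓡 7) f (c s) v = L v := ⟨_, hf.hasMFDerivAt, rfl⟩
  have h3 : HasFDerivAt (f ∘ c) (L.comp ((1 : ℝ →L[ℝ] ℝ).smulRight v : ℝ →L[ℝ] E7)) s :=
    HasMFDerivAt.hasFDerivAt (HasMFDerivAt.comp s hL.1 h)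
  rw [hL.2]
  simpa using h3.hasDerivAt

theorem hasVelocity_const (x : M) (s : ℝ) : HasVelocity (fun _ => x) s 0 :=
  hasVelocity_of_hasMFDerivAt (L := 0) (hasMFDerivAt_const x s)

end Velocity

/-! ### The infinitesimal action -/

section Action

variable {M : Type*} [TopologicalSpace M] [ChartedSpace E7 M] [MulAction Grp M]

/-- The infinitesimal action of the Lie algebra. -/
def inf (A : AdaptedBasis) (x : M) : Par →L[ℝ] E7 :=
  mfderiv 𝓘(ℝ, Par) (𝓡 7) (fun p => A.expG p • x) 0

/-- The differential of the action of an element of the group. -/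
def dact (g : Grp) (x : M) : E7 →L[ℝ] E7 := mfderiv (𝓡 7) (𝓡 7) (fun y : M => g • y) x

/-- The differential of the action map at the neutral element. -/
def infSnd (A : AdaptedBasis) (x : M) : Par × E7 →L[ℝ] E7 := (inf A x).comp (.fst ℝ Par E7) + .snd ℝ Par E7

variable [ContMDiffSMul modelGrp (𝓡 7) ∞ Grp M] (A : AdaptedBasis)

theorem contMDiff_act (M : Type*) [TopologicalSpace M] [ChartedSpace E7 M] [MulAction Grp M]
    [ContMDiffSMul modelGrp (𝓡 7) ∞ Grp M] :
    ContMDiff (𝓘(ℝ, Par).prod (𝓡 7)) (𝓡 7) ∞ (fun z : Par × M => A.expG z.1 • z.2) :=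
  (contMDiff_smul (I := modelGrp) (I' := 𝓡 7) (n := ∞) (G := Grp) (M := M)).comp
    ((A.contMDiff_expG.comp contMDiff_fst).prodMk contMDiff_snd)

theorem contMDiff_smul_const (g : Grp) : ContMDiff (𝓡 7) (𝓡 7) ∞ (fun x : M => g • x) :=
  (contMDiff_smul (I := modelGrp) (I' := 𝓡 7) (n := ∞) (G := Grp) (M := M)).comp
    (contMDiff_const.prodMk contMDiff_id)

theorem hasMFDerivAt_dact (g : Grp) (x : M) :
    HasMFDerivAt (𝓡 7) (𝓡 7) (fun x : M => g • x) x (dact g x) :=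
  ((contMDiff_smul_const g).mdifferentiableAt (by simp)).hasMFDerivAt

theorem hasMFDerivAt_act (x : M) :
    HasMFDerivAt (𝓘(ℝ, Par).prod (𝓡 7)) (𝓡 7) (fun z : Par × M => A.expG z.1 • z.2) (0, x)
      (infSnd A x) := by
  have h := (contMDiff_act A M).mdifferentiableAt (x := (0, x)) (by simp)
  refine h.hasMFDerivAt.congr_mfderiv ?_
  have h2 := mfderiv_prod_eq_add_comp h
  rw [h2]
  have e : (fun z' : M => A.expG (0 : Par) • z') = id := by
    ext z; rw [A.expG_zero, one_smul]; rfl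
  have e2 : (mfderiv (𝓡 7) (𝓡 7) (fun z' : M => A.expG (0 : Par) • z') x : E7 →L[ℝ] E7) =
      .id ℝ E7 := by
    rw [e]; exact mfderiv_id
  have key : ∀ L : E7 →L[ℝ] E7, L = .id ℝ E7 →
      (inf A x).comp (.fst ℝ Par E7) + L.comp (.snd ℝ Par E7) = infSnd A x := by
    rintro _ rfl
    rfl
  exact key _ e2

variable {c : ℝ → M} {s : ℝ} {v : E7}

/-- The differential of the action map is only computed at the neutral element, whence the condition
p s = 0. Other times are reduced to this one by splitting off a constant group element. -/
theorem HasVelocity.act (h : HasVelocity c s v) {p : ℝ → Par} {q : Par} (hp : HasDerivAt p q s)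
    (hp0 : p s = 0) : HasVelocity (fun t => A.expG (p t) • c t) s (inf A (c s) q + v) := by
  have h1 := HasMFDerivAt.prodMk hp.hasFDerivAt.hasMFDerivAt h
  have h0 : HasMFDerivAt (𝓘(ℝ, Par).prod (𝓡 7)) (𝓡 7) (fun z : Par × M => A.expG z.1 • z.2)
      ((fun t => (p t, c t)) s) (infSnd A (c s)) := by
    have := hasMFDerivAt_act A (c s)
    rw [← hp0] at this
    exact this
  have h2 := hasVelocity_of_hasMFDerivAt (HasMFDerivAt.comp s h0 h1)
  refine h2.congr_vel ?_
  change inf A (c s) ((1 : ℝ) • q) + (1 : ℝ) • v = _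
  rw [one_smul, one_smul]

theorem HasVelocity.smul (h : HasVelocity c s v) (g : Grp) :
    HasVelocity (fun t => g • c t) s (dact g (c s) v) :=
  h.hasMFDerivAt_comp (hasMFDerivAt_dact g (c s))

/-- The velocity of the orbit of a one-parameter subgroup. -/
theorem hasVelocity_expG (x : M) (p : Par) (s : ℝ) :
    HasVelocity (fun t => A.expG (t • p) • x) s (inf A (A.expG (s • p) • x) p) := by
  have h1 := (hasVelocity_const (A.expG (s • p) • x) s).act A (p := fun t => (t - s) • p) (q := p)
    (by simpa using ((hasDerivAt_id s).sub_const s).smul_const p) (by simp)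
  rw [add_zero] at h1
  refine h1.congr (Eventually.of_forall fun t => ?_)
  change _ = A.expG ((t - s) • p) • A.expG (s • p) • x
  rw [smul_smul, ← A.expG_add_smul, sub_add_cancel]

/-- The sign comes from the convention in `generator`, which differentiates along c (-t). -/
theorem U_eq (l : Fin 2) (x : M) : (U A l x : E7) = -inf A x (A.u l, 0) := by
  have h := hasVelocity_expG A x (-(A.u l, 0)) 0
  have e : (fun t : ℝ => torusExp (A.u l) (-t) • x) = fun t => A.expG (t • -(A.u l, 0)) • x := by
    ext t; rw [A.torusExp_eq, neg_smul, smul_neg]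
  rw [zero_smul, A.expG_zero, one_smul, map_neg, ← e] at h
  exact h.velocity_eq

theorem V_eq (i : Fin 3) (x : M) : (V A i x : E7) = -inf A x (0, Pi.single i 1) := by
  have h := hasVelocity_expG A x (-(0, Pi.single i 1)) 0
  have e : (fun t : ℝ => su2Exp (A.v i) (A.v_re i) (-t) • x) =
      fun t => A.expG (t • -(0, Pi.single i 1)) • x := by
    ext t
    have : su2Exp (A.v i) (A.v_re i) (-t) = A.expG ((-t) • (0, Pi.single i 1)) := by
      rw [← A.su2Exp_eq]
      congr 1
      exact (A.vec_single i).symm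
    rw [this, neg_smul, smul_neg]
  rw [zero_smul, A.expG_zero, one_smul, map_neg, ← e] at h
  exact h.velocity_eq

end Action

/-! ### Equivariance of the generators and of the G₂-data under the group. -/

section Dact

variable {M : Type*} [TopologicalSpace M] [ChartedSpace E7 M] [MulAction Grp M]
  [ContMDiffSMul modelGrp (𝓡 7) ∞ Grp M] (A : AdaptedBasis)

theorem continuousSMul_grp (M : Type*) [TopologicalSpace M] [ChartedSpace E7 M] [MulAction Grp M]
    [ContMDiffSMul modelGrp (𝓡 7) ∞ Grp M] : ContinuousSMul Grp M :=
  ContMDiffSMul.continuousSMul (I := modelGrp) (I' := 𝓡 7) (G := Grp) (M := M) ∞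

theorem dact_mul (g h : Grp) (x : M) (v : E7) : dact (g * h) x v = dact g (h • x) (dact h x v) := by
  have h1 : HasMFDerivAt (𝓡 7) (𝓡 7) (fun y : M => (g * h) • y) x
      ((dact g (h • x)).comp (dact h x)) :=
    (HasMFDerivAt.comp x (hasMFDerivAt_dact g (h • x)) (hasMFDerivAt_dact h x)).congr_of_eventuallyEq
      (Eventually.of_forall fun y => mul_smul g h y)
  have h2 : dact (g * h) x = (dact g (h • x)).comp (dact h x) := HasMFDerivAt.mfderiv h1
  rw [h2]; rfl

theorem dact_one (x : M) (v : E7) : dact (1 : Grp) x v = v := by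
  have h1 : HasMFDerivAt (𝓡 7) (𝓡 7) (fun y : M => (1 : Grp) • y) x (.id ℝ E7) :=
    (hasMFDerivAt_id x).congr_of_eventuallyEq (Eventually.of_forall fun y => one_smul Grp y)
  have h2 : dact (1 : Grp) x = .id ℝ E7 := HasMFDerivAt.mfderiv h1
  rw [h2]; rfl

theorem dact_inv_dact (g : Grp) (x : M) (v : E7) : dact g⁻¹ (g • x) (dact g x v) = v := by
  rw [← dact_mul, inv_mul_cancel, dact_one]

theorem dact_dact_inv (g : Grp) (x : M) (v : E7) : dact g x (dact g⁻¹ (g • x) v) = v := by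
  have := dact_mul g g⁻¹ (g • x) v
  rw [inv_smul_smul] at this
  rw [← this, mul_inv_cancel, dact_one]

/-- The differential of the action of an element of the group, as an isomorphism. -/
def dactEquiv (g : Grp) (x : M) : E7 ≃L[ℝ] E7 :=
  .equivOfInverse (dact g x) (dact g⁻¹ (g • x)) (dact_inv_dact g x) (dact_dact_inv g x)

theorem dactEquiv_apply (g : Grp) (x : M) (v : E7) : dactEquiv g x v = dact g x v := rfl

theorem dact_inf_of_conj {g : Grp} {p : Par} {q : Par}
    (h : ∀ t : ℝ, g * A.expG (t • p) * g⁻¹ = A.expG (t • q)) (x : M) :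
    dact g x (inf A x p) = inf A (g • x) q := by
  have h1 := (hasVelocity_expG A x p 0).smul g
  have h2 := hasVelocity_expG A (g • x) q 0
  simp only [zero_smul, A.expG_zero, one_smul] at h1 h2
  refine h1.unique (h2.congr (Eventually.of_forall fun t => ?_))
  change g • A.expG (t • p) • x = A.expG (t • q) • g • x
  rw [← h, mul_smul, inv_smul_smul, mul_smul]

theorem exists_dact_inf (g : Grp) (p : Par) : ∃ b : Fin 3 → ℝ,
    A.vec b = g.2 * A.vec p.2 * (g.2 : ℍ[ℝ])⁻¹ ∧
      ∀ x : M, dact g x (inf A x p) = inf A (g • x) (p.1, b) := by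
  obtain ⟨b, hb, h⟩ := A.exists_conj g p
  exact ⟨b, hb, dact_inf_of_conj A h⟩

/-- The torus is central in G, so conjugation is trivial on its Lie algebra. -/
theorem dact_inf_torus (g : Grp) (x : M) (a : ℝ × ℝ) :
    dact g x (inf A x (a, 0)) = inf A (g • x) (a, 0) := by
  obtain ⟨b, hb, h⟩ := exists_dact_inf (M := M) A g (a, 0)
  have : b = 0 := A.vec_injective (by rw [hb]; simp)
  rw [h, this]

theorem dact_inf_self (p : Par) (x : M) (s : ℝ) :
    dact (A.expG (s • p)) x (inf A x p) = inf A (A.expG (s • p) • x) p := by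
  refine dact_inf_of_conj A (fun t => ?_) x
  rw [← A.expG_add_smul, add_comm, A.expG_add_smul, mul_inv_cancel_right]

/-- The generators of the `𝕋²`-action, as vectors of the model space. -/
def uv (A : AdaptedBasis) (l : Fin 2) (x : M) : E7 := U A l x

/-- The generators of the `SU(2)`-action, as vectors of the model space. -/
def vv (A : AdaptedBasis) (i : Fin 3) (x : M) : E7 := V A i x

theorem uv_eq (l : Fin 2) (x : M) : uv A l x = -inf A x (A.u l, 0) := U_eq A l x

theorem vv_eq (i : Fin 3) (x : M) : vv A i x = -inf A x (0, Pi.single i 1) := V_eq A i x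

theorem dact_uv (g : Grp) (l : Fin 2) (x : M) : dact g x (uv A l x) = uv A l (g • x) := by
  rw [uv_eq, uv_eq, map_neg, dact_inf_torus]

theorem span_u : Submodule.span ℝ (range A.u) = ⊤ :=
  A.u_indep.span_eq_top_of_card_eq_finrank' (by simp)

/-- The tangent space of the torus orbit, in the model space. -/
def torusTan (A : AdaptedBasis) (x : M) : Submodule ℝ E7 := torusTangent A x

/-- The tangent space of the orbit, in the model space. -/
def orbitTan (A : AdaptedBasis) (x : M) : Submodule ℝ E7 := orbitTangent A x

/-- The infinitesimal action of the torus. -/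
def infT (A : AdaptedBasis) (x : M) : ℝ × ℝ →L[ℝ] E7 := (inf A x).comp (.inl ℝ (ℝ × ℝ) (Fin 3 → ℝ))

theorem infT_apply (x : M) (a : ℝ × ℝ) : infT A x a = inf A x (a, 0) := rfl

theorem torusTan_eq_span (x : M) : torusTan A x = Submodule.span ℝ (range fun l => uv A l x) := rfl

theorem orbitTan_eq_span (x : M) : orbitTan A x =
    torusTan A x ⊔ Submodule.span ℝ (range fun i => vv A i x) := rfl

theorem torusTan_eq (x : M) : torusTan A x = (infT A x).range := by
  rw [torusTan_eq_span]
  have h : (fun l => uv A l x) = fun l => (-infT A x) (A.u l) := funext fun l => uv_eq A l x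
  have h2 : range (fun l => uv A l x) = (-(infT A x : ℝ × ℝ →ₗ[ℝ] E7)) '' range A.u := by
    rw [h, ← range_comp]; rfl
  rw [h2, Submodule.span_image, span_u, Submodule.map_top, LinearMap.range_neg]

theorem mem_torusTan {x : M} {v : E7} : v ∈ torusTan A x ↔ ∃ a, infT A x a = v := by
  rw [torusTan_eq]; rfl

theorem mem_orbitTan {x : M} {v : E7} : v ∈ orbitTan A x ↔ ∃ p, inf A x p = v := by
  have h : Submodule.span ℝ (range fun i => vv A i x) =
      ((inf A x).comp (.inr ℝ (ℝ × ℝ) (Fin 3 → ℝ))).range := by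
    have h : (fun i => vv A i x) = fun i =>
      (-(inf A x).comp (.inr ℝ (ℝ × ℝ) (Fin 3 → ℝ))) (Pi.single i 1) := funext fun i => vv_eq A i x
    have h2 : range (fun i => vv A i x) =
        (-((inf A x).comp (.inr ℝ (ℝ × ℝ) (Fin 3 → ℝ)) : (Fin 3 → ℝ) →ₗ[ℝ] E7)) ''
          range (fun i => (Pi.single i 1 : Fin 3 → ℝ)) := by
      rw [h, ← range_comp]; rfl
    have h3 : Submodule.span ℝ (range fun i => (Pi.single i 1 : Fin 3 → ℝ)) = ⊤ := by
      have := (Pi.basisFun ℝ (Fin 3)).span_eq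
      convert this using 3
      ext i; simp
    rw [h2, Submodule.span_image, h3, Submodule.map_top, LinearMap.range_neg]
  rw [orbitTan_eq_span, torusTan_eq, h, Submodule.mem_sup]
  constructor
  · rintro ⟨_, ⟨a, rfl⟩, _, ⟨b, rfl⟩, rfl⟩
    refine ⟨(a, b), ?_⟩
    have : ((a, b) : Par) = (a, 0) + (0, b) := by simp
    rw [this, map_add]; rfl
  · rintro ⟨⟨a, b⟩, rfl⟩
    refine ⟨_, ⟨a, rfl⟩, _, ⟨b, rfl⟩, ?_⟩
    have : ((a, b) : Par) = (a, 0) + (0, b) := by simp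
    rw [this, map_add]; rfl

theorem orbitTan_eq (x : M) : orbitTan A x = (inf A x).range := by
  ext v; rw [mem_orbitTan]; rfl

theorem torusTan_le_orbitTan (x : M) : torusTan A x ≤ orbitTan A x := le_sup_left

theorem dact_mem_torusTan {g : Grp} {x : M} {v : E7} (hv : v ∈ torusTan A x) :
    dact g x v ∈ torusTan A (g • x) := by
  obtain ⟨a, rfl⟩ := (mem_torusTan A).mp hv
  exact (mem_torusTan A).mpr ⟨a, (dact_inf_torus A g x a).symm⟩

variable (φ : G2Structure M)

/-- The field `U₁ × U₂`, as a vector of the model space. -/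
def zf (φ : G2Structure M) (A : AdaptedBasis) (x : M) : E7 := crossField φ A x

/-- The frame, as an automorphism of the model space. -/
def frameE (φ : G2Structure M) (x : M) : E7 ≃L[ℝ] E7 := φ.frame x

/-- The `3`-form, on vectors of the model space. -/
def form3 (φ : G2Structure M) (x : M) (a b c : E7) : ℝ := φ.form x ![a, b, c]

/-- The `4`-form, on vectors of the model space. -/
def form4 (φ : G2Structure M) (x : M) (a b c d : E7) : ℝ := φ.star x ![a, b, c, d]

theorem form3_eq (x : M) (a b c : E7) : form3 φ x a b c =
    inner ℝ (cross0 ((frameE φ x).symm a) ((frameE φ x).symm b)) ((frameE φ x).symm c) :=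
  φ.form_eq x a b c

theorem form4_eq (x : M) (a b c d : E7) : form4 φ x a b c d =
    starPhi0 ![(frameE φ x).symm a, (frameE φ x).symm b, (frameE φ x).symm c,
      (frameE φ x).symm d] := by
  refine (φ.star_eq x a b c d).trans ?_
  have h : (![(φ.frame x).symm a, (φ.frame x).symm b, (φ.frame x).symm c,
      (φ.frame x).symm d] : Fin 4 → E7) = ![(frameE φ x).symm a, (frameE φ x).symm b,
      (frameE φ x).symm c, (frameE φ x).symm d] := rfl
  rw [h]

theorem symm_zf (x : M) : (frameE φ x).symm (zf φ A x) =
    cross0 ((frameE φ x).symm (uv A 0 x)) ((frameE φ x).symm (uv A 1 x)) := by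
  have h : zf φ A x = frameE φ x _ := φ.cross_eq x (U A 0 x) (U A 1 x)
  rw [h, ContinuousLinearEquiv.symm_apply_apply]; rfl

variable {φ} (hinv : φ.IsInvariant)
include hinv

theorem preserves_dactEquiv (g : Grp) (x : M) (w : Fin 3 → E7) :
    φ.form (g • x) (fun i => dactEquiv g x (w i)) = φ.form x w := hinv g x w

theorem dact_zf (g : Grp) (x : M) : dact g x (zf φ A x) = zf φ A (g • x) := by
  have h := G2Structure.cross_of_preserves (φ := φ) (x := x) (y := g • x) (P := dactEquiv g x)
    (preserves_dactEquiv hinv g x) (U A 0 x) (U A 1 x)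
  have h0 : dactEquiv g x (U A 0 x : E7) = (U A 0 (g • x) : E7) := dact_uv A g 0 x
  have h1 : dactEquiv g x (U A 1 x : E7) = (U A 1 (g • x) : E7) := dact_uv A g 1 x
  have h2 : φ.cross (g • x) (dactEquiv g x (U A 0 x : E7)) (dactEquiv g x (U A 1 x : E7)) =
      φ.cross (g • x) (U A 0 (g • x)) (U A 1 (g • x)) := by rw [h0, h1]
  exact h.symm.trans h2

theorem form3_dact (g : Grp) (x : M) (a b c : E7) :
    form3 φ (g • x) (dact g x a) (dact g x b) (dact g x c) = form3 φ x a b c := by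
  have := preserves_dactEquiv hinv g x ![a, b, c]
  refine Eq.trans ?_ this
  change φ.form (g • x) _ = φ.form (g • x) _
  congr 1; ext i; fin_cases i <;> rfl

theorem form4_dact (g : Grp) (x : M) (a b c d : E7) :
    form4 φ (g • x) (dact g x a) (dact g x b) (dact g x c) (dact g x d) = form4 φ x a b c d :=
  G2Structure.star_of_preserves (φ := φ) (x := x) (y := g • x) (P := dactEquiv g x)
    (preserves_dactEquiv hinv g x) a b c d

end Dact

/-! ### Functions with vanishing derivative along curves -/

section Const

variable {M : Type*} [TopologicalSpace M] [ChartedSpace E7 M] [IsManifold (𝓡 7) ∞ M]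

theorem hasVelocity_chart_symm {x₀ : M} {y v : E7} {d : ℝ → E7} {s : ℝ} (hd : HasDerivAt d v s)
    (hy : d s = y) (hyt : y ∈ (extChartAt (𝓡 7) x₀).target) :
    ∃ w, HasVelocity (fun t => (extChartAt (𝓡 7) x₀).symm (d t)) s w := by
  have h1 : MDifferentiableAt 𝓘(ℝ, E7) (𝓡 7) (extChartAt (𝓡 7) x₀).symm (d s) :=
    ((contMDiffOn_extChartAt_symm (n := ∞) x₀).contMDiffAt
      ((isOpen_extChartAt_target x₀).mem_nhds (hy ▸ hyt))).mdifferentiableAt (by simp)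
  have h2 : MDifferentiableAt 𝓘(ℝ, ℝ) 𝓘(ℝ, E7) d s := hd.differentiableAt.mdifferentiableAt
  exact ⟨_, hasVelocity_velocity (h1.comp s h2)⟩

/-- Near a point the function is constant along the straight segments of a chart, hence locally
constant, hence constant. -/
theorem eq_of_hasDerivAt_zero [PreconnectedSpace M] {f : M → ℝ}
    (hf : ∀ (c : ℝ → M) (s : ℝ) (v : E7), HasVelocity c s v → HasDerivAt (fun t => f (c t)) 0 s)
    (x y : M) : f x = f y := by
  refine (IsLocallyConstant.iff_eventually_eq f).mpr (fun x₀ => ?_) |>.apply_eq_of_preconnectedSpace x y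
  set e := extChartAt (𝓡 7) x₀
  obtain ⟨ε, hε, hb⟩ := Metric.isOpen_iff.mp (isOpen_extChartAt_target (I := 𝓡 7) x₀) (e x₀)
    (mem_extChartAt_target x₀)
  have h1 : ∀ᶠ z in 𝓝 x₀, e z ∈ Metric.ball (e x₀) ε :=
    (continuousAt_extChartAt x₀).eventually (Metric.ball_mem_nhds _ hε)
  filter_upwards [h1, extChartAt_source_mem_nhds (I := 𝓡 7) x₀] with z hz hzs
  have hd : ∀ t : ℝ, HasDerivAt (fun t : ℝ => e x₀ + t • (e z - e x₀)) (e z - e x₀) t := fun t => by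
    simpa using ((hasDerivAt_id t).smul_const (e z - e x₀)).const_add (e x₀)
  have hmem : ∀ t ∈ Icc (0 : ℝ) 1, e x₀ + t • (e z - e x₀) ∈ e.target := fun t ht =>
    hb ((convex_ball (e x₀) ε).add_smul_sub_mem (Metric.mem_ball_self hε) hz ht)
  have hder : ∀ t ∈ Icc (0 : ℝ) 1,
      HasDerivAt (fun t => f (e.symm (e x₀ + t • (e z - e x₀)))) 0 t := fun t ht => by
    obtain ⟨w, hw⟩ := hasVelocity_chart_symm (hd t) rfl (hmem t ht)
    exact hf _ _ _ hw
  have := constant_of_has_deriv_right_zero (a := 0) (b := 1)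
    (f := fun t => f (e.symm (e x₀ + t • (e z - e x₀))))
    (fun t ht => (hder t ht).continuousAt.continuousWithinAt)
    (fun t ht => (hder t (Ico_subset_Icc_self ht)).hasDerivWithinAt) 1 (by simp)
  simp only [one_smul, zero_smul, add_zero, add_sub_cancel] at this
  rwa [e.left_inv hzs, e.left_inv (mem_extChartAt_source x₀)] at this

/-- A curve with vanishing velocity is constant. -/
theorem eq_of_hasVelocity_zero [T2Space M] {c : ℝ → M} (hc : ∀ s, HasVelocity c s 0) (s t : ℝ) :
    c s = c t := by
  have h0 : ContMDiff (𝓡 7) (𝓡 7).tangent 1 (fun x : M => (⟨x, 0⟩ : TangentBundle (𝓡 7) M)) :=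
    have : IsManifold (𝓡 7) (1 + 1) M := IsManifold.of_le (n := ∞) (by
      rw [one_add_one_eq_two]; exact ENat.LEInfty.out)
    Bundle.contMDiff_zeroSection ℝ (TangentSpace (𝓡 7) : M → Type _)
  have : IsManifold (𝓡 7) 1 M := IsManifold.of_le (n := ∞) ENat.LEInfty.out
  have h1 : IsMIntegralCurve (I := 𝓡 7) c (fun x => (0 : TangentSpace (𝓡 7) x)) := hc
  have h2 : IsMIntegralCurve (I := 𝓡 7) (fun _ => c t) (fun x => (0 : TangentSpace (𝓡 7) x)) :=
    fun s => hasVelocity_const (c t) s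
  exact congrFun (isMIntegralCurve_Ioo_eq_of_contMDiff_boundaryless (t₀ := t) h0 h1 h2 rfl) s

end Const

/-! ### The multi-moment maps -/

section Moment

variable {M : Type*} [TopologicalSpace M] [ChartedSpace E7 M] [MulAction Grp M]
  [ContMDiffSMul modelGrp (𝓡 7) ∞ Grp M] {A : AdaptedBasis} {φ : G2Structure M}
  {ν : M → ℝ} {μ : M → EuclideanSpace ℝ (Fin 3)}

theorem IsMultiMoment.hasDerivAt_nu (h : IsMultiMoment φ A ν μ) {c : ℝ → M} {s : ℝ} {v : E7}
    (hc : HasVelocity c s v) :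
    HasDerivAt (fun t => ν (c t)) (form3 φ (c s) (uv A 0 (c s)) (uv A 1 (c s)) v) s := by
  have h1 := hc.hasDerivAt_comp (h.smooth_nu.mdifferentiableAt (by simp))
  exact h1.congr_deriv (h.d_nu (c s) v)

theorem IsMultiMoment.contMDiff_mu_apply (h : IsMultiMoment φ A ν μ) (i : Fin 3) :
    ContMDiff (𝓡 7) 𝓘(ℝ, ℝ) ∞ (fun x => μ x i) :=
  (EuclideanSpace.proj (𝕜 := ℝ) i).contDiff.contMDiff.comp h.smooth_mu

theorem IsMultiMoment.hasDerivAt_mu (h : IsMultiMoment φ A ν μ) (i : Fin 3) {c : ℝ → M} {s : ℝ}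
    {v : E7} (hc : HasVelocity c s v) : HasDerivAt (fun t => μ (c t) i)
      (form4 φ (c s) (uv A 0 (c s)) (uv A 1 (c s)) (vv A i (c s)) v) s := by
  have h1 := hc.hasDerivAt_comp ((h.contMDiff_mu_apply i).mdifferentiableAt (by simp))
  exact h1.congr_deriv (h.d_mu (c s) i v)

/-- `φ(U₁, U₂, ·)`. -/
def dnu (φ : G2Structure M) (A : AdaptedBasis) (x : M) : E7 →ₗ[ℝ] ℝ :=
  (innerₗ E7 (cross0 ((frameE φ x).symm (uv A 0 x)) ((frameE φ x).symm (uv A 1 x)))).comp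
    ((frameE φ x).symm : E7 →ₗ[ℝ] E7)

theorem dnu_apply (x : M) (v : E7) : dnu φ A x v = form3 φ x (uv A 0 x) (uv A 1 x) v :=
  (form3_eq φ x _ _ v).symm

/-- `∗φ(U₁, U₂, v, ·)`. -/
def dmu (φ : G2Structure M) (A : AdaptedBasis) (x : M) (v : E7) : E7 →ₗ[ℝ] ℝ :=
  (innerₗ E7 (starEnd ((frameE φ x).symm (uv A 0 x)) ((frameE φ x).symm (uv A 1 x))
    ((frameE φ x).symm v))).comp ((frameE φ x).symm : E7 →ₗ[ℝ] E7)

theorem dmu_apply (x : M) (v w : E7) :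
    dmu φ A x v w = form4 φ x (uv A 0 x) (uv A 1 x) v w := by
  rw [form4_eq, ← inner_starEnd]; rfl

theorem dmu_swap (x : M) (v w : E7) : dmu φ A x v w = -dmu φ A x w v := by
  rw [dmu_apply, dmu_apply, form4_eq, form4_eq, starPhi0_swap]

theorem dmu_smul_left (x : M) (r : ℝ) (v w : E7) :
    dmu φ A x (r • v) w = r * dmu φ A x v w := by
  rw [dmu_swap, map_smul, dmu_swap x v, smul_eq_mul]; ring

theorem dmu_sum_left {ι : Type*} (s : Finset ι) (f : ι → E7) (x : M) (w : E7) :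
    dmu φ A x (∑ i ∈ s, f i) w = ∑ i ∈ s, dmu φ A x (f i) w := by
  rw [dmu_swap, map_sum, ← Finset.sum_neg_distrib]
  exact Finset.sum_congr rfl fun i _ => (dmu_swap x _ _).symm

/-- The associative plane of U₁, U₂ is in the kernel of ∗φ(U₁, U₂, ·, ·). This is why every μᵢ, and
with it |μ|, is stationary in the direction U₁ × U₂. -/
theorem dmu_zf (x : M) (v : E7) : dmu φ A x v (zf φ A x) = 0 := by
  rw [dmu_swap]
  change -(inner ℝ (starEnd _ _ ((frameE φ x).symm (zf φ A x))) _ : ℝ) = 0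
  rw [symm_zf, starEnd_cross0, inner_zero_left, neg_zero]

theorem dmu_uv (x : M) (l : Fin 2) (v : E7) : dmu φ A x v (uv A l x) = 0 := by
  rw [dmu_swap]
  change -(inner ℝ (starEnd _ _ ((frameE φ x).symm (uv A l x))) _ : ℝ) = 0
  fin_cases l
  · exact (by rw [starEnd_left, inner_zero_left, neg_zero] : -(inner ℝ (starEnd
      ((frameE φ x).symm (uv A 0 x)) ((frameE φ x).symm (uv A 1 x))
      ((frameE φ x).symm (uv A 0 x))) ((frameE φ x).symm v) : ℝ) = 0)
  · exact (by rw [starEnd_right, inner_zero_left, neg_zero] : -(inner ℝ (starEnd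
      ((frameE φ x).symm (uv A 0 x)) ((frameE φ x).symm (uv A 1 x))
      ((frameE φ x).symm (uv A 1 x))) ((frameE φ x).symm v) : ℝ) = 0)

theorem dmu_torus (x : M) (v : E7) {w : E7} (hw : w ∈ torusTan A x) : dmu φ A x v w = 0 := by
  rw [torusTan_eq_span] at hw
  have : Submodule.span ℝ (range fun l => uv A l x) ≤ LinearMap.ker (dmu φ A x v) := by
    rw [Submodule.span_le]
    rintro _ ⟨l, rfl⟩
    exact dmu_uv x l v
  exact this hw

/-- `|U₁ × U₂|²`. -/
def nz (φ : G2Structure M) (A : AdaptedBasis) (x : M) : ℝ := dnu φ A x (zf φ A x)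

theorem nz_eq (x : M) : nz φ A x = inner ℝ ((frameE φ x).symm (zf φ A x))
    ((frameE φ x).symm (zf φ A x)) := by
  change (inner ℝ (cross0 _ _) ((frameE φ x).symm (zf φ A x)) : ℝ) = _
  rw [← symm_zf]

section Invariant

variable (hinv : φ.IsInvariant)
include hinv

theorem dnu_dact (g : Grp) (x : M) (v : E7) : dnu φ A (g • x) (dact g x v) = dnu φ A x v := by
  rw [dnu_apply, dnu_apply, ← dact_uv, ← dact_uv, form3_dact hinv]

theorem dmu_dact (g : Grp) (x : M) (v w : E7) :
    dmu φ A (g • x) (dact g x v) (dact g x w) = dmu φ A x v w := by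
  rw [dmu_apply, dmu_apply, ← dact_uv, ← dact_uv, form4_dact hinv]

theorem nz_smul (g : Grp) (x : M) : nz φ A (g • x) = nz φ A x := by
  rw [nz, ← dact_zf A hinv, dnu_dact hinv]; rfl

variable (hm : IsMultiMoment φ A ν μ)
include hm

/-- By invariance the derivative of ν along the orbit of a one-parameter subgroup is a constant K,
so ν grows linearly there. As G is compact, ν is bounded on orbits, and K = 0. -/
theorem dnu_inf (x : M) (p : Par) : dnu φ A x (inf A x p) = 0 := by
  by_contra hK
  set K := dnu φ A x (inf A x p) with hKd
  have hd : ∀ t : ℝ, HasDerivAt (fun t : ℝ => ν (A.expG (t • p) • x)) K t := fun t => by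
    have h1 := hm.hasDerivAt_nu (hasVelocity_expG A x p t)
    rw [← dnu_apply, ← dact_inf_self, dnu_dact hinv] at h1
    exact h1
  have hcont : Continuous fun g : Grp => ν (g • x) := by
    have := continuousSMul_grp M
    exact hm.smooth_nu.continuous.comp (continuous_id.smul continuous_const)
  obtain ⟨C, hC⟩ := isCompact_univ.exists_bound_of_continuousOn hcont.continuousOn
  have hd2 : ∀ t : ℝ, HasDerivAt (fun t : ℝ => ν (A.expG (t • p) • x) - K * t) 0 t := fun t =>
    (HasDerivAt.fun_sub (hd t) ((hasDerivAt_id t).const_mul K)).congr_deriv (by simp)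
  -- Over the time (2C + 1)/K the function ν would change by 2C + 1, more than the bound C on |ν|
  -- allows.
  have h3 := is_const_of_deriv_eq_zero (fun t => (hd2 t).differentiableAt)
    (fun t => (hd2 t).deriv) ((2 * C + 1) / K) 0
  have h4 := abs_le.mp (hC (A.expG (((2 * C + 1) / K) • p)) (mem_univ _))
  have h5 := abs_le.mp (hC (A.expG ((0 : ℝ) • p)) (mem_univ _))
  simp only [mul_div_cancel₀ _ hK, mul_zero, sub_zero] at h3
  linarith [h4.2, h5.1]

theorem dnu_orbit (x : M) {v : E7} (hv : v ∈ orbitTan A x) : dnu φ A x v = 0 := by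
  obtain ⟨p, rfl⟩ := (mem_orbitTan A).mp hv
  exact dnu_inf hinv hm x p

theorem nu_smul (g : Grp) (x : M) : ν (g • x) = ν x := by
  obtain ⟨p, rfl⟩ := A.expG_surjective g
  have hd : ∀ t : ℝ, HasDerivAt (fun t : ℝ => ν (A.expG (t • p) • x)) 0 t := fun t => by
    have h1 := hm.hasDerivAt_nu (hasVelocity_expG A x p t)
    rwa [← dnu_apply, dnu_inf hinv hm] at h1
  have h3 := is_const_of_deriv_eq_zero (fun t => (hd t).differentiableAt)
    (fun t => (hd t).deriv) 1 0
  simpa [A.expG_zero] using h3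

end Invariant

end Moment

/-! ### The formula for μ and the invariance of |μ|. -/

section Moment

variable {M : Type*} [TopologicalSpace M] [ChartedSpace E7 M] [MulAction Grp M]
  [ContMDiffSMul modelGrp (𝓡 7) ∞ Grp M] {A : AdaptedBasis} {φ : G2Structure M}
  {ν : M → ℝ} {μ : M → EuclideanSpace ℝ (Fin 3)}

/-- The coordinates of the conjugates of a basis vector under a one-parameter subgroup are
differentiable; the derivative is the bracket. -/
theorem exists_coord (k : Fin 3) : ∃ b : ℝ → Fin 3 → ℝ,
    (∀ t x, dact (A.expG (t • (0, Pi.single (k + 1) 1)))⁻¹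
        (A.expG (t • (0, Pi.single (k + 1) 1)) • x)
        (vv A k (A.expG (t • (0, Pi.single (k + 1) 1)) • x)) = ∑ j, b t j • vv (M := M) A j x) ∧
    HasDerivAt b (Pi.single (k + 2) 1) 0 := by
  set p : Par := (0, Pi.single (k + 1) 1) with hp
  choose b hb hd using fun t : ℝ => exists_dact_inf (M := M) A (A.expG (t • p))⁻¹ (0, Pi.single k 1)
  refine ⟨b, fun t x => ?_, ?_⟩
  · have h := hd t (A.expG (t • p) • x)
    rw [inv_smul_smul] at h
    rw [vv_eq, map_neg, h]
    simp only [vv_eq, smul_neg, Finset.sum_neg_distrib, ← map_smul, ← map_sum]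
    congr 2
    ext i
    · simp [Prod.fst_sum]
    · simp [Prod.fst_sum]
    · simp [Prod.snd_sum, Finset.sum_apply, Pi.single_apply]
  · obtain ⟨l, hl⟩ := A.vec.exists_leftInverse_of_injective (LinearMap.ker_eq_bot.mpr A.vec_injective)
    have hl' : ∀ c, l (A.vec c) = c := fun c => LinearMap.congr_fun hl c
    have hb2 : b = fun t => l (NormedSpace.exp ((-t) • A.v (k + 1)) * A.v k *
        NormedSpace.exp (t • A.v (k + 1))) := by
      ext1 t
      rw [← hl' (b t), hb, A.vec_single]
      congr 2
      · rw [← A.expG_neg, ← neg_smul]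
        change NormedSpace.exp (A.vec (-t • Pi.single (k + 1) 1)) * _ = _
        rw [map_smul, A.vec_single]
      · have hu : ∀ s : SU2, ((s⁻¹ : SU2) : ℍ[ℝ])⁻¹ = s := fun s => by
          have h1 : ((s⁻¹ : SU2) : ℍ[ℝ]) * s = 1 := congrArg Subtype.val (inv_mul_cancel s)
          rw [eq_inv_of_mul_eq_one_left h1, inv_inv]
        refine (hu (A.expG (t • p)).2).trans ?_
        change NormedSpace.exp (A.vec (t • Pi.single (k + 1) 1)) = _
        rw [map_smul, A.vec_single]
    have h1 : HasDerivAt (fun t : ℝ => NormedSpace.exp (t • A.v (k + 1))) (A.v (k + 1)) 0 := by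
      simpa using hasDerivAt_exp_smul_const (𝕂 := ℝ) (A.v (k + 1)) (0 : ℝ)
    have h2 : HasDerivAt (fun t : ℝ => NormedSpace.exp ((-t) • A.v (k + 1))) (-A.v (k + 1)) 0 := by
      have h3 : HasDerivAt (fun t : ℝ => -t) (-1) 0 := (hasDerivAt_id (0 : ℝ)).neg
      have h4 := HasDerivAt.scomp (0 : ℝ) (h := fun t : ℝ => -t) (by simpa using h1) h3
      exact h4.congr_deriv (by simp)
    -- The derivative at 0 of exp(−tX) Y exp(tX) is YX − XY. With Y = v_k and X = v_{k+1} this is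
    -- the bracket v_{k+2}.
    have h5 := (h2.mul_const (A.v k)).mul h1
    have h6 := (LinearMap.toContinuousLinearMap l).hasFDerivAt.comp_hasDerivAt (0 : ℝ) h5
    rw [hb2]
    refine h6.congr_deriv ?_
    change l _ = _
    rw [← hl' (Pi.single (k + 2) 1), A.vec_single, ← A.v_bracket]
    congr 1
    simp
    abel

variable [IsManifold (𝓡 7) ∞ M] [ConnectedSpace M] (hinv : φ.IsInvariant)
  (hm : IsMultiMoment φ A ν μ)
include hinv hm

/-- The moment map is determined by the vector fields, everywhere. -/
theorem mu_eq (x : M) (k : Fin 3) : μ x (k + 2) = -dmu φ A x (vv A k x) (vv A (k + 1) x) := by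
  obtain ⟨b, hb, hb'⟩ := exists_coord (M := M) (A := A) k
  set p : Par := (0, Pi.single (k + 1) 1) with hp
  -- At a fixed time t, both μ_k ∘ exp(tp) and the combination of the μ_j with the coordinates of
  -- the conjugated basis vector have the same differential, by the equivariance of ∗φ. On the
  -- connected M they differ by a constant.
  have hconst : ∀ t x y, μ (A.expG (t • p) • x) k - ∑ j, b t j * μ x j =
      μ (A.expG (t • p) • y) k - ∑ j, b t j * μ y j := fun t => by
    refine eq_of_hasDerivAt_zero (f := fun x => μ (A.expG (t • p) • x) k - ∑ j, b t j * μ x j)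
      fun c s v hc => ?_
    have h1 := hm.hasDerivAt_mu k (hc.smul (A.expG (t • p)))
    have h2 := HasDerivAt.fun_sum (u := Finset.univ)
      fun j _ => (hm.hasDerivAt_mu j hc).const_mul (b t j)
    refine (HasDerivAt.fun_sub h1 h2).congr_deriv ?_
    simp only [← dmu_apply]
    have h3 := dmu_dact (A := A) hinv (A.expG (t • p)) (c s)
      (dact (A.expG (t • p))⁻¹ (A.expG (t • p) • c s) (vv A k (A.expG (t • p) • c s))) v
    rw [dact_dact_inv, hb, dmu_sum_left] at h3
    rw [h3, sub_eq_zero]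
    exact Finset.sum_congr rfl fun j _ => dmu_smul_left _ _ _ _
  -- The derivative at t = 0 of that difference is the defect in the formula to be proved. It is
  -- therefore independent of the point, and the normalisation makes it vanish at one point.
  have hder : ∀ x, HasDerivAt (fun t : ℝ => μ (A.expG (t • p) • x) k - ∑ j, b t j * μ x j)
      (-dmu φ A x (vv A k x) (vv A (k + 1) x) - μ x (k + 2)) 0 := fun x => by
    have h1 := hm.hasDerivAt_mu k (hasVelocity_expG A x p 0)
    have h2 := HasDerivAt.fun_sum (u := Finset.univ)
      fun j _ => ((hasDerivAt_pi.mp hb') j).mul_const (μ x j)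
    refine (HasDerivAt.fun_sub h1 h2).congr_deriv ?_
    rw [zero_smul, A.expG_zero, one_smul, ← dmu_apply, vv_eq A (k + 1), map_neg, neg_neg]
    simp [Pi.single_apply, hp]
  obtain ⟨x₀, hx₀⟩ := hm.normalised
  have h1 := (hder x).unique ((hder x₀).congr_of_eventuallyEq
    (Eventually.of_forall fun t => hconst t x x₀))
  have h2 : μ x₀ (k + 2) = -dmu φ A x₀ (vv A k x₀) (vv A (k + 1) x₀) := by
    have h3 := hx₀ (k + 2)
    have e1 : k + 2 + 1 = k := by fin_cases k <;> rfl
    have e2 : k + 2 + 2 = k + 1 := by fin_cases k <;> rfl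
    rw [e1, e2] at h3
    rw [dmu_apply]
    exact h3
  linarith

omit hinv [ConnectedSpace M] [IsManifold (𝓡 7) ∞ M] in
theorem hasDerivAt_rho {c : ℝ → M} {s : ℝ} {v : E7} (hc : HasVelocity c s v) :
    HasDerivAt (fun t => ‖μ (c t)‖ ^ 2)
      (2 * dmu φ A (c s) (∑ i, μ (c s) i • vv A i (c s)) v) s := by
  have h1 : (fun t => ‖μ (c t)‖ ^ 2) = fun t => ∑ i, μ (c t) i ^ 2 := by
    ext1 t; simp [EuclideanSpace.norm_sq_eq]
  rw [h1]
  refine (HasDerivAt.fun_sum (u := Finset.univ)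
    fun i _ => (hm.hasDerivAt_mu i hc).pow 2).congr_deriv ?_
  rw [dmu_sum_left, Finset.mul_sum]
  refine Finset.sum_congr rfl fun i _ => ?_
  rw [dmu_smul_left, dmu_apply]
  simp; ring

/-- The differential of `|μ|²`. -/
theorem drho_inf (x : M) (p : Par) : dmu φ A x (∑ i, μ x i • vv A i x) (inf A x p) = 0 := by
  -- By `mu_eq` the numbers ∗φ(U₁, U₂, V_i, V_j) are, up to sign, the components of μ. The two
  -- surviving terms cancel as in the identity μ × μ = 0.
  have hv : ∀ i, dmu φ A x (∑ i, μ x i • vv A i x) (vv A i x) = 0 := fun i => by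
    have e : ∀ i, dmu φ A x (∑ i, μ x i • vv A i x) (vv A (i + 1) x) = 0 := fun i => by
      have h1 := mu_eq hinv hm x i
      have h2 := mu_eq hinv hm x (i + 1)
      have e1 : i + 1 + 2 = i := by fin_cases i <;> rfl
      have e2 : i + 1 + 1 = i + 2 := by fin_cases i <;> rfl
      rw [e1, e2] at h2
      have h3 : ∑ j, μ x j * dmu φ A x (vv A j x) (vv A (i + 1) x) =
          μ x i * dmu φ A x (vv A i x) (vv A (i + 1) x) +
          μ x (i + 1) * dmu φ A x (vv A (i + 1) x) (vv A (i + 1) x) +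
          μ x (i + 2) * dmu φ A x (vv A (i + 2) x) (vv A (i + 1) x) := by
        rw [Fin.sum_univ_three]; fin_cases i
        · rfl
        · change _ = _ + _ + μ x 0 * _; simp; ring
        · change _ = _ + μ x 0 * _ + μ x 1 * _; simp; ring
      have h4 := dmu_swap (φ := φ) (A := A) x (vv A (i + 1) x) (vv A (i + 1) x)
      have h5 := dmu_swap (φ := φ) (A := A) x (vv A (i + 2) x) (vv A (i + 1) x)
      rw [dmu_sum_left]
      simp only [dmu_smul_left]
      rw [h3, h5]
      have h6 : dmu φ A x (vv A (i + 1) x) (vv A (i + 1) x) = 0 := by linarith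
      rw [h6, ← neg_eq_iff_eq_neg.mpr h1, ← neg_eq_iff_eq_neg.mpr h2]
      ring
    have := e (i + 2)
    have e3 : i + 2 + 1 = i := by fin_cases i <;> rfl
    rwa [e3] at this
  have h1 : inf A x p ∈ orbitTan A x := (mem_orbitTan A).mpr ⟨p, rfl⟩
  have h2 : orbitTan A x ≤ LinearMap.ker (dmu φ A x (∑ i, μ x i • vv A i x)) := by
    rw [orbitTan_eq_span]
    refine sup_le (fun w hw => dmu_torus x _ hw) (Submodule.span_le.mpr ?_)
    rintro _ ⟨i, rfl⟩
    exact hv i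
  exact h2 h1

theorem norm_mu_smul (g : Grp) (x : M) : ‖μ (g • x)‖ = ‖μ x‖ := by
  obtain ⟨p, rfl⟩ := A.expG_surjective g
  have hd : ∀ t : ℝ, HasDerivAt (fun t : ℝ => ‖μ (A.expG (t • p) • x)‖ ^ 2) 0 t := fun t =>
    (hasDerivAt_rho hm (hasVelocity_expG A x p t)).congr_deriv (by
      rw [drho_inf hinv hm, mul_zero])
  have h3 := is_const_of_deriv_eq_zero (fun t => (hd t).differentiableAt)
    (fun t => (hd t).deriv) 1 0
  simp only [one_smul, zero_smul, A.expG_zero] at h3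
  exact (pow_left_inj₀ (norm_nonneg _) (norm_nonneg _) two_ne_zero).mp h3

end Moment

/-! ### The principal set -/

/-- The standing assumptions. -/
structure MomentSetting {M : Type*} [TopologicalSpace M] [ChartedSpace E7 M] [MulAction Grp M]
    (A : AdaptedBasis) (φ : G2Structure M) (ν : M → ℝ) (μ : M → EuclideanSpace ℝ (Fin 3)) :
    Prop where
  coh : CohomogeneityTwo M A
  inv : φ.IsInvariant
  mm : IsMultiMoment φ A ν μ

section Principal

theorem smul_mem_principalSet {M : Type*} [MulAction Grp M] {x : M} (hx : x ∈ principalSet M)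
    (g : Grp) : g • x ∈ principalSet M := fun y => by
  obtain ⟨h, hh⟩ := hx y
  exact ⟨h * g⁻¹, by rwa [mul_smul, inv_smul_smul]⟩

theorem smul_mem_principalSet_iff {M : Type*} [MulAction Grp M] {x : M} (g : Grp) :
    g • x ∈ principalSet M ↔ x ∈ principalSet M :=
  ⟨fun h => by simpa using smul_mem_principalSet h g⁻¹, fun h => smul_mem_principalSet h g⟩

variable {M : Type*} [TopologicalSpace M] [ChartedSpace E7 M] [MulAction Grp M]
  [ContMDiffSMul modelGrp (𝓡 7) ∞ Grp M] {A : AdaptedBasis} {φ : G2Structure M}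
  {ν : M → ℝ} {μ : M → EuclideanSpace ℝ (Fin 3)} {x : M}
  [IsManifold (𝓡 7) ∞ M] [T2Space M]

theorem expG_smul_of_inf_eq_zero {p : Par} (h : inf A x p = 0) (t : ℝ) :
    A.expG (t • p) • x = x := by
  have := eq_of_hasVelocity_zero (c := fun t : ℝ => A.expG (t • p) • x) (fun s => by
    have h1 := hasVelocity_expG A x p s
    rwa [← dact_inf_self, h, map_zero] at h1) t 0
  simpa [A.expG_zero] using this

theorem inf_eq_zero_of_smul {p : Par} (h : ∀ t : ℝ, A.expG (t • p) • x = x) : inf A x p = 0 := by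
  have h1 := hasVelocity_expG A x p 0
  simp only [h] at h1
  exact h1.unique (hasVelocity_const x 0)

/-- A point y with five-dimensional orbit has no infinitesimal stabiliser, since 5 = dim G. A
principal stabiliser is conjugate into the stabiliser of y, so a one-parameter subgroup fixing x
would give one fixing y. -/
theorem inf_injective (hcoh : CohomogeneityTwo M A) (hx : x ∈ principalSet M) :
    Function.Injective (inf A x) := by
  rw [injective_iff_map_eq_zero]
  intro p hp
  obtain ⟨y, hy⟩ := hcoh.1
  obtain ⟨g, hg⟩ := hx y
  obtain ⟨b, hb, hconj⟩ := A.exists_conj g p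
  have hy' : Module.finrank ℝ (orbitTan A y) = 5 := hy
  have hinj : Function.Injective (inf A y) := by
    rw [orbitTan_eq] at hy'
    have h1 := (inf A y : Par →ₗ[ℝ] E7).finrank_range_add_finrank_ker
    have h2 : Module.finrank ℝ Par = 5 := by simp
    have h3 : Module.finrank ℝ (LinearMap.ker (inf A y : Par →ₗ[ℝ] E7)) = 0 := by
      have h4 : Module.finrank ℝ (inf A y : Par →ₗ[ℝ] E7).range = 5 := hy'
      omega
    exact LinearMap.ker_eq_bot.mp (Submodule.finrank_eq_zero.mp h3)
  have h0 : inf A y (p.1, b) = 0 := by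
    refine inf_eq_zero_of_smul fun t => ?_
    have : A.expG (t • (p.1, b)) ∈ MulAction.stabilizer Grp (g • x) := by
      rw [MulAction.mem_stabilizer_iff, ← hconj, mul_smul, inv_smul_smul, mul_smul,
        expG_smul_of_inf_eq_zero hp]
    exact MulAction.mem_stabilizer_iff.mp (hg this)
  have h1 : ((p.1, b) : Par) = 0 := hinj (by rw [h0, map_zero])
  have hb0 : b = 0 := congrArg Prod.snd h1
  have hn : ‖(g.2 : ℍ[ℝ])‖ = 1 := by simp
  have hg0 : (g.2 : ℍ[ℝ]) ≠ 0 := by rw [← norm_ne_zero_iff, hn]; exact one_ne_zero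
  rw [hb0, map_zero] at hb
  have h2 : A.vec p.2 = 0 := by
    have h3 := hb.symm
    rw [mul_eq_zero, mul_eq_zero] at h3
    rcases h3 with (h3 | h3) | h3
    · exact absurd h3 hg0
    · exact h3
    · exact absurd h3 (inv_ne_zero hg0)
  have h4 : p.2 = 0 := A.vec_injective (by rw [h2, map_zero])
  have h5 : p.1 = 0 := congrArg Prod.fst h1
  exact Prod.ext h5 h4

theorem linearIndependent_uv (hcoh : CohomogeneityTwo M A) (hx : x ∈ principalSet M) :
    LinearIndependent ℝ fun l => uv A l x := by
  have h1 : (fun l => uv A l x) = (-(infT A x : ℝ × ℝ →ₗ[ℝ] E7)) ∘ A.u :=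
    funext fun l => uv_eq A l x
  rw [h1]
  refine A.u_indep.map' _ (LinearMap.ker_eq_bot.mpr fun a b h => ?_)
  have h2 : infT A x a = infT A x b := neg_injective h
  exact congrArg Prod.fst (inf_injective hcoh hx h2)

theorem linearIndependent_symm_uv (hcoh : CohomogeneityTwo M A) (hx : x ∈ principalSet M) :
    LinearIndependent ℝ ![(frameE φ x).symm (uv A 0 x), (frameE φ x).symm (uv A 1 x)] := by
  have h1 := (linearIndependent_uv hcoh hx).map' ((frameE φ x).symm : E7 →ₗ[ℝ] E7)
    (LinearMap.ker_eq_bot.mpr (frameE φ x).symm.injective)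
  have h2 : (![(frameE φ x).symm (uv A 0 x), (frameE φ x).symm (uv A 1 x)] : Fin 2 → E7) =
      ⇑((frameE φ x).symm : E7 →ₗ[ℝ] E7) ∘ fun l => uv A l x := by
    ext1 l
    fin_cases l <;> rfl
  rw [h2]
  exact h1

theorem nz_pos (hcoh : CohomogeneityTwo M A) (hx : x ∈ principalSet M) : 0 < nz φ A x := by
  rw [nz_eq, symm_zf]
  exact inner_self_mul_sub_pos (linearIndependent_symm_uv hcoh hx)

variable (hS : MomentSetting A φ ν μ) (hx : x ∈ principalSet M)
include hS

/-- The SU(2)-component of g fixes some b ≠ 0 of 𝔰𝔲(2), unless it centralises 𝔰𝔲(2) already. The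
differential of g at x then preserves φ and fixes U₁, U₂ and the vector generated by b, which lies
outside their associative plane, so it is the identity. Injectivity of the infinitesimal action
shows that conjugation by g is trivial, so g is central. A central element of a principal stabiliser
belongs to every stabiliser. -/
theorem smul_eq_of_smul_eq (hx : x ∈ principalSet M) {g : Grp} (hg : g • x = x) (y : M) :
    g • y = y := by
  have hinf : inf A (g • x) = inf A x := by rw [hg]
  have hfr : frameE φ (g • x) = frameE φ x := by rw [hg]
  have huv : ∀ l, uv A l (g • x) = uv A l x := fun l => by rw [hg]
  have hn : ‖(g.2 : ℍ[ℝ])‖ = 1 := by simp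
  have hg0 : (g.2 : ℍ[ℝ]) ≠ 0 := by rw [← norm_ne_zero_iff, hn]; exact one_ne_zero
  have hc : ∀ b, (g.2 : ℍ[ℝ]) * A.vec b = A.vec b * g.2 := by
    rcases A.exists_fixed g.2 with h | ⟨b, hb0, hb⟩
    · exact h
    have hfix : dact g x (inf A x (0, b)) = inf A x (0, b) := by
      obtain ⟨b', hb', h⟩ := exists_dact_inf (M := M) A g (0, b)
      have : b' = b := A.vec_injective (hb'.trans hb)
      rw [h, this, hinf]
    set q : E7 ≃L[ℝ] E7 := ((frameE φ x).trans (dactEquiv g x)).trans (frameE φ (g • x)).symm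
      -- Since g fixes x, the two frames coincide and q is the differential of g written in the
      -- frame at x.
      with hq
    have hpres : ∀ w : Fin 3 → E7, phi0 (fun i => q (w i)) = phi0 w := fun w =>
      G2Structure.preserves_aux (φ := φ) (x := x) (y := g • x) (P := dactEquiv g x)
        (preserves_dactEquiv hS.inv g x) w
    have hq' : ∀ v, q ((frameE φ x).symm v) = (frameE φ x).symm (dact g x v) := fun v => by
      rw [hq, hfr]; simp [dactEquiv_apply]
    have hid := eq_id_of_preserves hpres (linearIndependent_symm_uv (φ := φ) hS.coh hx)
      (w := (frameE φ x).symm (inf A x (0, b))) ?_ (by rw [hq', dact_uv, huv])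
      (by rw [hq', dact_uv, huv]) (by rw [hq', hfix])
    · intro c
      obtain ⟨c', hc', h⟩ := exists_dact_inf (M := M) A g (0, c)
      have h1 := hid ((frameE φ x).symm (inf A x (0, c)))
      rw [hq', h, hinf] at h1
      have h2 := congrArg Prod.snd (inf_injective hS.coh hx ((frameE φ x).symm.injective h1))
      simp only at h2
      rw [h2] at hc'
      conv_rhs => rw [hc', mul_assoc, inv_mul_cancel₀ hg0, mul_one]
    -- In a relation r U₁ + s U₂ + t Z for the vector generated by b, the coefficient t is zero
    -- because dν kills orbit directions but not Z. What remains contradicts the injectivity of the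
    -- infinitesimal action, as b ≠ 0.
    · intro hmem
      obtain ⟨r, s, t, hrst⟩ := Submodule.mem_span_triple.mp hmem
      have h0 := dnu_inf hS.inv hS.mm x (0, b)
      have hpos := nz_pos (φ := φ) hS.coh hx
      rw [nz_eq, symm_zf] at hpos
      have ht : t = 0 := by
        have h1 : dnu φ A x (inf A x (0, b)) = t * inner ℝ (cross0 ((frameE φ x).symm (uv A 0 x))
          ((frameE φ x).symm (uv A 1 x))) (cross0 ((frameE φ x).symm (uv A 0 x))
          ((frameE φ x).symm (uv A 1 x))) := by
          change (inner ℝ _ ((frameE φ x).symm (inf A x (0, b))) : ℝ) = _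
          rw [← hrst, inner_add_right, inner_add_right, inner_smul_right, inner_smul_right,
            inner_smul_right, inner_cross0_left, inner_cross0_right]
          ring
        rw [h0] at h1
        exact (mul_eq_zero.mp h1.symm).resolve_right hpos.ne'
      rw [ht, zero_smul, add_zero, ← map_smul, ← map_smul, ← map_add] at hrst
      have h3 := (frameE φ x).symm.injective hrst
      rw [uv_eq, uv_eq, smul_neg, smul_neg, ← neg_add, ← map_smul, ← map_smul, ← map_add,
        ← map_neg] at h3
      have h4 := congrArg Prod.snd (inf_injective hS.coh hx h3)
      exact hb0 (by simpa using h4.symm)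
  have hcomm : ∀ h : Grp, g * h = h * g := fun h =>
    Prod.ext (mul_comm _ _) (A.mul_comm_of_conj hc h.2)
  obtain ⟨h, hh⟩ := hx y
  have hmem : g ∈ MulAction.stabilizer Grp (h • x) := by
    rw [MulAction.mem_stabilizer_iff, ← mul_smul, hcomm, mul_smul, hg]
  exact MulAction.mem_stabilizer_iff.mp (hh hmem)

include hx

theorem zf_notMem_orbitTan : zf φ A x ∉ orbitTan A x := fun h =>
  (nz_pos (φ := φ) hS.coh hx).ne' (dnu_orbit hS.inv hS.mm x h)

variable [ConnectedSpace M]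

/-- The common kernel of the differentials of `ν` and `|μ|²`. -/
theorem mem_orbitTan_of_dnu_of_drho {v : E7} (h1 : dnu φ A x v = 0)
    (h2 : dmu φ A x (∑ i, μ x i • vv A i x) v = 0) : v ∈ orbitTan A x := by
  set z := ∑ i, μ x i • vv A i x with hz
  -- If d|μ|² vanished at x, then ∑ μᵢVᵢ would lie in the associative plane. Being tangent to the
  -- orbit it has no Z-component, hence lies in the torus directions, and μ(x) = 0 by injectivity.
  have hne : dmu φ A x z ≠ 0 := by
    intro h0
    have hker : (frameE φ x).symm z ∈ LinearMap.ker (starEnd ((frameE φ x).symm (uv A 0 x))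
        ((frameE φ x).symm (uv A 1 x))) := by
      rw [LinearMap.mem_ker, ← inner_self_eq_zero (𝕜 := ℝ)]
      have h3 := LinearMap.congr_fun h0 (frameE φ x (starEnd ((frameE φ x).symm (uv A 0 x))
        ((frameE φ x).symm (uv A 1 x)) ((frameE φ x).symm z)))
      have h4 : (inner ℝ (starEnd ((frameE φ x).symm (uv A 0 x)) ((frameE φ x).symm (uv A 1 x))
        ((frameE φ x).symm z)) ((frameE φ x).symm (frameE φ x (starEnd ((frameE φ x).symm (uv A 0 x))
        ((frameE φ x).symm (uv A 1 x)) ((frameE φ x).symm z)))) : ℝ) = 0 := h3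
      rwa [ContinuousLinearEquiv.symm_apply_apply] at h4
    have huvi := linearIndependent_symm_uv (φ := φ) hS.coh hx
    rw [ker_starEnd huvi] at hker
    obtain ⟨r, s, t, hrst⟩ := Submodule.mem_span_triple.mp hker
    rw [← symm_zf, ← map_smul, ← map_smul, ← map_smul, ← map_add, ← map_add] at hrst
    have h5 := (frameE φ x).symm.injective hrst
    have hzv : z = -inf A x (0, fun i => μ x i) := by
      rw [hz]
      simp only [vv_eq, smul_neg, Finset.sum_neg_distrib, ← map_smul, ← map_sum]
      congr 2
      ext i
      · simp [Prod.fst_sum]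
      · simp [Prod.fst_sum]
      · simp [Prod.snd_sum, Finset.sum_apply, Pi.single_apply]
    have hpos := nz_pos (φ := φ) hS.coh hx
    have ht : t = 0 := by
      have h6 := congrArg (dnu φ A x) h5
      rw [hzv, map_neg, dnu_inf hS.inv hS.mm, map_add, map_add, map_smul, map_smul, map_smul,
        uv_eq, uv_eq, map_neg, map_neg, dnu_inf hS.inv hS.mm, dnu_inf hS.inv hS.mm] at h6
      simp only [neg_zero, smul_eq_mul, mul_zero, zero_add] at h6
      exact (mul_eq_zero.mp h6).resolve_right hpos.ne'
    rw [ht, zero_smul, add_zero, hzv, uv_eq, uv_eq, smul_neg, smul_neg, ← neg_add, ← map_smul,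
      ← map_smul, ← map_add, neg_inj] at h5
    have h7 := congrArg Prod.snd (inf_injective hS.coh hx h5)
    have hμ0 : ∀ i, μ x i = 0 := fun i => by
      have := congrFun h7 i
      simpa using this.symm
    have hzero : ∀ i, dmu φ A x (vv A i x) (vv A (i + 1) x) = 0 := fun i => by
      have := mu_eq hS.inv hS.mm x i
      rw [hμ0] at this
      linarith
    -- With μ(x) = 0 the formula for μ makes ∗φ(U₁, U₂, ·, ·) vanish on all pairs of the Vᵢ. This is
    -- excluded by `exists_starPhi0_ne_zero`, since U₁, U₂, Z, V₁, V₂, V₃ are independent.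
    have hall : ∀ i j, dmu φ A x (vv A i x) (vv A j x) = 0 := fun i j => by
      have hij : j = i ∨ j = i + 1 ∨ i = j + 1 := by
        revert i j; decide
      rcases hij with rfl | rfl | rfl
      · have := dmu_swap (φ := φ) (A := A) x (vv A j x) (vv A j x)
        linarith
      · exact hzero i
      · rw [dmu_swap, hzero, neg_zero]
    have hind : LinearIndependent ℝ ![(frameE φ x).symm (uv A 0 x), (frameE φ x).symm (uv A 1 x),
        cross0 ((frameE φ x).symm (uv A 0 x)) ((frameE φ x).symm (uv A 1 x)),
        (frameE φ x).symm (vv A 0 x), (frameE φ x).symm (vv A 1 x),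
        (frameE φ x).symm (vv A 2 x)] := by
      rw [← symm_zf, Fintype.linearIndependent_iff]
      intro g hg
      simp only [Fin.sum_univ_six, Matrix.cons_val] at hg
      simp only [← map_smul, ← map_add] at hg
      have h8 := (frameE φ x).symm.injective (hg.trans (map_zero _).symm)
      have hg2 : g 2 = 0 := by
        have h6 := congrArg (dnu φ A x) h8
        simp only [map_add, map_smul, uv_eq, vv_eq, map_neg, dnu_inf hS.inv hS.mm, neg_zero,
          mul_zero, add_zero, zero_add, smul_eq_mul, map_zero] at h6
        exact (mul_eq_zero.mp h6).resolve_right hpos.ne'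
      have h9 : inf A x (g 0 • A.u 0 + g 1 • A.u 1, ![g 3, g 4, g 5]) = 0 := by
        have e : ((g 0 • A.u 0 + g 1 • A.u 1, ![g 3, g 4, g 5]) : Par) =
            g 0 • (A.u 0, 0) + g 1 • (A.u 1, 0) + g 3 • (0, Pi.single 0 1) +
            g 4 • (0, Pi.single 1 1) + g 5 • (0, Pi.single 2 1) := by
          ext i
          · simp
          · simp
          · fin_cases i <;> simp
        rw [e, ← neg_eq_zero, ← h8, hg2]
        simp only [map_add, map_smul, uv_eq, vv_eq]
        module
      have h10 := inf_injective hS.coh hx (h9.trans (map_zero _).symm)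
      have h11 := congrArg Prod.snd h10
      have h12 := Fintype.linearIndependent_iff.mp A.u_indep (fun l => g (Fin.castLE (by omega) l))
        (by rw [Fin.sum_univ_two]; exact congrArg Prod.fst h10)
      intro i
      fin_cases i
      · exact h12 0
      · exact h12 1
      · exact hg2
      · exact congrFun h11 0
      · exact congrFun h11 1
      · exact congrFun h11 2
    obtain ⟨i, j, hij⟩ := exists_starPhi0_ne_zero (w := fun i => (frameE φ x).symm (vv A i x)) hind
    apply hij
    rw [← form4_eq, ← dmu_apply, hall]
  have hpos := nz_pos (φ := φ) hS.coh hx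
  -- The pair (dν, d|μ|²), up to a factor 2, is onto ℝ²: Z has positive first and vanishing second
  -- component. Its kernel has dimension 7 − 2 = 5, the dimension of the orbit.
  set f : E7 →ₗ[ℝ] ℝ × ℝ := (dnu φ A x).prod (dmu φ A x z) with hf
  obtain ⟨w, hw⟩ : ∃ w, dmu φ A x z w ≠ 0 := by
    by_contra! h; exact hne (LinearMap.ext h)
  have hsurj : LinearMap.range f = ⊤ := by
    rw [LinearMap.range_eq_top]
    rintro ⟨a, b⟩
    refine ⟨((a - b / dmu φ A x z w * dnu φ A x w) / nz φ A x) • zf φ A x +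
      (b / dmu φ A x z w) • w, Prod.ext ?_ ?_⟩
    · change dnu φ A x _ = a
      rw [map_add, map_smul, map_smul, smul_eq_mul, smul_eq_mul]
      change _ / nz φ A x * nz φ A x + _ = _
      rw [div_mul_cancel₀ _ hpos.ne']; ring
    · change dmu φ A x z _ = b
      rw [map_add, map_smul, map_smul, smul_eq_mul, smul_eq_mul, dmu_zf, mul_zero, zero_add,
        div_mul_cancel₀ _ hw]
  have hdim := f.finrank_range_add_finrank_ker
  rw [hsurj, finrank_top] at hdim
  have hle : orbitTan A x ≤ LinearMap.ker f := fun y hy => by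
    obtain ⟨p, rfl⟩ := (mem_orbitTan A).mp hy
    exact Prod.ext (dnu_inf hS.inv hS.mm x p) (drho_inf hS.inv hS.mm x p)
  have heq : orbitTan A x = LinearMap.ker f := by
    refine Submodule.eq_of_le_of_finrank_eq hle ?_
    rw [orbitTan_eq]
    have h3 := LinearMap.finrank_range_of_inj (f := (inf A x : Par →ₗ[ℝ] E7))
      (inf_injective hS.coh hx)
    have h4 : Module.finrank ℝ Par = 5 := by simp
    have h5 : Module.finrank ℝ (ℝ × ℝ) = 2 := by simp
    have h6 : Module.finrank ℝ E7 = 7 := by simp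
    have h7 : Module.finrank ℝ (inf A x).range = Module.finrank ℝ Par := h3
    omega
  rw [heq]
  exact Prod.ext h1 h2

end Principal

/-! ### Charts -/

section Chart

variable {M : Type*} [TopologicalSpace M] [ChartedSpace E7 M] [IsManifold (𝓡 7) ∞ M]

/-- The chart at a point. -/
abbrev ch (x₀ : M) : PartialEquiv M E7 := extChartAt (𝓡 7) x₀

theorem isOpen_ch_target (x₀ : M) : IsOpen (ch x₀).target := isOpen_extChartAt_target x₀

theorem isOpen_ch_source (x₀ : M) : IsOpen (ch x₀).source := isOpen_extChartAt_source x₀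

theorem contMDiffAt_ch {x₀ x : M} (hx : x ∈ (ch x₀).source) :
    ContMDiffAt (𝓡 7) 𝓘(ℝ, E7) ∞ (ch x₀) x :=
  contMDiffAt_extChartAt' (by rwa [extChartAt_source] at hx)

theorem contMDiffAt_ch_symm {x₀ : M} {y : E7} (hy : y ∈ (ch x₀).target) :
    ContMDiffAt 𝓘(ℝ, E7) (𝓡 7) ∞ (ch x₀).symm y :=
  (contMDiffOn_extChartAt_symm (n := ∞) x₀).contMDiffAt ((isOpen_ch_target x₀).mem_nhds hy)

/-- The differential of the chart at `x₀`. -/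
def chD (x₀ x : M) : E7 →L[ℝ] E7 := mfderiv (𝓡 7) 𝓘(ℝ, E7) (ch x₀) x

/-- The differential of the inverse of the chart at `x₀`. -/
def chI (x₀ : M) (y : E7) : E7 →L[ℝ] E7 := mfderiv 𝓘(ℝ, E7) (𝓡 7) (ch x₀).symm y

theorem hasMFDerivAt_ch {x₀ x : M} (hx : x ∈ (ch x₀).source) :
    HasMFDerivAt (𝓡 7) 𝓘(ℝ, E7) (ch x₀) x (chD x₀ x) :=
  ((contMDiffAt_ch hx).mdifferentiableAt (by simp)).hasMFDerivAt

theorem hasMFDerivAt_ch_symm {x₀ : M} {y : E7} (hy : y ∈ (ch x₀).target) :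
    HasMFDerivAt 𝓘(ℝ, E7) (𝓡 7) (ch x₀).symm y (chI x₀ y) :=
  ((contMDiffAt_ch_symm hy).mdifferentiableAt (by simp)).hasMFDerivAt

theorem chD_chI {x₀ : M} {y : E7} (hy : y ∈ (ch x₀).target) (v : E7) :
    chD x₀ ((ch x₀).symm y) (chI x₀ y v) = v := by
  have h1 := HasMFDerivAt.comp y (hasMFDerivAt_ch ((ch x₀).map_target hy)) (hasMFDerivAt_ch_symm hy)
  have h2 : HasMFDerivAt 𝓘(ℝ, E7) 𝓘(ℝ, E7) (ch x₀ ∘ (ch x₀).symm) y (.id ℝ E7) :=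
    (hasMFDerivAt_id y).congr_of_eventuallyEq (by
      filter_upwards [(isOpen_ch_target x₀).mem_nhds hy] with z hz
      exact (ch x₀).right_inv hz)
  exact congrArg (fun L : E7 →L[ℝ] E7 => L v) (hasMFDerivAt_unique h1 h2)

theorem chI_chD {x₀ x : M} (hx : x ∈ (ch x₀).source) (v : E7) :
    chI x₀ (ch x₀ x) (chD x₀ x v) = v := by
  have h1 := HasMFDerivAt.comp x (hasMFDerivAt_ch_symm ((ch x₀).map_source hx)) (hasMFDerivAt_ch hx)
  have h2 : HasMFDerivAt (𝓡 7) (𝓡 7) ((ch x₀).symm ∘ ch x₀) x (.id ℝ E7) :=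
    (hasMFDerivAt_id x).congr_of_eventuallyEq (by
      filter_upwards [(isOpen_ch_source x₀).mem_nhds hx] with z hz
      exact (ch x₀).left_inv hz)
  exact congrArg (fun L : E7 →L[ℝ] E7 => L v) (hasMFDerivAt_unique h1 h2)

/-- The differential of the chart, as an isomorphism. -/
def chEquiv {x₀ x : M} (hx : x ∈ (ch x₀).source) : E7 ≃L[ℝ] E7 :=
  .equivOfInverse (chD x₀ x) (chI x₀ (ch x₀ x)) (chI_chD hx) fun v => by
    have := chD_chI ((ch x₀).map_source hx) v
    rwa [(ch x₀).left_inv hx] at this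

theorem HasVelocity.chart {c : ℝ → M} {s : ℝ} {v : E7} (h : HasVelocity c s v) {x₀ : M}
    (hx : c s ∈ (ch x₀).source) : HasDerivAt (fun t => ch x₀ (c t)) (chD x₀ (c s) v) s := by
  have h3 : HasFDerivAt (ch x₀ ∘ c)
      ((chD x₀ (c s)).comp ((1 : ℝ →L[ℝ] ℝ).smulRight v : ℝ →L[ℝ] E7)) s :=
    HasMFDerivAt.hasFDerivAt (HasMFDerivAt.comp s (hasMFDerivAt_ch hx) h)
  exact h3.hasDerivAt.congr_deriv (by simp)

theorem hasVelocity_symm {x₀ : M} {d : ℝ → E7} {s : ℝ} {w : E7} (h : HasDerivAt d w s)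
    (hy : d s ∈ (ch x₀).target) :
    HasVelocity (fun t => (ch x₀).symm (d t)) s (chI x₀ (d s) w) := by
  have h2 := hasVelocity_of_hasMFDerivAt (L := (chI x₀ (d s)).comp (.toSpanSingleton ℝ w))
    (HasMFDerivAt.comp s (hasMFDerivAt_ch_symm hy) h.hasFDerivAt.hasMFDerivAt)
  exact h2.congr_vel (by simp)

theorem contMDiffAt_curve_of_chart {c : ℝ → M} {s : ℝ} {x₀ : M} (hc : ContinuousAt c s)
    (hx : c s ∈ (ch x₀).source) (h : ContDiffAt ℝ ∞ (fun t => ch x₀ (c t)) s) :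
    ContMDiffAt 𝓘(ℝ, ℝ) (𝓡 7) ∞ c s := by
  have h1 := ContMDiffAt.comp s (contMDiffAt_ch_symm ((ch x₀).map_source hx)) h.contMDiffAt
  refine h1.congr_of_eventuallyEq ?_
  filter_upwards [hc.preimage_mem_nhds ((isOpen_ch_source x₀).mem_nhds hx)] with t ht
  exact ((ch x₀).left_inv ht).symm

theorem contDiffAt_chart_curve {c : ℝ → M} {s : ℝ} {x₀ : M} (hx : c s ∈ (ch x₀).source)
    (h : ContMDiffAt 𝓘(ℝ, ℝ) (𝓡 7) ∞ c s) : ContDiffAt ℝ ∞ (fun t => ch x₀ (c t)) s :=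
  contMDiffAt_iff_contDiffAt.mp ((contMDiffAt_ch hx).comp s h)

end Chart

/-! ### The action in a chart -/

section ActChart

variable {M : Type*} [TopologicalSpace M] [ChartedSpace E7 M] [IsManifold (𝓡 7) ∞ M]
  [MulAction Grp M] [ContMDiffSMul modelGrp (𝓡 7) ∞ Grp M] (A : AdaptedBasis)

/-- The action in a chart. -/
def actCh (A : AdaptedBasis) (x₀ : M) (z : Par × E7) : E7 :=
  ch x₀ (A.expG z.1 • (ch x₀).symm z.2)

theorem contDiffAt_actCh {x₀ : M} {y : E7} (hy : y ∈ (ch x₀).target) :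
    ContDiffAt ℝ ∞ (actCh A x₀) (0, y) := by
  have h0 : A.expG (0 : Par) • (ch x₀).symm y = (ch x₀).symm y := by rw [A.expG_zero, one_smul]
  have h1 : ContMDiffAt 𝓘(ℝ, Par × E7) (𝓘(ℝ, Par).prod (𝓡 7)) ∞
      (fun z : Par × E7 => (z.1, (ch x₀).symm z.2)) (0, y) :=
    contDiff_fst.contMDiff.contMDiffAt.prodMk
      (ContMDiffAt.comp (0, y) (contMDiffAt_ch_symm hy) contDiff_snd.contMDiff.contMDiffAt)
  have h2 := ContMDiffAt.comp (0, y) (contMDiff_act A M).contMDiffAt h1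
  have h3 : ContMDiffAt (𝓡 7) 𝓘(ℝ, E7) ∞ (ch x₀) (A.expG (0 : Par) • (ch x₀).symm y) := by
    rw [h0]; exact contMDiffAt_ch ((ch x₀).map_target hy)
  exact contMDiffAt_iff_contDiffAt.mp (ContMDiffAt.comp (0, y) h3 h2)

/-- The infinitesimal action in a chart. -/
def infCh (A : AdaptedBasis) (x₀ : M) (y : E7) : Par →L[ℝ] E7 :=
  (fderiv ℝ (actCh A x₀) (0, y)).comp (.inl ℝ Par E7)

theorem contDiffAt_infCh {x₀ : M} {y : E7} (hy : y ∈ (ch x₀).target) :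
    ContDiffAt ℝ ∞ (infCh A x₀) y := by
  have h1 : ContDiffAt ℝ ∞ (fderiv ℝ (actCh A x₀)) (0, y) :=
    (contDiffAt_actCh A hy).fderiv_right (by simp)
  have h2 : ContDiffAt ℝ ∞ (fun y : E7 => fderiv ℝ (actCh A x₀) ((0 : Par), y)) y :=
    h1.comp y (contDiffAt_const.prodMk contDiffAt_id)
  exact h2.clm_comp contDiffAt_const

theorem hasFDerivAt_actCh {x₀ : M} {y : E7} (hy : y ∈ (ch x₀).target) :
    HasStrictFDerivAt (actCh A x₀)
      ((infCh A x₀ y).comp (.fst ℝ Par E7) + .snd ℝ Par E7) (0, y) := by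
  have h1 := (contDiffAt_actCh A hy).hasStrictFDerivAt (by simp)
  have h2 : fderiv ℝ (actCh A x₀) (0, y) =
      (infCh A x₀ y).comp (.fst ℝ Par E7) + .snd ℝ Par E7 := by
    refine ContinuousLinearMap.ext fun z => ?_
    have h3 : HasFDerivAt (fun r : E7 => actCh A x₀ ((0 : Par), r))
        ((fderiv ℝ (actCh A x₀) (0, y)).comp (.inr ℝ Par E7)) y :=
      h1.hasFDerivAt.comp y (hasFDerivAt_prodMk_right (0 : Par) y)
    have h4 : HasFDerivAt (fun r : E7 => actCh A x₀ ((0 : Par), r)) (.id ℝ E7) y :=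
      (hasFDerivAt_id y).congr_of_eventuallyEq (by
        filter_upwards [(isOpen_ch_target x₀).mem_nhds hy] with r hr
        rw [actCh, A.expG_zero, one_smul]
        exact (ch x₀).right_inv hr)
    have h5 := congrArg (fun L : E7 →L[ℝ] E7 => L z.2) (h3.unique h4)
    have h6 : z = (z.1, 0) + (0, z.2) := by simp
    conv_lhs => rw [h6, map_add]
    exact congrArg₂ (· + ·) rfl h5
  rwa [h2] at h1

theorem chD_inf {x₀ x : M} (hx : x ∈ (ch x₀).source) (p : Par) :
    chD x₀ x (inf A x p) = infCh A x₀ (ch x₀ x) p := by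
  have h1 := hasVelocity_expG A x p 0
  rw [zero_smul, A.expG_zero, one_smul] at h1
  have h2 := h1.chart (x₀ := x₀) (by simpa [A.expG_zero] using hx)
  have h3 : HasDerivAt (fun t : ℝ => ((t • p, ch x₀ x) : Par × E7)) (p, 0) 0 := by
    have := ((hasDerivAt_id (0 : ℝ)).smul_const p).prodMk (hasDerivAt_const (0 : ℝ) (ch x₀ x))
    simpa using this
  have h4 : HasFDerivAt (actCh A x₀) ((infCh A x₀ (ch x₀ x)).comp (.fst ℝ Par E7) + .snd ℝ Par E7)
      ((fun t : ℝ => ((t • p, ch x₀ x) : Par × E7)) 0) := by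
    simp only [zero_smul]
    exact (hasFDerivAt_actCh A ((ch x₀).map_source hx)).hasFDerivAt
  have h5 := h4.comp_hasDerivAt (0 : ℝ) h3
  have h6 : actCh A x₀ ∘ (fun t : ℝ => ((t • p, ch x₀ x) : Par × E7)) =
      fun t => ch x₀ (A.expG (t • p) • x) := by
    ext1 t
    simp only [Function.comp, actCh]
    rw [(ch x₀).left_inv hx]
  rw [h6] at h5
  have h7 := h2.unique h5
  simpa [A.expG_zero] using h7

variable (φ : G2Structure M)

/-- The field `U₁ × U₂` in a chart. -/
def zCh (φ : G2Structure M) (A : AdaptedBasis) (x₀ : M) (y : E7) : E7 :=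
  crossOf (chartForm φ.form x₀ y) (-infCh A x₀ y (A.u 0, 0)) (-infCh A x₀ y (A.u 1, 0))

theorem chartForm_preserves {x₀ : M} {y : E7} (hy : y ∈ (ch x₀).target) (w : Fin 3 → E7) :
    chartForm φ.form x₀ y (fun i => ((frameE φ ((ch x₀).symm y)).trans
      (chEquiv ((ch x₀).map_target hy))) (w i)) = phi0 w := by
  rw [← φ.form_frame ((ch x₀).symm y) w]
  change φ.form ((ch x₀).symm y) (fun i => chI x₀ y (chD x₀ ((ch x₀).symm y) _)) = _
  congr 1
  ext1 i
  have := chI_chD ((ch x₀).map_target hy) (frameE φ ((ch x₀).symm y) (w i))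
  rwa [(ch x₀).right_inv hy] at this

theorem contDiffAt_zCh {x₀ : M} {y : E7} (hy : y ∈ (ch x₀).target) :
    ContDiffAt ℝ ∞ (zCh φ A x₀) y :=
  contDiffAt_crossOf ((φ.smooth x₀).contDiffAt ((isOpen_ch_target x₀).mem_nhds hy))
    ((contDiffAt_infCh A hy).clm_apply contDiffAt_const).neg
    ((contDiffAt_infCh A hy).clm_apply contDiffAt_const).neg (chartForm_preserves φ hy)

theorem chD_zf {x₀ x : M} (hx : x ∈ (ch x₀).source) :
    chD x₀ x (zf φ A x) = zCh φ A x₀ (ch x₀ x) := by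
  have hu : ∀ l, -infCh A x₀ (ch x₀ x) (A.u l, 0) = chD x₀ x (uv A l x) := fun l => by
    rw [uv_eq, map_neg, chD_inf A hx]
  have hy := (ch x₀).map_source hx
  rw [zCh, hu, hu, crossOf_eq (chartForm_preserves φ hy)]
  have key : ∀ (z : M) (hz : z ∈ (ch x₀).source), z = x → chD x₀ x (zf φ A x) =
      ((frameE φ z).trans (chEquiv hz)) (cross0 (((frameE φ z).trans (chEquiv hz)).symm
        (chD x₀ x (uv A 0 x))) (((frameE φ z).trans (chEquiv hz)).symm (chD x₀ x (uv A 1 x)))) := by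
    rintro z hz rfl
    have h1 : ∀ v, ((frameE φ z).trans (chEquiv hz)).symm (chD x₀ z v) = (frameE φ z).symm v :=
      fun v => by
        rw [ContinuousLinearEquiv.symm_apply_eq]
        simp [chEquiv]
    rw [h1, h1, ← symm_zf]
    simp [chEquiv]
  exact key _ _ ((ch x₀).left_inv hx)

/-- In a chart the field is given by `crossOf`, so the pointwise choice of frames does no harm.
Smoothness gives access to existence and uniqueness of integral curves. -/
theorem contMDiff_crossField : ContMDiff (𝓡 7) (𝓡 7).tangent ∞
    (fun x => (⟨x, crossField φ A x⟩ : TangentBundle (𝓡 7) M)) := fun x₀ => by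
  have : IsManifold (𝓡 7) 1 M := IsManifold.of_le (n := ∞) ENat.LEInfty.out
  rw [Bundle.contMDiffAt_section]
  have h1 : ContMDiffAt (𝓡 7) 𝓘(ℝ, E7) ∞ (fun x => zCh φ A x₀ (ch x₀ x)) x₀ :=
    ContMDiffAt.comp (g := zCh φ A x₀) x₀ (contDiffAt_zCh A φ (mem_extChartAt_target x₀)).contMDiffAt
      (contMDiffAt_ch (mem_extChartAt_source x₀))
  refine h1.congr_of_eventuallyEq ?_
  filter_upwards [(isOpen_ch_source x₀).mem_nhds (mem_extChartAt_source x₀)] with x hx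
  rw [← chD_zf A φ hx]
  have hx' : x ∈ (chartAt E7 x₀).source := by rwa [extChartAt_source] at hx
  have h2 := TangentBundle.continuousLinearMapAt_trivializationAt (I := 𝓡 7) hx'
  have h3 := congrArg (fun L : TangentSpace (𝓡 7) x →L[ℝ] E7 => L (crossField φ A x)) h2
  refine Eq.trans ?_ h3
  simp only [Bundle.Trivialization.continuousLinearMapAt_apply]
  rw [Bundle.Trivialization.coe_linearMapAt_of_mem]
  rwa [TangentBundle.trivializationAt_baseSet]

end ActChart

/-! ### Integral curves -/

/-- Solutions of smooth autonomous differential equations are smooth. -/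
theorem contDiffOn_of_hasDerivAt {E : Type*} [NormedAddCommGroup E] [NormedSpace ℝ E]
    {f : E → E} {U : Set E} (hf : ContDiffOn ℝ ∞ f U) {d : ℝ → E} {I : Set ℝ} (hI : IsOpen I)
    (hd : MapsTo d I U) (h : ∀ s ∈ I, HasDerivAt d (f (d s)) s) : ContDiffOn ℝ ∞ d I := by
  have hdiff : DifferentiableOn ℝ d I := fun s hs => (h s hs).differentiableAt.differentiableWithinAt
  rw [contDiffOn_infty]
  intro n
  induction n with
  | zero => exact contDiffOn_zero.mpr hdiff.continuousOn
  | succ n ih =>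
    -- Bootstrap: the derivative of d is f ∘ d, which is as regular as d.
    refine (contDiffOn_succ_iff_deriv_of_isOpen (n := (n : ℕ∞ω)) hI).mpr
      ⟨hdiff, fun h => absurd h (by simp), ?_⟩
    refine ContDiffOn.congr (f := f ∘ d) ?_ fun s hs => (h s hs).deriv
    exact (hf.of_le ENat.LEInfty.out).comp ih hd

section ZCurve

variable {M : Type*} [TopologicalSpace M] [ChartedSpace E7 M] [MulAction Grp M]

/-- `c` is, on `I`, an integral curve in `M` of the field `U₁ × U₂`. -/
def IsZ (φ : G2Structure M) (A : AdaptedBasis) (c : ℝ → M) (I : Set ℝ) : Prop :=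
  ∀ s ∈ I, HasVelocity c s (zf φ A (c s))

variable [IsManifold (𝓡 7) ∞ M] [ContMDiffSMul modelGrp (𝓡 7) ∞ Grp M] {A : AdaptedBasis}
  {φ : G2Structure M} {c d : ℝ → M} {I : Set ℝ}

theorem IsZ.mono (h : IsZ φ A c I) {I' : Set ℝ} (hI : I' ⊆ I) : IsZ φ A c I' :=
  fun s hs => h s (hI hs)

theorem IsZ.congr (h : IsZ φ A c I) (hI : IsOpen I) (hcd : EqOn d c I) : IsZ φ A d I :=
  fun s hs => by
    rw [hcd hs]
    exact (h s hs).congr (hcd.eventuallyEq_of_mem (hI.mem_nhds hs))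

theorem exists_isZ (φ : G2Structure M) (A : AdaptedBasis) (x : M) (t₀ : ℝ) :
    ∃ ε > 0, ∃ c : ℝ → M, c t₀ = x ∧ IsZ φ A c (Ioo (t₀ - ε) (t₀ + ε)) := by
  have : IsManifold (𝓡 7) 1 M := IsManifold.of_le (n := ∞) ENat.LEInfty.out
  obtain ⟨c, hc, h⟩ := exists_isMIntegralCurveAt_of_contMDiffAt_boundaryless (I := 𝓡 7) t₀
    ((contMDiff_crossField A φ).of_le ENat.LEInfty.out x)
  obtain ⟨ε, hε, hb⟩ := Metric.eventually_nhds_iff_ball.mp h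
  refine ⟨ε, hε, c, hc, fun s hs => hb s ?_⟩
  rwa [Real.ball_eq_Ioo]

theorem IsZ.eqOn [T2Space M] (hc : IsZ φ A c I) (hd : IsZ φ A d I) (hI : IsOpen I)
    (hI' : I.OrdConnected) {t₀ : ℝ} (ht₀ : t₀ ∈ I) (h : c t₀ = d t₀) : EqOn c d I := by
  have : IsManifold (𝓡 7) 1 M := IsManifold.of_le (n := ∞) ENat.LEInfty.out
  intro t ht
  obtain ⟨ε₁, h1, hb1⟩ := Metric.isOpen_iff.mp hI _ (min_rec' (· ∈ I) ht₀ ht)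
  obtain ⟨ε₂, h2, hb2⟩ := Metric.isOpen_iff.mp hI _ (max_rec' (· ∈ I) ht₀ ht)
  set a := min t₀ t - ε₁ / 2
  set b := max t₀ t + ε₂ / 2
  have hsub : Ioo a b ⊆ I := by
    refine Ioo_subset_Icc_self.trans (hI'.out (hb1 ?_) (hb2 ?_))
    · rw [Real.ball_eq_Ioo]; constructor <;> simp [a] <;> linarith
    · rw [Real.ball_eq_Ioo]; constructor <;> simp [b] <;> linarith
  have hat : ∀ t', min t₀ t ≤ t' → t' ≤ max t₀ t → t' ∈ Ioo a b := fun t' h3 h4 =>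
    ⟨by simp only [a]; linarith, by simp only [b]; linarith⟩
  have key : ∀ e : ℝ → M, IsZ φ A e I →
      IsMIntegralCurveOn (I := 𝓡 7) e (crossField φ A) (Ioo a b) := fun e he s hs =>
    HasMFDerivAt.hasMFDerivWithinAt (he s (hsub hs))
  exact isMIntegralCurveOn_Ioo_eqOn_of_contMDiff_boundaryless
    (hat t₀ (min_le_left _ _) (le_max_left _ _))
    ((contMDiff_crossField A φ).of_le ENat.LEInfty.out) (key c hc) (key d hd) h
    (hat t (min_le_right _ _) (le_max_right _ _))

theorem IsZ.contMDiffAt (hc : IsZ φ A c I) (hI : IsOpen I) {t : ℝ} (ht : t ∈ I) :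
    ContMDiffAt 𝓘(ℝ, ℝ) (𝓡 7) ∞ c t := by
  have hcont : ContinuousOn c I := fun s hs => (hc s hs).continuousAt.continuousWithinAt
  set J := I ∩ c ⁻¹' (ch (c t)).source
  have hJ : IsOpen J := hcont.isOpen_inter_preimage hI (isOpen_ch_source _)
  have htJ : t ∈ J := ⟨ht, mem_extChartAt_source _⟩
  refine contMDiffAt_curve_of_chart (hc t ht).continuousAt htJ.2 ?_
  refine (contDiffOn_of_hasDerivAt (f := zCh φ A (c t)) (U := (ch (c t)).target)
    (fun y hy => (contDiffAt_zCh A φ hy).contDiffWithinAt) hJ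
    (fun s hs => (ch (c t)).map_source hs.2) fun s hs => ?_).contDiffAt (hJ.mem_nhds htJ)
  rw [← chD_zf A φ hs.2]
  exact (hc s hs.1).chart hs.2

theorem IsZ.smul (hinv : φ.IsInvariant) (hc : IsZ φ A c I) (g : Grp) :
    IsZ φ A (fun t => g • c t) I := fun s hs =>
  ((hc s hs).smul g).congr_vel (dact_zf A hinv g (c s))

theorem IsZ.comp_add (hc : IsZ φ A c I) (τ : ℝ) :
    IsZ φ A (fun t => c (t + τ)) ((fun t => t + τ) ⁻¹' I) := fun s hs =>
  (HasVelocity.comp (σ := fun t => t + τ) (hc (s + τ) hs)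
    ((hasDerivAt_id s).add_const τ)).congr_vel (one_smul ℝ _)

end ZCurve

/-! ### Calculus -/

section Calculus

variable {E F : Type*} [NormedAddCommGroup E] [NormedSpace ℝ E] [NormedAddCommGroup F]
  [NormedSpace ℝ F] [FiniteDimensional ℝ E]

theorem exists_norm_le_of_injective {D : E →L[ℝ] F} (hD : Function.Injective D) :
    ∃ K > 0, ∀ v, ‖v‖ ≤ K * ‖D v‖ := by
  obtain ⟨K, hK, h⟩ := (D : E →ₗ[ℝ] F).exists_antilipschitzWith (LinearMap.ker_eq_bot.mpr hD)
  refine ⟨K, hK, fun v => ?_⟩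
  have := h.le_mul_dist v 0
  simpa using this

/-- A map with injective strict derivative is locally bi-Lipschitz from below. -/
theorem exists_nhds_norm_sub_le {f : E → F} {D : E →L[ℝ] F} {a : E} (hf : HasStrictFDerivAt f D a)
    (hD : Function.Injective D) :
    ∃ K > 0, ∃ U ∈ 𝓝 a, ∀ y ∈ U, ∀ z ∈ U, ‖y - z‖ ≤ K * ‖f y - f z‖ := by
  obtain ⟨K, hK, h⟩ := exists_norm_le_of_injective hD
  have h1 := hf.isLittleO.def (c := 1 / (2 * K)) (by positivity)
  rw [nhds_prod_eq] at h1
  obtain ⟨U, hU, hb⟩ := eventually_prod_self_iff'.mp h1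
  refine ⟨2 * K, by positivity, U, hU, fun y hy z hz => ?_⟩
  have h2 : ‖f y - f z - D (y - z)‖ ≤ 1 / (2 * K) * ‖y - z‖ := hb y hy z hz
  have h3 := h (y - z)
  have h4 : ‖D (y - z)‖ ≤ ‖f y - f z‖ + ‖f y - f z - D (y - z)‖ := by
    have := norm_sub_le (f y - f z) (f y - f z - D (y - z))
    rwa [sub_sub_cancel] at this
  have h5 : K * (1 / (2 * K) * ‖y - z‖) = ‖y - z‖ / 2 := by field_simp
  nlinarith

open Asymptotics in
-- No differentiability of τ is assumed. Injectivity of D gives τ = O(Dτ), so the error is o(Dτ) and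
-- Dτ is comparable to Δ. Hence Dτ has the same derivative v as Δ, a limit of difference quotients
-- in the closed range of D.
theorem mem_range_of_isLittleO {D : E →L[ℝ] F} (hD : Function.Injective D) {τ : ℝ → E}
    {Δ : ℝ → F} {t : ℝ} {v : F} (h0 : τ t = 0) (hΔ0 : Δ t = 0) (hΔ : HasDerivAt Δ v t)
    (h : (fun s => Δ s - D (τ s)) =o[𝓝 t] τ) : v ∈ D.range := by
  obtain ⟨K, hK, hb⟩ := exists_norm_le_of_injective hD
  have h1 : τ =O[𝓝 t] fun s => D (τ s) := IsBigO.of_bound K (Eventually.of_forall fun s => hb _)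
  have h2 : (fun s => D (τ s) - Δ s) =o[𝓝 t] fun s => D (τ s) := by
    have := (h.trans_isBigO h1).neg_left
    simpa using this
  have h3 := h2.right_isBigO_sub
  simp only [sub_sub_cancel] at h3
  have h4 : Δ =O[𝓝 t] fun s => s - t := by simpa [hΔ0] using hΔ.isBigO_sub
  have h5 : HasDerivAt (fun s => D (τ s)) v t := by
    rw [hasDerivAt_iff_isLittleO] at hΔ ⊢
    have h6 := hΔ.add (h2.trans_isBigO (h3.trans h4))
    refine h6.congr_left fun s => ?_
    rw [hΔ0, h0, map_zero]
    abel
  have hcl : IsClosed (D.range : Set F) := Submodule.closed_of_finiteDimensional _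
  refine hcl.mem_of_tendsto (hasDerivAt_iff_tendsto_slope.mp h5) (Eventually.of_forall fun s => ?_)
  rw [slope_def_module, h0, map_zero, sub_zero]
  exact Submodule.smul_mem _ _ ⟨_, rfl⟩

theorem mem_range_of_hasDerivAt_comp {D : E →L[ℝ] F} (hD : Function.Injective D) {f : E → F}
    {y : ℝ → E} {t : ℝ} {v : F} (hf : HasFDerivAt f D (y t)) (hy : ContinuousAt y t)
    (h : HasDerivAt (fun s => f (y s)) v t) : v ∈ D.range := by
  refine mem_range_of_isLittleO hD (τ := fun s => y s - y t) (Δ := fun s => f (y s) - f (y t))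
    (sub_self _) (sub_self _) (h.sub_const _) ?_
  exact hf.isLittleO.comp_tendsto hy

/-- Admissible values that can be found arbitrarily small near t are chosen almost minimal in norm,
so that a single function works for all δ at once. -/
theorem exists_tendsto_selection {P : ℝ → E → Prop} {t : ℝ} (h0 : P t 0)
    (h : ∀ δ > 0, ∀ᶠ s in 𝓝 t, ∃ τ, ‖τ‖ < δ ∧ P s τ) :
    ∃ τ : ℝ → E, τ t = 0 ∧ Tendsto τ (𝓝 t) (𝓝 0) ∧ ∀ᶠ s in 𝓝 t, P s (τ s) := by
  have hex : ∀ s, ∃ τ : E, (s = t → τ = 0) ∧ ((∃ τ, P s τ) → P s τ ∧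
      ∀ τ', P s τ' → ‖τ‖ ≤ ‖τ'‖ + |s - t|) := by
    intro s
    by_cases hst : s = t
    · exact ⟨0, fun _ => rfl, fun _ => ⟨hst ▸ h0, fun τ' _ => by rw [norm_zero]; positivity⟩⟩
    by_cases hP : ∃ τ, P s τ
    · obtain ⟨τ₁, h1⟩ := hP
      -- The infimum of the norms need not be attained; the slack |s − t| is positive for s ≠ t and
      -- tends to zero.
      obtain ⟨_, ⟨τ, hτ, rfl⟩, hlt⟩ := Real.lt_sInf_add_pos (s := norm '' {τ | P s τ})
        ⟨_, τ₁, h1, rfl⟩ (abs_pos.mpr (sub_ne_zero.mpr hst))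
      refine ⟨τ, fun h => absurd h hst, fun _ => ⟨hτ, fun τ' h' => ?_⟩⟩
      have : sInf (norm '' {τ | P s τ}) ≤ ‖τ'‖ :=
        csInf_le ⟨0, by rintro _ ⟨z, -, rfl⟩; positivity⟩ ⟨τ', h', rfl⟩
      linarith
    · exact ⟨0, fun _ => rfl, fun h => absurd h hP⟩
  choose τ hτ0 hτ using hex
  refine ⟨τ, hτ0 t rfl, ?_, ?_⟩
  · rw [Metric.tendsto_nhds]
    intro ε hε
    filter_upwards [h (ε / 2) (half_pos hε), Metric.ball_mem_nhds t (half_pos hε)] with s hs hst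
    obtain ⟨τ', h1, h2⟩ := hs
    have h3 := (hτ s ⟨τ', h2⟩).2 τ' h2
    rw [Metric.mem_ball, Real.dist_eq] at hst
    rw [dist_zero_right]
    linarith
  · filter_upwards [h 1 one_pos] with s hs
    obtain ⟨τ', -, h2⟩ := hs
    exact (hτ s ⟨τ', h2⟩).1

end Calculus

/-! ### The torus action and the invariant functions near a principal point. -/

section Local

variable {M : Type*} [TopologicalSpace M] [ChartedSpace E7 M] [MulAction Grp M]
  [IsManifold (𝓡 7) ∞ M] [T2Space M]
  [ContMDiffSMul modelGrp (𝓡 7) ∞ Grp M] {A : AdaptedBasis} {φ : G2Structure M}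
  {ν : M → ℝ} {μ : M → EuclideanSpace ℝ (Fin 3)} {x : M}

theorem eventually_exists_expG_torus (A : AdaptedBasis) {δ : ℝ} (hδ : 0 < δ) :
    ∀ᶠ a : Torus in 𝓝 1, ∃ τ : ℝ × ℝ, ‖τ‖ < δ ∧ A.expG (τ, 0) = (a, 1) := by
  have h1 : ContinuousAt (fun a : Circle => Complex.arg a) 1 :=
    (Complex.continuousAt_arg (by simp [Complex.mem_slitPlane_iff])).comp
      continuous_subtype_val.continuousAt
  have h2 : ContinuousAt (fun a : Torus => (Complex.arg a.1, Complex.arg a.2)) 1 :=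
    (ContinuousAt.comp (f := Prod.fst) (x := (1 : Torus)) h1 continuous_fst.continuousAt).prodMk
      (ContinuousAt.comp (f := Prod.snd) (x := (1 : Torus)) h1 continuous_snd.continuousAt)
  have h3 := h2.eventually (Metric.ball_mem_nhds _ hδ)
  filter_upwards [h3] with a ha
  refine ⟨(Complex.arg a.1, Complex.arg a.2), ?_, Prod.ext (Prod.ext ?_ ?_) (A.expG_torus_snd _)⟩
  · simpa [dist_eq_norm] using ha
  · exact Circle.exp_arg a.1
  · exact Circle.exp_arg a.2

variable (hS : MomentSetting A φ ν μ)
include hS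

/-- The torus acts properly, with trivial isotropy modulo the kernel, near a principal point. -/
theorem exists_tube (hx : x ∈ principalSet M) {δ : ℝ} (hδ : 0 < δ) :
    ∃ N ∈ 𝓝 x, ∀ y ∈ N, ∀ a : Torus, ((a, 1) : Grp) • y ∈ N →
      ∃ τ : ℝ × ℝ, ‖τ‖ < δ ∧ A.expG (τ, 0) • y = ((a, 1) : Grp) • y := by
  have hcs := continuousSMul_grp M
  set W : Set Torus := interior {a | ∃ τ : ℝ × ℝ, ‖τ‖ < δ ∧ A.expG (τ, 0) = (a, 1)} with hW
  have hW1 : (1 : Torus) ∈ W := mem_interior_iff_mem_nhds.mpr (eventually_exists_expG_torus A hδ)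
  -- O consists of the small torus elements multiplied by those that fix x. Outside O no element
  -- fixes x, and compactness turns this into a uniform statement: near x, no element outside O
  -- returns a nearby point to the neighbourhood.
  set O : Set Torus := ⋃ k ∈ {k : Torus | ((k, 1) : Grp) • x = x}, (fun a => k⁻¹ * a) ⁻¹' W with hO
  have hOo : IsOpen O := isOpen_biUnion fun k _ =>
    isOpen_interior.preimage (continuous_const.mul continuous_id)
  have hC : IsCompact Oᶜ := hOo.isClosed_compl.isCompact
  have hne : ∀ a ∈ Oᶜ, ∀ᶠ z : (M × M) × Torus in 𝓝 ((x, x), a),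
      ((z.2, 1) : Grp) • z.1.1 ≠ z.1.2 := by
    intro a ha
    have h1 : ((a, 1) : Grp) • x ≠ x := fun h => ha (by
      refine mem_biUnion (x := a) h ?_
      change a⁻¹ * a ∈ W
      rwa [inv_mul_cancel])
    have h2 : Continuous fun z : (M × M) × Torus => ((z.2, 1) : Grp) • z.1.1 :=
      (continuous_snd.prodMk continuous_const).smul (continuous_fst.comp continuous_fst)
    exact (isOpen_ne_fun h2 (continuous_snd.comp continuous_fst)).mem_nhds h1
  have h3 := hC.eventually_forall_of_forall_eventually
    (P := fun (z : M × M) (a : Torus) => ((a, 1) : Grp) • z.1 ≠ z.2) hne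
  rw [nhds_prod_eq] at h3
  obtain ⟨N, hN, hb⟩ := eventually_prod_self_iff'.mp h3
  refine ⟨N, hN, fun y hy a hay => ?_⟩
  have haO : a ∈ O := by
    by_contra h
    exact hb y hy _ hay a h rfl
  obtain ⟨k, hk, hak⟩ := mem_iUnion₂.mp haO
  obtain ⟨τ, hτ, he⟩ := interior_subset hak
  refine ⟨τ, hτ, ?_⟩
  -- The factor k fixes the principal point x, so it acts trivially and can be dropped.
  have hky := smul_eq_of_smul_eq hS hx (g := ((k, 1) : Grp)) hk (A.expG (τ, 0) • y)
  rw [← hky, he, smul_smul]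
  congr 1
  exact Prod.ext (mul_inv_cancel_left k a) (one_mul 1)

/-- The velocities of two lifts of the same curve in the torus quotient. -/
theorem sub_mem_torusTan (hx : x ∈ principalSet M) {c d : ℝ → M} {t : ℝ} {v w : E7}
    (hc : HasVelocity c t v) (hd : HasVelocity d t w) (hct : c t = x) (hdt : d t = x)
    (h : ∀ᶠ s in 𝓝 t, ∃ a : Torus, ((a, 1) : Grp) • d s = c s) : v - w ∈ torusTan A x := by
  have hsx : x ∈ (ch x).source := mem_extChartAt_source x
  -- The torus element relating c and d need not be continuous in time; the tube replaces it by
  -- small exponentials with the same effect.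
  have hsel : ∀ δ > 0, ∀ᶠ s in 𝓝 t, ∃ τ : ℝ × ℝ, ‖τ‖ < δ ∧ A.expG (τ, 0) • d s = c s := by
    intro δ hδ
    obtain ⟨N, hN, hb⟩ := exists_tube hS hx hδ
    filter_upwards [h, hc.continuousAt.eventually (hct.symm ▸ hN),
      hd.continuousAt.eventually (hdt.symm ▸ hN)] with s hs hcs hds
    obtain ⟨a, ha⟩ := hs
    obtain ⟨τ, h1, h2⟩ := hb _ hds a (ha ▸ hcs)
    exact ⟨τ, h1, h2.trans ha⟩
  obtain ⟨τ, hτ0, hτ, hP⟩ := exists_tendsto_selection (P := fun s τ => A.expG (τ, 0) • d s = c s)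
    (by rw [show ((0, 0) : Par) = 0 from rfl, A.expG_zero, one_smul, hct, hdt]) hsel
  set D : ℝ × ℝ →L[ℝ] E7 := (infCh A x (ch x x)).comp (.inl ℝ (ℝ × ℝ) (Fin 3 → ℝ)) with hDd
  have hDinf : ∀ a, D a = chD x x (infT A x a) := fun a => (chD_inf A hsx (a, 0)).symm
  have hD : Function.Injective D := fun a b hab => by
    rw [hDinf, hDinf] at hab
    exact congrArg Prod.fst (inf_injective hS.coh hx ((chEquiv hsx).injective hab))
  have hcv := hc.chart (x₀ := x) (by rwa [hct])
  have hdv := hd.chart (x₀ := x) (by rwa [hdt])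
  rw [hct] at hcv
  rw [hdt] at hdv
  have hcd := hcv.fun_sub hdv
  rw [← map_sub] at hcd
  have hstrict := (hasFDerivAt_actCh A ((ch x).map_source hsx)).isLittleO
  have htend : Tendsto (fun s => ((((τ s, 0) : Par), ch x (d s)), ((0 : Par), ch x (d s)))) (𝓝 t)
      (𝓝 ((0, ch x x), (0, ch x x))) := by
    have h1 : Tendsto (fun s => ch x (d s)) (𝓝 t) (𝓝 (ch x x)) := by
      have := hdv.continuousAt.tendsto
      rwa [hdt] at this
    exact ((hτ.prodMk_nhds tendsto_const_nhds).prodMk_nhds h1).prodMk_nhds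
      (tendsto_const_nhds.prodMk_nhds h1)
  -- Strict differentiability of the action at (0, x) gives, in the chart, c − d = Dτ + o(τ),
  -- although the base point d s moves.
  have hlit := hstrict.comp_tendsto htend
  have hmem : chD x x (v - w) ∈ D.range := by
    refine mem_range_of_isLittleO hD hτ0 (by simp [hct, hdt]) hcd ?_
    have h2 : (fun s => ((((τ s, 0) : Par), ch x (d s)) : Par × E7) - ((0 : Par), ch x (d s)))
        =O[𝓝 t] τ := by
      refine Asymptotics.IsBigO.of_bound 1 (Eventually.of_forall fun s => ?_)
      simp
    refine (hlit.trans_isBigO h2).congr' ?_ EventuallyEq.rfl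
    have hev : ∀ᶠ s in 𝓝 t, d s ∈ (ch x).source := hd.continuousAt.eventually (by
      rw [hdt]; exact (isOpen_ch_source x).mem_nhds hsx)
    filter_upwards [hP, hev] with s hs hds
    simp only [Function.comp, actCh, A.expG_zero, one_smul, (ch x).left_inv hds, hs]
    simp [hDd]
  obtain ⟨a, ha⟩ := hmem
  refine (mem_torusTan A).mpr ⟨a, (chEquiv hsx).injective ?_⟩
  exact (hDinf a).symm.trans ha

variable [ConnectedSpace M]

/-- The functions `ν` and `|μ|` separate the orbits near a principal point. -/
theorem exists_nhds_same_orbit (hx : x ∈ principalSet M) :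
    ∃ N ∈ 𝓝 x, ∀ y ∈ N, ∀ z ∈ N, ν y = ν z → ‖μ y‖ = ‖μ z‖ → ∃ g : Grp, g • y = z := by
  have hcs := continuousSMul_grp M
  have hsx : x ∈ (ch x).source := mem_extChartAt_source x
  have hy₀ := (ch x).map_source hsx
  set y₀ := ch x x with hy₀d
  -- A linear complement to the orbit directions in the chart serves as a slice; invariance of the
  -- slice under stabilisers is not needed.
  obtain ⟨R, hR⟩ := Submodule.exists_isCompl (infCh A x y₀).range
  have hsym : ∀ r : E7, y₀ + r ∈ (ch x).target → MDifferentiableAt 𝓘(ℝ, E7) (𝓡 7)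
      (ch x).symm (y₀ + r) := fun r hr => (contMDiffAt_ch_symm hr).mdifferentiableAt (by simp)
  -- the local slice
  set Φ : Par × R → E7 := fun z => actCh A x (z.1, y₀ + z.2) with hΦ
  have hΦd : HasStrictFDerivAt Φ ((infCh A x y₀).comp (.fst ℝ Par R) +
      R.subtypeL.comp (.snd ℝ Par R)) 0 := by
    have h1 := hasFDerivAt_actCh A (x₀ := x) hy₀
    have h2 : HasStrictFDerivAt (fun z : Par × R => ((z.1, y₀ + (z.2 : E7)) : Par × E7))
        ((ContinuousLinearMap.fst ℝ Par R).prod (R.subtypeL.comp (.snd ℝ Par R))) 0 :=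
      hasStrictFDerivAt_fst.prodMk
        ((R.subtypeL.comp (.snd ℝ Par R)).hasStrictFDerivAt.const_add y₀)
    have h3 : HasStrictFDerivAt (actCh A x) ((infCh A x y₀).comp (.fst ℝ Par E7) + .snd ℝ Par E7)
        ((fun z : Par × R => ((z.1, y₀ + (z.2 : E7)) : Par × E7)) 0) := by
      simpa using h1
    exact h3.comp 0 h2
  -- The differential of Φ is onto, so the orbits through the slice fill a neighbourhood of x.
  have hmap := hΦd.map_nhds_eq_of_surj (by
    refine LinearMap.range_eq_top.mpr fun v => ?_
    have : v ∈ (infCh A x y₀).range ⊔ R := by rw [hR.sup_eq_top]; trivial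
    obtain ⟨_, ⟨p, rfl⟩, r, hr, hv⟩ := Submodule.mem_sup.mp this
    exact ⟨(p, ⟨r, hr⟩), hv⟩)
  have hΦ0 : Φ 0 = y₀ := by
    simp [hΦ, actCh, A.expG_zero, hy₀d]
  -- the invariants on the slice
  set Ψ : R → ℝ × ℝ := fun r => (ν ((ch x).symm (y₀ + r)), ‖μ ((ch x).symm (y₀ + r))‖ ^ 2) with hΨ
  have hΨc : ContDiffAt ℝ ∞ Ψ 0 := by
    have h1 : ContMDiffAt 𝓘(ℝ, R) (𝓡 7) ∞ (fun r : R => (ch x).symm (y₀ + r)) 0 := by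
      have h2 : ContMDiffAt 𝓘(ℝ, E7) (𝓡 7) ∞ (ch x).symm ((fun r : R => y₀ + (r : E7)) 0) := by
        simpa using contMDiffAt_ch_symm hy₀
      exact ContMDiffAt.comp (f := fun r : R => y₀ + (r : E7)) 0 h2 (contDiff_const.add R.subtypeL.contDiff).contMDiff.contMDiffAt
    have h3 := contMDiffAt_iff_contDiffAt.mp (hS.mm.smooth_nu.contMDiffAt.comp 0 h1)
    have h4 := contMDiffAt_iff_contDiffAt.mp (hS.mm.smooth_mu.contMDiffAt.comp 0 h1)
    exact h3.prodMk (h4.norm_sq ℝ)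
  have hΨs := hΨc.hasStrictFDerivAt (by simp)
  have hinj : Function.Injective (fderiv ℝ Ψ 0) := by
    rw [injective_iff_map_eq_zero]
    intro r hr
    have hl : HasDerivAt (fun t : ℝ => t • r) r 0 := by
      simpa using (hasDerivAt_id (0 : ℝ)).smul_const r
    have hF : HasFDerivAt Ψ (fderiv ℝ Ψ 0) ((fun t : ℝ => t • r) 0) := by
      simp only [zero_smul]; exact hΨs.hasFDerivAt
    have h1 := hF.comp_hasDerivAt (0 : ℝ) hl
    rw [hr] at h1
    have hl2 : HasDerivAt (fun t : ℝ => y₀ + t • (r : E7)) (r : E7) 0 := by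
      simpa using ((hasDerivAt_id (0 : ℝ)).smul_const (r : E7)).const_add y₀
    have h2 := hasVelocity_symm (x₀ := x) hl2 (by simpa using hy₀)
    have h3 := hS.mm.hasDerivAt_nu h2
    have h4 := hasDerivAt_rho hS.mm h2
    simp only [zero_smul, add_zero, (ch x).left_inv hsx, hy₀d] at h3 h4
    rw [← dnu_apply] at h3
    have h5 := h3.unique h1.fst
    have h6 := h4.unique h1.snd
    have h7 := mem_orbitTan_of_dnu_of_drho hS hx h5 (by simpa using h6)
    obtain ⟨p, hp⟩ := (mem_orbitTan A).mp h7
    have h8 := congrArg (chD x x) hp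
    have h9 := chD_chI hy₀ (r : E7)
    rw [hy₀d, (ch x).left_inv hsx] at h9
    rw [chD_inf A hsx, h9] at h8
    have h10 : (r : E7) ∈ (infCh A x y₀).range ⊓ R := ⟨⟨p, h8⟩, r.2⟩
    rw [hR.inf_eq_bot] at h10
    exact Subtype.ext h10
  -- A kernel vector of the differential of (ν, |μ|²) on the slice is an orbit direction, hence
  -- zero. So (ν, |μ|²) is injective on a small piece of the slice.
  obtain ⟨K, -, U, hU, hb⟩ := exists_nhds_norm_sub_le hΨs hinj
  set Q : Par × R → M := fun z => A.expG z.1 • (ch x).symm (y₀ + z.2) with hQ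
  have hQc : ContinuousAt Q 0 := by
    have h1 : ContinuousAt (fun z : Par × R => (ch x).symm (y₀ + z.2)) 0 := by
      have h2 : ContinuousAt (ch x).symm ((fun z : Par × R => y₀ + (z.2 : E7)) 0) := by
        simpa using (contMDiffAt_ch_symm hy₀).continuousAt
      exact ContinuousAt.comp h2 (by fun_prop)
    exact (A.contMDiff_expG.continuous.continuousAt.comp continuous_fst.continuousAt).smul h1
  have hQ0 : Q 0 = x := by simp [hQ, A.expG_zero, hy₀d]
  have hW : Q ⁻¹' (ch x).source ∩ Prod.snd ⁻¹' U ∈ 𝓝 (0 : Par × R) :=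
    inter_mem (hQc.preimage_mem_nhds (hQ0.symm ▸ (isOpen_ch_source x).mem_nhds hsx))
      (continuous_snd.continuousAt.preimage_mem_nhds hU)
  have hW2 : Φ '' (Q ⁻¹' (ch x).source ∩ Prod.snd ⁻¹' U) ∈ 𝓝 y₀ := by
    rw [← hΦ0, ← hmap]; exact image_mem_map hW
  refine ⟨(ch x) ⁻¹' (Φ '' (Q ⁻¹' (ch x).source ∩ Prod.snd ⁻¹' U)) ∩ (ch x).source,
    inter_mem ((continuousAt_extChartAt x).preimage_mem_nhds hW2)
      ((isOpen_ch_source x).mem_nhds hsx), ?_⟩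
  rintro y ⟨⟨⟨p, r⟩, ⟨hs1, hr⟩, h1⟩, hys⟩ z ⟨⟨⟨p', r'⟩, ⟨hs2, hr'⟩, h2⟩, hzs⟩ hν hμ
  have hy : Q (p, r) = y := (ch x).injOn hs1 hys h1
  have hz : Q (p', r') = z := (ch x).injOn hs2 hzs h2
  have hΨeq : Ψ r = Ψ r' := by
    rw [← hy, ← hz] at hν hμ
    simp only [hQ, nu_smul hS.inv hS.mm, norm_mu_smul hS.inv hS.mm] at hν hμ
    exact Prod.ext hν (congrArg (· ^ 2) hμ)
  have hrr : r = r' := by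
    have h5 := hb r hr r' hr'
    rw [hΨeq, sub_self, norm_zero, mul_zero] at h5
    exact sub_eq_zero.mp (norm_le_zero_iff.mp h5)
  refine ⟨A.expG p' * (A.expG p)⁻¹, ?_⟩
  rw [← hy, ← hz, mul_smul, hrr]
  simp only [hQ, inv_smul_smul]

end Local

/-! ### Orbit spaces -/

section Quot

variable {M : Type*} [MulAction Grp M]

theorem toTorusQuotient_eq {x y : M} :
    (toTorusQuotient x : TorusQuotient M) = toTorusQuotient y ↔
      ∃ a : Torus, ((a, 1) : Grp) • y = x := by
  constructor
  · intro h
    obtain ⟨⟨⟨a, b⟩, hb⟩, hab⟩ := Quotient.exact' h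
    obtain rfl : b = 1 := by simpa [Subgroup.mem_prod] using hb
    exact ⟨a, hab⟩
  · rintro ⟨a, ha⟩
    exact Quotient.sound' ⟨⟨(a, 1), by simp [Subgroup.mem_prod]⟩, ha⟩

theorem toFullQuotient_eq {x y : M} :
    (toFullQuotient x : FullQuotient M) = toFullQuotient y ↔ ∃ g : Grp, g • y = x := by
  constructor
  · intro h
    exact Quotient.exact' h
  · rintro ⟨g, hg⟩
    exact Quotient.sound' ⟨g, hg⟩

theorem toTorusQuotient_smul (a : Torus) (x : M) :
    toTorusQuotient (((a, 1) : Grp) • x) = toTorusQuotient x := toTorusQuotient_eq.mpr ⟨a, rfl⟩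

theorem toTorusQuotient_expG (A : AdaptedBasis) (τ : ℝ × ℝ) (x : M) :
    toTorusQuotient (A.expG (τ, 0) • x) = toTorusQuotient x :=
  toTorusQuotient_eq.mpr ⟨(A.expG (τ, 0)).1, by
    congr 1; exact Prod.ext rfl (A.expG_torus_snd τ).symm⟩

theorem toFullQuotient_smul (g : Grp) (x : M) :
    toFullQuotient (g • x) = toFullQuotient x := toFullQuotient_eq.mpr ⟨g, rfl⟩

theorem quotientProj_mk (x : M) : quotientProj (toTorusQuotient x) = toFullQuotient x := rfl

theorem toTorusQuotient_surjective : Function.Surjective (toTorusQuotient : M → _) :=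
  Quotient.mk''_surjective

theorem toTorusQuotient_mem {x : M} :
    toTorusQuotient x ∈ principalTorusQuotient M ↔ x ∈ principalSet M := by
  refine ⟨?_, fun h => ⟨x, h, rfl⟩⟩
  rintro ⟨y, hy, h⟩
  obtain ⟨a, rfl⟩ := toTorusQuotient_eq.mp h
  exact (smul_mem_principalSet_iff _).mp hy

theorem toFullQuotient_mem {x : M} : toFullQuotient x ∈ baseB M ↔ x ∈ principalSet M := by
  refine ⟨?_, fun h => ⟨x, h, rfl⟩⟩
  rintro ⟨y, hy, h⟩
  obtain ⟨a, rfl⟩ := toFullQuotient_eq.mp h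
  exact (smul_mem_principalSet_iff _).mp hy

end Quot

/-! ### Lifts -/

section Lift

variable {M : Type*} [TopologicalSpace M] [ChartedSpace E7 M] {Q : Type*} {p : M → Q} {γ : ℝ → Q}
  {t : ℝ} {c : ℝ → M}

/-- The velocity, in the model space. -/
def vel (c : ℝ → M) (t : ℝ) : E7 := velocity c t

theorem IsLocalLift.hasVelocity (h : IsLocalLift p γ t c) : HasVelocity c t (vel c t) :=
  hasVelocity_velocity (h.self_of_nhds.1.mdifferentiableAt (by simp))

theorem IsLocalLift.eventually (h : IsLocalLift p γ t c) : ∀ᶠ s in 𝓝 t, IsLocalLift p γ s c :=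
  eventually_eventually_nhds.mpr h

theorem HasVelocity.vel_eq {v : E7} (h : HasVelocity c t v) : vel c t = v := h.velocity_eq

end Lift

/-! ### Curves in M/𝕋² with velocity proportional to the field. -/

section Speed

variable {M : Type*} [TopologicalSpace M] [ChartedSpace E7 M] [MulAction Grp M]
  [IsManifold (𝓡 7) ∞ M] [T2Space M]
  [ContMDiffSMul modelGrp (𝓡 7) ∞ Grp M] {A : AdaptedBasis} {φ : G2Structure M}
  {ν : M → ℝ} {μ : M → EuclideanSpace ℝ (Fin 3)} {γ : ℝ → TorusQuotient M} {J : Set ℝ} {t k : ℝ}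

/-- The velocity of the curve `γ` in the torus quotient is `k` times the field `U₁ × U₂`. -/
def HasSpeed (φ : G2Structure M) (A : AdaptedBasis) (γ : ℝ → TorusQuotient M) (t k : ℝ) : Prop :=
  ∃ c : ℝ → M, IsLocalLift toTorusQuotient γ t c ∧ vel c t - k • zf φ A (c t) ∈ torusTan A (c t)

theorem isIntegralCurveT_iff : IsIntegralCurveT φ A γ J ↔
    ∀ t ∈ J, γ t ∈ principalTorusQuotient M ∧ HasSpeed φ A γ t 1 := by
  refine forall₂_congr fun t _ => and_congr_right fun _ => exists_congr fun c =>
    and_congr_right fun _ => ?_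
  rw [one_smul]
  exact Submodule.Quotient.eq (torusTangent A (c t))

variable (hS : MomentSetting A φ ν μ)
include hS

/-- Any other lift can be translated by a torus element to agree with the given one at time t; their
velocities then agree modulo the torus by `sub_mem_torusTan`. -/
theorem HasSpeed.of_lift (h : HasSpeed φ A γ t k) (ht : γ t ∈ principalTorusQuotient M) {c : ℝ → M}
    (hc : IsLocalLift toTorusQuotient γ t c) :
    vel c t - k • zf φ A (c t) ∈ torusTan A (c t) := by
  obtain ⟨d, hd, hv⟩ := h
  obtain ⟨a, ha⟩ := toTorusQuotient_eq.mp
    (hc.self_of_nhds.2.trans hd.self_of_nhds.2.symm)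
  have h1 := hd.hasVelocity.smul ((a, 1) : Grp)
  have hx : c t ∈ principalSet M := by
    rw [← toTorusQuotient_mem, hc.self_of_nhds.2]; exact ht
  have h2 := sub_mem_torusTan hS hx hc.hasVelocity h1 rfl ha (by
    filter_upwards [hc, hd] with s h3 h4
    refine toTorusQuotient_eq.mp ?_
    rw [toTorusQuotient_smul, h3.2, h4.2])
  have h3 := dact_mem_torusTan (g := ((a, 1) : Grp)) A hv
  rw [map_sub, map_smul, dact_zf A hS.inv, ha] at h3
  have := add_mem h2 h3
  rwa [sub_add_sub_cancel] at this

theorem HasSpeed.unique {k' : ℝ} (h : HasSpeed φ A γ t k) (ht : γ t ∈ principalTorusQuotient M)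
    (h' : HasSpeed φ A γ t k') : k = k' := by
  obtain ⟨c, hc, hv⟩ := id h
  have h1 := sub_mem (h'.of_lift hS ht hc) hv
  rw [sub_sub_sub_cancel_left, ← sub_smul] at h1
  have hx : c t ∈ principalSet M := by
    rw [← toTorusQuotient_mem, hc.self_of_nhds.2]; exact ht
  by_contra hne
  have h2 := Submodule.smul_mem _ (k - k')⁻¹ h1
  rw [smul_smul, inv_mul_cancel₀ (sub_ne_zero.mpr hne), one_smul] at h2
  exact zf_notMem_orbitTan hS hx (torusTan_le_orbitTan A _ h2)

theorem dnu_of_sub_mem {v : E7} {y : M} (h : v - k • zf φ A y ∈ orbitTan A y) :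
    dnu φ A y v = k * nz φ A y := by
  have h1 := dnu_orbit hS.inv hS.mm y h
  rw [map_sub, map_smul, sub_eq_zero] at h1
  exact h1

/-- The function `nz` is the derivative of ν along Z. In a chart both ν and Z are smooth, and the
frames that enter its definition do not matter. -/
theorem contDiffAt_nz_comp {c : ℝ → M} (hc : ContMDiffAt 𝓘(ℝ, ℝ) (𝓡 7) ∞ c t) :
    ContDiffAt ℝ ∞ (fun s => nz φ A (c s)) t := by
  have hsx := mem_extChartAt_source (I := 𝓡 7) (c t)
  have hy := (ch (c t)).map_source hsx
  have hν : ∀ y ∈ (ch (c t)).target, ContDiffAt ℝ ∞ (fun y => ν ((ch (c t)).symm y)) y :=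
    fun y hy => contMDiffAt_iff_contDiffAt.mp
      (hS.mm.smooth_nu.contMDiffAt.comp y (contMDiffAt_ch_symm hy))
  have h1 : ContDiffAt ℝ ∞ (fun y => fderiv ℝ (fun y => ν ((ch (c t)).symm y)) y
      (zCh φ A (c t) y)) (ch (c t) (c t)) :=
    ((hν _ hy).fderiv_right (by simp)).clm_apply (contDiffAt_zCh A φ hy)
  have h2 := ContDiffAt.comp t h1 (contDiffAt_chart_curve hsx hc)
  refine h2.congr_of_eventuallyEq ?_
  filter_upwards [hc.continuousAt.preimage_mem_nhds ((isOpen_ch_source (c t)).mem_nhds hsx)]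
    with s hs
  obtain ⟨ε, hε, e, he, hz⟩ := exists_isZ φ A (c s) 0
  have h3 := hz 0 ⟨by linarith, by linarith⟩
  have h4 := hS.mm.hasDerivAt_nu h3
  have h5 := h3.chart (x₀ := c t) (by rwa [he])
  rw [he] at h4 h5
  rw [chD_zf A φ hs] at h5
  have h6 : HasFDerivAt (fun y => ν ((ch (c t)).symm y))
      (fderiv ℝ (fun y => ν ((ch (c t)).symm y)) (ch (c t) (c s))) (ch (c t) (e 0)) := by
    rw [he]; exact ((hν _ ((ch (c t)).map_source hs)).differentiableAt (by simp)).hasFDerivAt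
  have h7 := h6.comp_hasDerivAt (0 : ℝ) h5
  have h8 := h4.unique (h7.congr_of_eventuallyEq (by
    filter_upwards [h3.continuousAt.preimage_mem_nhds
      ((isOpen_ch_source (c t)).mem_nhds (by rwa [he]))] with r hr
    exact congrArg ν ((ch (c t)).left_inv hr).symm))
  rw [nz, dnu_apply, h8]; rfl

/-- The speed depends smoothly on the time. -/
theorem contDiffAt_of_hasSpeed {h : ℝ → ℝ}
    (hh : ∀ᶠ s in 𝓝 t, γ s ∈ principalTorusQuotient M ∧ HasSpeed φ A γ s (h s)) :
    ContDiffAt ℝ ∞ h t := by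
  obtain ⟨c, hc, -⟩ := hh.self_of_nhds.2
  have hcs := hc.self_of_nhds.1
  have h1 : ContDiffAt ℝ ∞ (fun s => ν (c s)) t :=
    contMDiffAt_iff_contDiffAt.mp (hS.mm.smooth_nu.contMDiffAt.comp t hcs)
  have h2 : ContDiffAt ℝ ∞ (deriv fun s => ν (c s)) t := by
    have : ContDiffAt ℝ ∞ (fun s => fderiv ℝ (fun s => ν (c s)) s 1) t :=
      (h1.fderiv_right (by simp)).clm_apply contDiffAt_const
    exact this
  have hx : c t ∈ principalSet M := by
    rw [← toTorusQuotient_mem, hc.self_of_nhds.2]; exact hh.self_of_nhds.1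
  -- As dν vanishes on torus directions, (ν ∘ c)' is the speed times |Z|². This determines the speed
  -- as a smooth quotient, for one lift c valid near t.
  have h3 : ContDiffAt ℝ ∞ (fun s => deriv (fun s => ν (c s)) s / nz φ A (c s)) t :=
    h2.div (contDiffAt_nz_comp hS hcs) (nz_pos hS.coh hx).ne'
  refine h3.congr_of_eventuallyEq ?_
  filter_upwards [hh, hc.eventually] with s hs hcs
  have h4 := hs.2.of_lift hS hs.1 hcs
  have h5 := hS.mm.hasDerivAt_nu hcs.hasVelocity
  rw [← dnu_apply, dnu_of_sub_mem hS (torusTan_le_orbitTan A _ h4)] at h5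
  have hxs : c s ∈ principalSet M := by
    rw [← toTorusQuotient_mem, hcs.self_of_nhds.2]; exact hs.1
  rw [h5.deriv, mul_div_cancel_right₀ _ (nz_pos hS.coh hxs).ne']

end Speed

/-! ### Primitives and monotone reparametrisations -/

theorem exists_primitive {E : Type*} [NormedAddCommGroup E] [NormedSpace ℝ E] [CompleteSpace E]
    {τ : ℝ → E} {J : Set ℝ} (hJ : IsOpen J) (hJ' : J.OrdConnected) {t : ℝ} (ht : t ∈ J)
    (hτ : ContinuousOn τ J) : ∃ P : ℝ → E, ∀ s ∈ J, HasDerivAt P (τ s) s := by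
  refine ⟨fun s => ∫ r in t..s, τ r, fun s hs => ?_⟩
  exact intervalIntegral.integral_hasDerivAt_right
    ((hτ.mono (hJ'.uIcc_subset ht hs)).intervalIntegrable)
    (hτ.stronglyMeasurableAtFilter hJ s hs) (hτ.continuousAt (hJ.mem_nhds hs))

/-- Continuity of θ is enough: it keeps θ on the branch on which F has a local inverse, so that θ is
this inverse composed with f. -/
theorem hasDerivAt_of_comp_eq {F f θ : ℝ → ℝ} {s k l : ℝ} (hθ : ContinuousAt θ s)
    (hF : HasStrictDerivAt F k (θ s)) (hk : k ≠ 0) (hf : HasDerivAt f l s)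
    (h : ∀ᶠ r in 𝓝 s, F (θ r) = f r) : HasDerivAt θ (k⁻¹ * l) s := by
  have h1 := hF.to_localInverse hk
  have h2 := hF.eventually_left_inverse hk
  rw [h.self_of_nhds] at h1
  refine (h1.hasDerivAt.comp s hf).congr_of_eventuallyEq ?_
  filter_upwards [hθ.eventually h2, h] with r hr hr'
  rw [Function.comp, ← hr']
  exact hr.symm

section Curve

variable {M : Type*} [TopologicalSpace M] [ChartedSpace E7 M] [MulAction Grp M]
  [IsManifold (𝓡 7) ∞ M] [T2Space M]
  [ContMDiffSMul modelGrp (𝓡 7) ∞ Grp M] {A : AdaptedBasis} {φ : G2Structure M}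
  {ν : M → ℝ} {μ : M → EuclideanSpace ℝ (Fin 3)}

/-! ### Maximal integral curves subject to a relation -/

theorem IsOpenInterval.inter {I J : Set ℝ} (hI : IsOpenInterval I) (hJ : IsOpenInterval J) {t : ℝ}
    (htI : t ∈ I) (htJ : t ∈ J) : IsOpenInterval (I ∩ J) :=
  ⟨hI.1.inter hJ.1, hI.2.1.inter hJ.2.1, t, htI, htJ⟩

theorem isOpenInterval_Ioo {t ε : ℝ} (hε : 0 < ε) : IsOpenInterval (Ioo (t - ε) (t + ε)) :=
  ⟨isOpen_Ioo, ordConnected_Ioo, t, by linarith, by linarith⟩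

theorem IsZ.eqOn' {c d : ℝ → M} {I : Set ℝ} (hc : IsZ φ A c I) (hd : IsZ φ A d I)
    (hI : IsOpenInterval I) {t₀ : ℝ} (ht₀ : t₀ ∈ I) (h : c t₀ = d t₀) : EqOn c d I :=
  hc.eqOn hd hI.1 hI.2.1 ht₀ h

/-- All integral curves through x at time t₀ that satisfy R agree on common times, so they glue on
the union of their intervals. The last clause is the form of maximality needed later: an admissible
curve that meets the maximal one at the same time is absorbed by it. R stands for a condition such
as projecting to a prescribed curve or lying in a submanifold. -/
theorem exists_maximal_isZ (R : ℝ → M → Prop) {t₀ : ℝ} {x : M}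
    (h : ∃ I e, IsOpenInterval I ∧ t₀ ∈ I ∧ e t₀ = x ∧ IsZ φ A e I ∧ ∀ s ∈ I, R s (e s)) :
    ∃ J c, IsOpenInterval J ∧ t₀ ∈ J ∧ c t₀ = x ∧ IsZ φ A c J ∧ (∀ s ∈ J, R s (c s)) ∧
      ∀ e I, IsOpenInterval I → IsZ φ A e I → (∀ s ∈ I, R s (e s)) →
        ∀ s ∈ I ∩ J, e s = c s → I ⊆ J ∧ EqOn e c I := by
  classical
  set good : Set ℝ → (ℝ → M) → Prop := fun I e =>
    IsOpenInterval I ∧ t₀ ∈ I ∧ e t₀ = x ∧ IsZ φ A e I ∧ ∀ s ∈ I, R s (e s) with hgood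
  have hagree : ∀ I e I' e', good I e → good I' e' → ∀ s ∈ I ∩ I', e s = e' s := by
    intro I e I' e' h1 h2
    exact IsZ.eqOn' (h1.2.2.2.1.mono inter_subset_left) (h2.2.2.2.1.mono inter_subset_right)
      (h1.1.inter h2.1 h1.2.1 h2.2.1) ⟨h1.2.1, h2.2.1⟩ (h1.2.2.1.trans h2.2.2.1.symm)
  set J : Set ℝ := ⋃₀ {I | ∃ e, good I e} with hJ
  have hsub : ∀ I e, good I e → I ⊆ J := fun I e h1 => subset_sUnion_of_mem ⟨e, h1⟩
  obtain ⟨I₀, e₀, h₀⟩ := h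
  have h₀' : good I₀ e₀ := h₀
  have ht₀J : t₀ ∈ J := hsub _ _ h₀' h₀.2.1
  have hJo : IsOpenInterval J := by
    refine ⟨isOpen_sUnion fun I hI => ?_, ?_, t₀, ht₀J⟩
    · obtain ⟨e, he⟩ := hI
      exact he.1.1
    · refine (isPreconnected_sUnion t₀ _ (fun I hI => ?_) fun I hI => ?_).ordConnected
      · obtain ⟨e, he⟩ := hI
        exact he.2.1
      · obtain ⟨e, he⟩ := hI
        exact he.1.2.1.isPreconnected
  have hex : ∀ s, ∃ y : M, ∀ I e, good I e → s ∈ I → e s = y := by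
    intro s
    by_cases hs : s ∈ J
    · obtain ⟨I, ⟨e, he⟩, hsI⟩ := hs
      exact ⟨e s, fun I' e' h' hs' => hagree I' e' I e h' he s ⟨hs', hsI⟩⟩
    · exact ⟨x, fun I' e' h' hs' => absurd (hsub _ _ h' hs') hs⟩
  choose c hc using hex
  have hcon : ∀ I e, good I e → EqOn c e I := fun I e h1 s hs => (hc s I e h1 hs).symm
  have hcZ : IsZ φ A c J := by
    rintro s ⟨I, ⟨e, he⟩, hs⟩
    exact (he.2.2.2.1.congr he.1.1 (hcon I e he)) s hs
  have hcR : ∀ s ∈ J, R s (c s) := by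
    rintro s ⟨I, ⟨e, he⟩, hs⟩
    rw [hcon I e he hs]
    exact he.2.2.2.2 s hs
  have hcx : c t₀ = x := (hcon I₀ e₀ h₀' h₀.2.1).trans h₀.2.2.1
  refine ⟨J, c, hJo, ht₀J, hcx, hcZ, hcR, fun e I hI heZ heR s hs hes => ?_⟩
  have hIJ : EqOn e c (I ∩ J) := IsZ.eqOn' (heZ.mono inter_subset_left)
    (hcZ.mono inter_subset_right) (hI.inter hJo hs.1 hs.2) hs hes
  -- The two curves agree on the overlap, so their gluing is a competitor in the definition of J.
  set f : ℝ → M := J.piecewise c e with hf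
  have hfJ : EqOn f c J := fun r hr => piecewise_eq_of_mem _ _ _ hr
  have hfI : EqOn f e I := fun r hr => by
    by_cases hrJ : r ∈ J
    · rw [hfJ hrJ, hIJ ⟨hr, hrJ⟩]
    · exact piecewise_eq_of_notMem _ _ _ hrJ
  have hg : good (I ∪ J) f := by
    refine ⟨⟨hI.1.union hJo.1, ?_, t₀, Or.inr ht₀J⟩, Or.inr ht₀J, (hfJ ht₀J).trans hcx, ?_, ?_⟩
    · exact (IsPreconnected.union s hs.1 hs.2 hI.2.1.isPreconnected
        hJo.2.1.isPreconnected).ordConnected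
    · rintro r (hr | hr)
      · exact heZ.congr hI.1 hfI r hr
      · exact hcZ.congr hJo.1 hfJ r hr
    · rintro r (hr | hr)
      · rw [hfI hr]; exact heR r hr
      · rw [hfJ hr]; exact hcR r hr
  have hIsub : I ⊆ J := subset_union_left.trans (hsub _ _ hg)
  exact ⟨hIsub, fun r hr => hIJ ⟨hr, hIsub hr⟩⟩

/-- The points admissible at a given time are related by group elements that preserve R. As Z is
invariant, a local solution can be translated to pass through any admissible point, so its time of
existence depends only on the time and not on the point. The maximal solution therefore cannot end
inside J. -/
theorem exists_isZ_of_local (hinv : φ.IsInvariant) {R : ℝ → M → Prop} {J : Set ℝ}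
    (hJ : IsOpenInterval J)
    (hRJ : ∀ s y, R s y → s ∈ J)
    (hloc : ∀ t ∈ J, ∃ ε > 0, ∃ e, IsZ φ A e (Ioo (t - ε) (t + ε)) ∧
      ∀ s ∈ Ioo (t - ε) (t + ε), R s (e s))
    (htr : ∀ s y y', R s y → R s y' → ∃ g : Grp, g • y = y' ∧ ∀ s' z, R s' z → R s' (g • z))
    {t₀ : ℝ} {x : M} (hx : R t₀ x) :
    ∃ c, c t₀ = x ∧ IsZ φ A c J ∧ ∀ s ∈ J, R s (c s) := by
  have hloc' : ∀ t ∈ J, ∃ ε > 0, ∀ s ∈ Ioo (t - ε) (t + ε), ∀ y, R s y →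
      ∃ e, e s = y ∧ IsZ φ A e (Ioo (t - ε) (t + ε)) ∧
        ∀ s ∈ Ioo (t - ε) (t + ε), R s (e s) := by
    intro t ht
    obtain ⟨ε, hε, e, he, hR⟩ := hloc t ht
    refine ⟨ε, hε, fun s hs y hy => ?_⟩
    obtain ⟨g, hg, hg'⟩ := htr s (e s) y (hR s hs) hy
    exact ⟨fun r => g • e r, hg, he.smul hinv g, fun r hr => hg' _ _ (hR r hr)⟩
  have hst : ∃ I e, IsOpenInterval I ∧ t₀ ∈ I ∧ e t₀ = x ∧ IsZ φ A e I ∧ ∀ s ∈ I, R s (e s) := by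
    obtain ⟨ε, hε, h⟩ := hloc' t₀ (hRJ _ _ hx)
    obtain ⟨e, h1, h2, h3⟩ := h t₀ ⟨by linarith, by linarith⟩ x hx
    exact ⟨_, e, isOpenInterval_Ioo hε, ⟨by linarith, by linarith⟩, h1, h2, h3⟩
  obtain ⟨I, c, hI, ht₀, hcx, hcZ, hcR, hmax⟩ := exists_maximal_isZ R hst
  -- Near a time of J in the closure of I, a translated local solution through a point of c extends
  -- c; so I is relatively closed in the connected J.
  have hsub : J ⊆ I := by
    refine hJ.2.1.isPreconnected.subset_of_closure_inter_subset hI.1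
      ⟨t₀, hRJ _ _ hx, ht₀⟩ fun t ht => ?_
    obtain ⟨ε, hε, h⟩ := hloc' t ht.2
    obtain ⟨s, hs, hsI⟩ := mem_closure_iff.mp ht.1 (Ioo (t - ε) (t + ε)) isOpen_Ioo
      ⟨by linarith, by linarith⟩
    obtain ⟨e, h1, h2, h3⟩ := h s hs (c s) (hcR s hsI)
    exact (hmax e _ (isOpenInterval_Ioo hε) h2 h3 s ⟨hs, hsI⟩ h1).1 ⟨by linarith, by linarith⟩
  exact ⟨c, hcx, hcZ.mono hsub, fun s hs => hcR s (hsub hs)⟩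

/-! ### Adjusting lifts by the torus -/

variable (hS : MomentSetting A φ ν μ)
include hS

/-- If the velocity of c is Z plus the torus vector of τ, then multiplying c by exp P with P' = −τ
cancels the torus part. The torus is abelian, so P is a plain integral of −τ. -/
theorem exists_torus_adjust {c : ℝ → M} {t : ℝ} (hx : c t ∈ principalSet M)
    (hc : ∀ᶠ s in 𝓝 t, ContMDiffAt 𝓘(ℝ, ℝ) (𝓡 7) ∞ c s ∧
      vel c s - zf φ A (c s) ∈ torusTan A (c s)) :
    ∃ P : ℝ → ℝ × ℝ, ∃ ε > 0, IsZ φ A (fun s => A.expG (P s, 0) • c s) (Ioo (t - ε) (t + ε)) := by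
  set x := c t with hxd
  have hsx : x ∈ (ch x).source := mem_extChartAt_source x
  have hy := (ch x).map_source hsx
  have hcs := hc.self_of_nhds.1
  set D : E7 → ℝ × ℝ →L[ℝ] E7 := fun y => (infCh A x y).comp (.inl ℝ (ℝ × ℝ) (Fin 3 → ℝ)) with hDd
  have hDinf : ∀ z ∈ (ch x).source, ∀ a, D (ch x z) a = chD x z (infT A z a) :=
    fun z hz a => (chD_inf A hz (a, 0)).symm
  have hD : Function.Injective (D (ch x x)) := fun a b hab => by
    rw [hDinf x hsx, hDinf x hsx] at hab
    exact congrArg Prod.fst (inf_injective hS.coh hx ((chEquiv hsx).injective hab))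
  -- A fixed left inverse of the infinitesimal torus action at x remains a left inverse up to an
  -- invertible 2 × 2 matrix B at nearby points. This yields τ as a smooth function of time.
  obtain ⟨l, hl⟩ := (D (ch x x) : ℝ × ℝ →ₗ[ℝ] E7).exists_leftInverse_of_injective
    (LinearMap.ker_eq_bot.mpr hD)
  set L : E7 →L[ℝ] ℝ × ℝ := LinearMap.toContinuousLinearMap l with hLd
  set B : ℝ → ℝ × ℝ →L[ℝ] ℝ × ℝ := fun s => L.comp (D (ch x (c s))) with hBd
  have hBt : B t = ContinuousLinearEquiv.refl ℝ (ℝ × ℝ) :=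
    ContinuousLinearMap.ext fun a => LinearMap.congr_fun hl a
  have hchart : ContDiffAt ℝ ∞ (fun s => ch x (c s)) t := contDiffAt_chart_curve hsx hcs
  have hDc : ContDiffAt ℝ ∞ D (ch x (c t)) := (contDiffAt_infCh A hy).clm_comp contDiffAt_const
  have hBc : ContDiffAt ℝ ∞ B t := contDiffAt_const.clm_comp
    (ContDiffAt.comp (g := D) (f := fun s => ch x (c s)) t hDc hchart)
  set τ : ℝ → ℝ × ℝ := fun s => (B s).inverse
    (L (fderiv ℝ (fun s => ch x (c s)) s 1 - zCh φ A x (ch x (c s)))) with hτd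
  have hinvc : ContDiffAt ℝ ∞ (fun s => (B s).inverse) t := by
    have h1 : ContDiffAt ℝ ∞ (ContinuousLinearMap.inverse : (ℝ × ℝ →L[ℝ] ℝ × ℝ) → _) (B t) := by
      rw [hBt]; exact contDiffAt_map_inverse _
    exact h1.comp t hBc
  have hτc : ContDiffAt ℝ ∞ τ t := by
    refine hinvc.clm_apply (contDiffAt_const.clm_apply (ContDiffAt.sub
      ((hchart.fderiv_right (by simp)).clm_apply contDiffAt_const) ?_))
    exact ContDiffAt.comp (g := zCh φ A x) t (contDiffAt_zCh A φ hy) hchart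
  have hτc' : ∀ᶠ s in 𝓝 t, ContinuousAt τ s := by
    have h1 : ContDiffAt ℝ 0 τ t := hτc.of_le bot_le
    exact (h1.eventually (by simp)).mono fun s h => h.continuousAt
  have hBinv : ∀ᶠ s in 𝓝 t, ∃ e : (ℝ × ℝ) ≃L[ℝ] (ℝ × ℝ), (e : ℝ × ℝ →L[ℝ] ℝ × ℝ) = B s :=
    hBc.continuousAt.eventually (by rw [hBt]; exact ContinuousLinearEquiv.nhds _)
  have hsrc : ∀ᶠ s in 𝓝 t, c s ∈ (ch x).source :=
    hcs.continuousAt.eventually ((isOpen_ch_source x).mem_nhds hsx)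
  obtain ⟨ε, hε, hb⟩ := Metric.eventually_nhds_iff_ball.mp
    ((hc.and hτc').and (hBinv.and hsrc))
  rw [Real.ball_eq_Ioo] at hb
  obtain ⟨P, hP⟩ := exists_primitive (τ := fun s => -τ s) (isOpen_Ioo (a := t - ε) (b := t + ε))
    ordConnected_Ioo (t := t) ⟨by linarith, by linarith⟩
    (fun s hs => (hb s hs).1.2.neg.continuousWithinAt)
  refine ⟨P, ε, hε, fun s hs => ?_⟩
  obtain ⟨⟨⟨hsm, hv⟩, -⟩, ⟨e, he⟩, hss⟩ := hb s hs
  obtain ⟨a, ha⟩ := (mem_torusTan A).mp hv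
  have hvel : HasVelocity c s (vel c s) := hasVelocity_velocity (hsm.mdifferentiableAt (by simp))
  have hτa : τ s = a := by
    have h1 := (hvel.chart hss).hasFDerivAt.fderiv
    have h2 : fderiv ℝ (fun s => ch x (c s)) s 1 - zCh φ A x (ch x (c s)) =
        D (ch x (c s)) a := by
      rw [h1, hDinf _ hss, ha, map_sub, chD_zf A φ hss]
      simp
    have h3 : τ s = (B s).inverse (B s a) := by
      rw [hτd]
      simp only [h2]
      rfl
    rw [h3, ← he, ContinuousLinearMap.inverse_equiv]
    simp
  have h1 := hvel.act A (p := fun r => (P r - P s, 0)) (q := (-τ s, 0))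
    (((hP s hs).sub_const (P s)).prodMk (hasDerivAt_const s 0)) (by simp)
  have h2 := h1.smul (A.expG (P s, 0))
  have hfun : (fun r => A.expG (P s, 0) • A.expG ((fun r => (P r - P s, 0)) r : Par) • c r) =
      fun r => A.expG (P r, 0) • c r := by
    ext1 r
    simp only
    rw [smul_smul, ← A.expG_torus_add, add_sub_cancel]
  rw [hfun] at h2
  refine h2.congr_vel ?_
  have h3 : inf A (c s) (-τ s, 0) + vel c s = zf φ A (c s) := by
    have h4 : inf A (c s) (-τ s, 0) = -infT A (c s) a := by
      have h5 : ((-τ s, 0) : Par) = -(a, 0) := Prod.ext (congrArg Neg.neg hτa) neg_zero.symm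
      rw [h5, map_neg]; rfl
    rw [h4, ha]; abel
  simp only [sub_self]
  rw [show ((0, 0) : Par) = 0 from rfl, A.expG_zero, one_smul, h3, dact_zf A hS.inv]

variable {J : Set ℝ}

/-- Integral curves in the torus quotient lift to integral curves. -/
theorem IsIntegralCurveT.exists_lift {γ : ℝ → TorusQuotient M} (hγ : IsIntegralCurveT φ A γ J)
    (hJ : IsOpenInterval J) {t₀ : ℝ} (ht₀ : t₀ ∈ J) {x : M} (hx : toTorusQuotient x = γ t₀) :
    ∃ c, c t₀ = x ∧ IsZ φ A c J ∧ ∀ s ∈ J, toTorusQuotient (c s) = γ s := by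
  rw [isIntegralCurveT_iff] at hγ
  have hloc : ∀ t ∈ J, ∃ ε > 0, ∃ e, IsZ φ A e (Ioo (t - ε) (t + ε)) ∧
      ∀ s ∈ Ioo (t - ε) (t + ε), s ∈ J ∧ toTorusQuotient (e s) = γ s := by
    intro t ht
    obtain ⟨hp, c, hc, -⟩ := hγ t ht
    have hcx : c t ∈ principalSet M := by rw [← toTorusQuotient_mem, hc.self_of_nhds.2]; exact hp
    obtain ⟨P, ε, hε, hZ⟩ := exists_torus_adjust hS hcx (c := c) (by
      filter_upwards [hc.eventually, hJ.1.mem_nhds ht] with s hs hsJ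
      refine ⟨hs.self_of_nhds.1, ?_⟩
      have := (hγ s hsJ).2.of_lift hS (hγ s hsJ).1 hs
      rwa [one_smul] at this)
    obtain ⟨ε', hε', hb⟩ := Metric.eventually_nhds_iff_ball.mp
      ((hJ.1.eventually_mem ht).and hc)
    rw [Real.ball_eq_Ioo] at hb
    refine ⟨min ε ε', lt_min hε hε', _, hZ.mono (Ioo_subset_Ioo ?_ ?_), fun s hs => ?_⟩
    · linarith [min_le_left ε ε']
    · linarith [min_le_left ε ε']
    · have hs' := hb s (Ioo_subset_Ioo (by linarith [min_le_right ε ε'])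
        (by linarith [min_le_right ε ε']) hs)
      exact ⟨hs'.1, (toTorusQuotient_expG A _ _).trans hs'.2.2⟩
  obtain ⟨c, h1, h2, h3⟩ := exists_isZ_of_local (φ := φ) (A := A) hS.inv
    (R := fun s y => s ∈ J ∧ toTorusQuotient y = γ s) hJ (fun s y h => h.1) hloc
    (fun s y y' h h' => by
      obtain ⟨a, ha⟩ := toTorusQuotient_eq.mp (h'.2.trans h.2.symm)
      exact ⟨_, ha, fun s' z hz => ⟨hz.1, (toTorusQuotient_smul a z).trans hz.2⟩⟩) ⟨ht₀, hx⟩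
  exact ⟨c, h1, h2, fun s hs => (h3 s hs).2⟩

end Curve

section Reparam

variable {M : Type*} [TopologicalSpace M] [ChartedSpace E7 M] [MulAction Grp M]
  [IsManifold (𝓡 7) ∞ M] [T2Space M]
  [ContMDiffSMul modelGrp (𝓡 7) ∞ Grp M] {A : AdaptedBasis} {φ : G2Structure M}
  {ν : M → ℝ} {μ : M → EuclideanSpace ℝ (Fin 3)} {γ : ℝ → TorusQuotient M} {J : Set ℝ} {t k : ℝ}

/-! ### Reparametrisation by speed -/

theorem contDiffAt_of_right_inverse {f g : ℝ → ℝ} {s : ℝ} (hg : ContinuousAt g s)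
    (hr : ∀ᶠ r in 𝓝 s, f (g r) = r) (hf : ContDiffAt ℝ ∞ f (g s)) (hd : deriv f (g s) ≠ 0) :
    ContDiffAt ℝ ∞ g s := by
  have h1 : HasFDerivAt f ((ContinuousLinearEquiv.unitsEquivAut ℝ (Units.mk0 _ hd) : ℝ ≃L[ℝ] ℝ) :
      ℝ →L[ℝ] ℝ) (g s) := by
    have h2 := (hf.differentiableAt (by simp)).hasDerivAt.hasFDerivAt
    have h3 : ((ContinuousLinearEquiv.unitsEquivAut ℝ (Units.mk0 _ hd) : ℝ ≃L[ℝ] ℝ) :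
      ℝ →L[ℝ] ℝ) = ContinuousLinearMap.toSpanSingleton ℝ (deriv f (g s)) := by
      ext
      simp
    rw [h3]
    exact h2
  have hn : (∞ : WithTop ℕ∞) ≠ 0 := by simp
  have hs := hf.hasStrictFDerivAt' h1 hn
  have hgc := hf.to_localInverse h1 hn
  rw [hr.self_of_nhds] at hgc
  refine hgc.congr_of_eventuallyEq ?_
  filter_upwards [hg.eventually hs.eventually_left_inverse, hr] with r h2 h3
  rw [h3] at h2
  exact h2.symm

/-- The local inverse of a function with nonvanishing derivative. -/
theorem exists_local_inverse {f : ℝ → ℝ} {a : ℝ} (hf : ∀ᶠ y in 𝓝 a, ContDiffAt ℝ ∞ f y)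
    (hd : deriv f a ≠ 0) :
    ∃ g : ℝ → ℝ, (∀ᶠ s in 𝓝 (f a), ContDiffAt ℝ ∞ g s) ∧ g (f a) = a ∧
      HasDerivAt g (deriv f a)⁻¹ (f a) ∧ ∀ᶠ s in 𝓝 (f a), f (g s) = s := by
  have hs := hf.self_of_nhds.hasStrictDerivAt (n := ∞) (by simp)
  set g := hs.localInverse f (deriv f a) a hd with hg
  have hga : g (f a) = a := (hs.eventually_left_inverse hd).self_of_nhds
  have hr : ∀ᶠ s in 𝓝 (f a), f (g s) = s := hs.eventually_right_inverse hd
  have hgd : HasStrictDerivAt g (deriv f a)⁻¹ (f a) := hs.to_localInverse hd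
  have hgc : ContDiffAt ℝ ∞ g (f a) := contDiffAt_of_right_inverse hgd.hasDerivAt.continuousAt hr
    (by rw [hga]; exact hf.self_of_nhds) (by rwa [hga])
  have hgc' : ∀ᶠ s in 𝓝 (f a), ContDiffAt ℝ 1 g s :=
    (hgc.of_le (by simp)).eventually (by simp)
  have hfd : ∀ᶠ y in 𝓝 a, deriv f y ≠ 0 := by
    have h2 : ContDiffAt ℝ ∞ (deriv f) a := by
      have : ContDiffAt ℝ ∞ (fun s => fderiv ℝ f s 1) a :=
        (hf.self_of_nhds.fderiv_right (by simp)).clm_apply contDiffAt_const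
      exact this
    exact h2.continuousAt.eventually_ne hd
  refine ⟨g, ?_, hga, hgd.hasDerivAt, hr⟩
  filter_upwards [hgc', hr.eventually_nhds, hgc.continuousAt.eventually
    (p := fun y => ContDiffAt ℝ ∞ f y ∧ deriv f y ≠ 0)
    (by rw [hga]; exact hf.and hfd)] with s h1 h2 h3
  exact contDiffAt_of_right_inverse h1.continuousAt h2 h3.1 h3.2

theorem HasSpeed.comp {σ : ℝ → ℝ} {s : ℝ} (h : HasSpeed φ A γ (σ s) k)
    (hσ : ∀ᶠ r in 𝓝 s, ContDiffAt ℝ ∞ σ r) : HasSpeed φ A (γ ∘ σ) s (deriv σ s * k) := by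
  obtain ⟨c, hc, hv⟩ := h
  have hσs := hσ.self_of_nhds
  refine ⟨c ∘ σ, ?_, ?_⟩
  · filter_upwards [hσs.continuousAt.eventually hc, hσ] with r h1 h2
    exact ⟨h1.1.comp r h2.contMDiffAt, h1.2⟩
  · rw [(hc.hasVelocity.comp (hσs.differentiableAt (by simp)).hasDerivAt).vel_eq, mul_smul,
      ← smul_sub]
    exact Submodule.smul_mem _ _ hv

theorem HasSpeed.congr {γ' : ℝ → TorusQuotient M} (h : HasSpeed φ A γ t k)
    (he : ∀ᶠ s in 𝓝 t, γ s = γ' s) : HasSpeed φ A γ' t k := by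
  obtain ⟨c, hc, hv⟩ := h
  exact ⟨c, by filter_upwards [hc, he] with s h1 h2 using ⟨h1.1, h1.2.trans h2⟩, hv⟩

theorem IsUnparamIntegralCurveT.exists_hasSpeed (h : IsUnparamIntegralCurveT φ A γ J) (ht : t ∈ J) :
    ∃ k ≠ 0, HasSpeed φ A γ t k := by
  obtain ⟨J', σ, hJ', hσ, hd, rfl, hi⟩ := h
  obtain ⟨s, hs, rfl⟩ := ht
  have hσs : ∀ᶠ r in 𝓝 s, ContDiffAt ℝ ∞ σ r :=
    (hJ'.1.eventually_mem hs).mono fun r hr => hσ.contDiffAt (hJ'.1.mem_nhds hr)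
  obtain ⟨g, hg, hgs, hgd, hr⟩ := exists_local_inverse hσs (hd s hs)
  have h1 := (isIntegralCurveT_iff.mp hi s hs).2
  rw [← hgs] at h1
  have h2 := (h1.comp hg).congr (γ' := γ) (by
    filter_upwards [hr] with r hr
    simp only [Function.comp, hr])
  rw [hgd.deriv, mul_one] at h2
  exact ⟨_, inv_ne_zero (hd s hs), h2⟩

variable (hS : MomentSetting A φ ν μ)
include hS

/-- A curve with velocity hZ becomes an integral curve in the time θ with θ' = h; σ is the inverse
of θ. The map θ itself is returned in order to locate given times in the new interval. -/
theorem isUnparamIntegralCurveT_of_hasSpeed (hJ : IsOpenInterval J) {h : ℝ → ℝ}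
    (h0 : ∀ t ∈ J, h t ≠ 0)
    (hh : ∀ t ∈ J, γ t ∈ principalTorusQuotient M ∧ HasSpeed φ A γ t (h t)) :
    ∃ (J' : Set ℝ) (σ θ : ℝ → ℝ), IsOpenInterval J' ∧ ContDiffOn ℝ ∞ σ J' ∧
    (∀ s ∈ J', deriv σ s ≠ 0) ∧ σ '' J' = J ∧ IsIntegralCurveT φ A (γ ∘ σ) J' ∧
    ContinuousOn θ J ∧ (∀ t ∈ J, θ t ∈ J' ∧ σ (θ t) = t) := by
  have hsm : ∀ t ∈ J, ContDiffAt ℝ ∞ h t := fun t ht =>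
    contDiffAt_of_hasSpeed hS ((hJ.1.eventually_mem ht).mono hh)
  obtain ⟨t₀, ht₀⟩ := hJ.2.2
  obtain ⟨θ, hθ⟩ := exists_primitive hJ.1 hJ.2.1 ht₀
    (fun t ht => (hsm t ht).continuousAt.continuousWithinAt)
  have hθc : ContinuousOn θ J := fun t ht => (hθ t ht).continuousAt.continuousWithinAt
  have hθs : ∀ t ∈ J, ContDiffAt ℝ ∞ θ t := by
    have h1 : ContDiffOn ℝ ∞ θ J := by
      rw [contDiffOn_infty_iff_deriv_of_isOpen hJ.1]
      refine ⟨fun t ht => (hθ t ht).differentiableAt.differentiableWithinAt, ?_⟩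
      exact ContDiffOn.congr (fun t ht => (hsm t ht).contDiffWithinAt) fun t ht => (hθ t ht).deriv
    exact fun t ht => h1.contDiffAt (hJ.1.mem_nhds ht)
  -- Rolle's theorem: equal values of θ at two times would force a zero of h between them.
  have hinj : InjOn θ J := by
    have key : ∀ a ∈ J, ∀ b ∈ J, θ a = θ b → ¬ a < b := by
      intro a ha b hb hab hlt
      have hsub : Icc a b ⊆ J := hJ.2.1.out ha hb
      obtain ⟨c, hc, hc0⟩ := exists_hasDerivAt_eq_zero hlt (hθc.mono hsub) hab
        fun x hx => hθ x (hsub (Ioo_subset_Icc_self hx))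
      exact h0 c (hsub (Ioo_subset_Icc_self hc)) hc0
    intro a ha b hb hab
    rcases lt_trichotomy a b with h1 | h1 | h1
    · exact absurd h1 (key a ha b hb hab)
    · exact h1
    · exact absurd h1 (key b hb a ha hab.symm)
  set σ := Function.invFunOn θ J with hσd
  have hσθ : ∀ t ∈ J, σ (θ t) = t := fun t ht => hinj.leftInvOn_invFunOn ht
  have hloc : ∀ t ∈ J, (∀ᶠ s in 𝓝 (θ t), s ∈ θ '' J) ∧ (∀ᶠ s in 𝓝 (θ t), ContDiffAt ℝ ∞ σ s) ∧
      HasDerivAt σ (h t)⁻¹ (θ t) := by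
    intro t ht
    obtain ⟨g, hg, hgt, hgd, hr⟩ := exists_local_inverse
      ((hJ.1.eventually_mem ht).mono hθs)
      (by rw [(hθ t ht).deriv]; exact h0 t ht)
    have hgJ : ∀ᶠ s in 𝓝 (θ t), g s ∈ J :=
      hg.self_of_nhds.continuousAt.eventually (by rw [hgt]; exact hJ.1.mem_nhds ht)
    have hgσ : σ =ᶠ[𝓝 (θ t)] g := by
      filter_upwards [hgJ, hr] with s h1 h2
      rw [← hσθ _ h1, h2]
    refine ⟨?_, ?_, ?_⟩
    · filter_upwards [hgJ, hr] with s h1 h2 using ⟨g s, h1, h2⟩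
    · filter_upwards [hg, hgσ.eventuallyEq_nhds] with s h1 h2 using h1.congr_of_eventuallyEq h2
    · rw [(hθ t ht).deriv] at hgd
      exact hgd.congr_of_eventuallyEq hgσ
  have hJ' : IsOpenInterval (θ '' J) := by
    refine ⟨isOpen_iff_mem_nhds.mpr ?_, ?_, hJ.2.2.image θ⟩
    · rintro _ ⟨t, ht, rfl⟩
      exact (hloc t ht).1
    · exact (hJ.2.1.isPreconnected.image θ hθc).ordConnected
  refine ⟨θ '' J, σ, θ, hJ', ?_, ?_, ?_, ?_, hθc, fun t ht => ⟨mem_image_of_mem θ ht, hσθ t ht⟩⟩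
  · rintro _ ⟨t, ht, rfl⟩
    exact (hloc t ht).2.1.self_of_nhds.contDiffWithinAt
  · rintro _ ⟨t, ht, rfl⟩
    rw [(hloc t ht).2.2.deriv]
    exact inv_ne_zero (h0 t ht)
  · rw [image_image]
    exact (image_congr hσθ).trans (image_id J)
  · rw [isIntegralCurveT_iff]
    rintro _ ⟨t, ht, rfl⟩
    have h1 := hh t ht
    rw [← hσθ t ht] at h1
    refine ⟨h1.1, ?_⟩
    have h2 := h1.2.comp (hloc t ht).2.1
    rwa [(hloc t ht).2.2.deriv, hσθ t ht, inv_mul_cancel₀ (h0 t ht)] at h2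

end Reparam

/-! ### Integral curves in the base -/

section Base

variable {M : Type*} [TopologicalSpace M] [ChartedSpace E7 M] [MulAction Grp M]
  [IsManifold (𝓡 7) ∞ M] [T2Space M] [ConnectedSpace M]
  [ContMDiffSMul modelGrp (𝓡 7) ∞ Grp M] {A : AdaptedBasis} {φ : G2Structure M}
  {ν : M → ℝ} {μ : M → EuclideanSpace ℝ (Fin 3)} {β : ℝ → FullQuotient M} {J : Set ℝ} {t k : ℝ}

theorem isIntegralCurveB_iff : IsIntegralCurveB φ A β J ↔
    ∀ t ∈ J, β t ∈ baseB M ∧ ∃ c : ℝ → M, IsLocalLift toFullQuotient β t c ∧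
      vel c t - zf φ A (c t) ∈ orbitTan A (c t) :=
  forall₂_congr fun _ _ => and_congr_right fun _ => exists_congr fun c =>
    and_congr_right fun _ => Submodule.Quotient.eq (orbitTan A (c _))

theorem eq_on_Ioo_of_hasDerivAt_zero {f : ℝ → ℝ} {a b : ℝ}
    (h : ∀ s ∈ Ioo a b, HasDerivAt f 0 s) {s t : ℝ} (hs : s ∈ Ioo a b) (ht : t ∈ Ioo a b) :
    f s = f t :=
  (convex_Ioo a b).is_const_of_fderivWithin_eq_zero
    (fun r hr => (h r hr).differentiableAt.differentiableWithinAt)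
    (fun r hr => by
      rw [fderivWithin_of_isOpen isOpen_Ioo hr, (h r hr).hasFDerivAt.fderiv]
      ext; simp) hs ht

variable (hS : MomentSetting A φ ν μ)
include hS

theorem nu_of_toFullQuotient_eq {x y : M} (h : (toFullQuotient x : FullQuotient M) = toFullQuotient y) :
    ν x = ν y := by
  obtain ⟨g, rfl⟩ := toFullQuotient_eq.mp h
  exact nu_smul hS.inv hS.mm g y

theorem norm_mu_of_toFullQuotient_eq {x y : M}
    (h : (toFullQuotient x : FullQuotient M) = toFullQuotient y) : ‖μ x‖ = ‖μ y‖ := by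
  obtain ⟨g, rfl⟩ := toFullQuotient_eq.mp h
  exact norm_mu_smul hS.inv hS.mm g y

theorem nz_of_toFullQuotient_eq {x y : M}
    (h : (toFullQuotient x : FullQuotient M) = toFullQuotient y) : nz φ A x = nz φ A y := by
  obtain ⟨g, rfl⟩ := toFullQuotient_eq.mp h
  exact nz_smul hS.inv g y

/-- Along curves with velocity in `k • Z + T(orbit)`, `|μ|` is constant. -/
theorem hasDerivAt_rho_of_sub_mem {c : ℝ → M} {v : E7} (hc : HasVelocity c t v)
    (hv : v - k • zf φ A (c t) ∈ orbitTan A (c t)) :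
    HasDerivAt (fun s => ‖μ (c s)‖ ^ 2) 0 t := by
  obtain ⟨p, hp⟩ := (mem_orbitTan A).mp hv
  have h1 := hasDerivAt_rho hS.mm hc
  rw [sub_eq_iff_eq_add.mp hp.symm, map_add, map_smul, dmu_zf, drho_inf hS.inv hS.mm] at h1
  simpa using h1

theorem hasDerivAt_nu_of_sub_mem {c : ℝ → M} {v : E7} (hc : HasVelocity c t v)
    (hv : v - k • zf φ A (c t) ∈ orbitTan A (c t)) :
    HasDerivAt (fun s => ν (c s)) (k * nz φ A (c t)) t := by
  have h1 := hS.mm.hasDerivAt_nu hc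
  rwa [← dnu_apply, dnu_of_sub_mem hS hv] at h1

theorem IsZ.hasDerivAt_nu {e : ℝ → M} {I : Set ℝ} (he : IsZ φ A e I) (ht : t ∈ I) :
    HasDerivAt (fun s => ν (e s)) (nz φ A (e t)) t := by
  have := hasDerivAt_nu_of_sub_mem (k := 1) hS (he t ht) (by simp)
  rwa [one_mul] at this

theorem IsZ.hasDerivAt_rho {e : ℝ → M} {I : Set ℝ} (he : IsZ φ A e I) (ht : t ∈ I) :
    HasDerivAt (fun s => ‖μ (e s)‖ ^ 2) 0 t :=
  hasDerivAt_rho_of_sub_mem (k := 1) hS (he t ht) (by simp)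

theorem IsZ.hasStrictDerivAt_nu {e : ℝ → M} {I : Set ℝ} (he : IsZ φ A e I) (hI : IsOpen I)
    (ht : t ∈ I) : HasStrictDerivAt (fun s => ν (e s)) (nz φ A (e t)) t := by
  have h1 : ContDiffAt ℝ ∞ (fun s => ν (e s)) t :=
    contMDiffAt_iff_contDiffAt.mp (hS.mm.smooth_nu.contMDiffAt.comp t (he.contMDiffAt hI ht))
  have h2 := h1.hasStrictDerivAt (by simp)
  rwa [(he.hasDerivAt_nu hS ht).deriv] at h2

/-- The tangential freedom of a lift c is now the whole orbit, so no torus correction is available.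
Instead c is compared with the integral curve e of Z through c t: along both, |μ| is constant and ν
increases at the rate |Z|². Since ν and |μ| separate nearby orbits, e passes through the same
orbits, and the equal rates make the times agree. -/
theorem IsIntegralCurveB.exists_local_isZ (hβ : IsIntegralCurveB φ A β J) (hJ : IsOpen J)
    (ht : t ∈ J) : ∃ ε > 0, ∃ e, IsZ φ A e (Ioo (t - ε) (t + ε)) ∧
      ∀ s ∈ Ioo (t - ε) (t + ε), s ∈ J ∧ toFullQuotient (e s) = β s := by
  rw [isIntegralCurveB_iff] at hβ
  obtain ⟨hp, c, hc, -⟩ := hβ t ht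
  have hx : c t ∈ principalSet M := by rw [← toFullQuotient_mem, hc.self_of_nhds.2]; exact hp
  have hder : ∀ᶠ s in 𝓝 t, HasDerivAt (fun s => ν (c s)) (nz φ A (c s)) s ∧
      HasDerivAt (fun s => ‖μ (c s)‖ ^ 2) 0 s := by
    filter_upwards [hJ.mem_nhds ht, hc.eventually] with s hs hcs
    obtain ⟨-, d, hd, hv⟩ := hβ s hs
    have hcd : ∀ᶠ r in 𝓝 s, (toFullQuotient (c r) : FullQuotient M) = toFullQuotient (d r) := by
      filter_upwards [hd, hcs] with r h1 h2 using h2.2.trans h1.2.symm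
    have h1 := hasDerivAt_nu_of_sub_mem hS (k := 1) hd.hasVelocity (by rwa [one_smul])
    have h2 := hasDerivAt_rho_of_sub_mem hS (k := 1) hd.hasVelocity (by rwa [one_smul])
    rw [one_mul, ← nz_of_toFullQuotient_eq hS hcd.self_of_nhds] at h1
    exact ⟨h1.congr_of_eventuallyEq (hcd.mono fun r hr => nu_of_toFullQuotient_eq hS hr),
      h2.congr_of_eventuallyEq
        (hcd.mono fun r hr => congrArg (· ^ 2) (norm_mu_of_toFullQuotient_eq hS hr))⟩
  obtain ⟨ε₁, hε₁, e, het, heZ⟩ := exists_isZ φ A (c t) t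
  have htI : t ∈ Ioo (t - ε₁) (t + ε₁) := ⟨by linarith, by linarith⟩
  have hst := heZ.hasStrictDerivAt_nu hS isOpen_Ioo htI
  have hnz : nz φ A (e t) ≠ 0 := by rw [het]; exact (nz_pos hS.coh hx).ne'
  have hcont : ContinuousAt c t := hc.self_of_nhds.1.continuousAt
  have hecont : ContinuousAt e t := (heZ t htI).continuousAt
  obtain ⟨g, hg, hgt, -, hr⟩ := exists_local_inverse
    ((isOpen_Ioo.eventually_mem htI).mono fun s hs =>
      contMDiffAt_iff_contDiffAt.mp (hS.mm.smooth_nu.contMDiffAt.comp s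
      (heZ.contMDiffAt isOpen_Ioo hs)) : ∀ᶠ s in 𝓝 t, ContDiffAt ℝ ∞ (fun s => ν (e s)) s)
    (by rw [hst.hasDerivAt.deriv]; exact hnz)
  have hνt : ν (c t) = ν (e t) := by rw [het]
  -- θ s is the time at which e reaches the value ν (c s) of the clock.
  set θ : ℝ → ℝ := fun s => g (ν (c s)) with hθ
  have hθt : θ t = t := by simp only [hθ, hνt]; exact hgt
  have hνc : ContinuousAt (fun s => ν (c s)) t := (hder.self_of_nhds.1).continuousAt
  have hgν : ∀ᶠ s in 𝓝 t, ContDiffAt ℝ ∞ g (ν (c s)) :=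
    hνc.eventually (p := fun r => ContDiffAt ℝ ∞ g r)
      (by beta_reduce; rw [hνt]; exact hg)
  have hθν : ∀ᶠ s in 𝓝 t, ν (e (θ s)) = ν (c s) :=
    hνc.eventually (p := fun r => ν (e (g r)) = r) (by beta_reduce; rw [hνt]; exact hr)
  have hθc : ∀ᶠ s in 𝓝 t, ContinuousAt θ s := by
    filter_upwards [hgν, hder] with s h1 h2
    exact ContinuousAt.comp (g := g) (f := fun s => ν (c s)) h1.continuousAt h2.1.continuousAt
  obtain ⟨N, hN, hOC⟩ := exists_nhds_same_orbit hS hx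
  have hθI : ∀ᶠ s in 𝓝 t, θ s ∈ Ioo (t - ε₁) (t + ε₁) ∧ e (θ s) ∈ N := by
    refine hθc.self_of_nhds.eventually (p := fun r => r ∈ Ioo (t - ε₁) (t + ε₁) ∧ e r ∈ N) ?_
    rw [hθt]
    exact (isOpen_Ioo.eventually_mem htI).and (hecont.eventually (by rw [het]; exact hN))
  obtain ⟨ε, hε, hb⟩ := Metric.eventually_nhds_iff_ball.mp
    ((hder.and (hθν.eventually_nhds.and hθc)).and
      (hθI.and ((hcont.eventually hN).and (hc.and (hJ.eventually_mem ht)))))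
  rw [Real.ball_eq_Ioo] at hb
  have htε : t ∈ Ioo (t - ε) (t + ε) := ⟨by linarith, by linarith⟩
  have hsame : ∀ s ∈ Ioo (t - ε) (t + ε),
      (toFullQuotient (e (θ s)) : FullQuotient M) = toFullQuotient (c s) := by
    intro s hs
    obtain ⟨⟨h1, h2, -⟩, h3, h4, h5, -⟩ := hb s hs
    have hρc : ‖μ (c s)‖ ^ 2 = ‖μ (c t)‖ ^ 2 :=
      eq_on_Ioo_of_hasDerivAt_zero (fun r hr => (hb r hr).1.1.2) hs htε
    have hρe : ‖μ (e (θ s))‖ ^ 2 = ‖μ (e t)‖ ^ 2 :=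
      eq_on_Ioo_of_hasDerivAt_zero (fun r hr => heZ.hasDerivAt_rho hS hr) h3.1 htI
    rw [het, ← hρc] at hρe
    refine Eq.symm (toFullQuotient_eq.mpr (hOC _ h3.2 _ h4 h2.self_of_nhds ?_))
    exact (pow_left_inj₀ (norm_nonneg _) (norm_nonneg _) two_ne_zero).mp hρe
  -- The rate |Z|² is constant on orbits, hence the same at e (θ s) and at c s, so θ has derivative
  -- 1.
  have hθd : ∀ s ∈ Ioo (t - ε) (t + ε), HasDerivAt (fun s => θ s - s) 0 s := by
    intro s hs
    obtain ⟨⟨h1, h2, h2'⟩, h3, h4, h5, -⟩ := hb s hs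
    have hn : nz φ A (e (θ s)) = nz φ A (c s) := nz_of_toFullQuotient_eq hS (hsame s hs)
    have hxs : nz φ A (c s) ≠ 0 := by
      refine (nz_pos hS.coh ?_).ne'
      rw [← toFullQuotient_mem, h5.2]
      exact (hβ s (hb s hs).2.2.2.2).1
    have h6 := hasDerivAt_of_comp_eq h2' (heZ.hasStrictDerivAt_nu hS isOpen_Ioo h3.1)
      (by rwa [hn]) h1.1 h2
    rw [hn, inv_mul_cancel₀ hxs] at h6
    have h7 := h6.sub (hasDerivAt_id s)
    rw [sub_self] at h7
    exact h7
  have hθid : ∀ s ∈ Ioo (t - ε) (t + ε), θ s = s := by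
    intro s hs
    have := eq_on_Ioo_of_hasDerivAt_zero hθd hs htε
    simp only [hθt, sub_self] at this
    linarith
  refine ⟨min ε ε₁, lt_min hε hε₁, e, heZ.mono (Ioo_subset_Ioo ?_ ?_), fun s hs => ?_⟩
  · linarith [min_le_right ε ε₁]
  · linarith [min_le_right ε ε₁]
  · have hs' : s ∈ Ioo (t - ε) (t + ε) := Ioo_subset_Ioo (by linarith [min_le_left ε ε₁])
      (by linarith [min_le_left ε ε₁]) hs
    refine ⟨(hb s hs').2.2.2.2, ?_⟩
    have := hsame s hs'
    rw [hθid s hs'] at this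
    exact this.trans (hb s hs').2.2.2.1.2

/-- Integral curves in the base lift to integral curves. -/
theorem IsIntegralCurveB.exists_lift (hβ : IsIntegralCurveB φ A β J) (hJ : IsOpenInterval J)
    (ht : t ∈ J) {x : M} (hx : toFullQuotient x = β t) :
    ∃ c, c t = x ∧ IsZ φ A c J ∧ ∀ s ∈ J, toFullQuotient (c s) = β s := by
  obtain ⟨c, h1, h2, h3⟩ := exists_isZ_of_local (φ := φ) (A := A) hS.inv
    (R := fun s y => s ∈ J ∧ toFullQuotient y = β s) hJ (fun s y h => h.1)
    (fun t ht => hβ.exists_local_isZ hS hJ.1 ht)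
    (fun s y y' h h' => by
      obtain ⟨a, ha⟩ := toFullQuotient_eq.mp (h'.2.trans h.2.symm)
      exact ⟨_, ha, fun s' z hz => ⟨hz.1, (toFullQuotient_smul a z).trans hz.2⟩⟩) ⟨ht, hx⟩
  exact ⟨c, h1, h2, fun s hs => (h3 s hs).2⟩

end Base

/-! ### Immersed parametrisations -/

/-- The parameter space of three-dimensional submanifolds. -/
abbrev W3 := EuclideanSpace ℝ (Fin 3)

section Param

variable {M : Type*} [TopologicalSpace M] [ChartedSpace E7 M] [IsManifold (𝓡 7) ∞ M]
  {F : W3 → M} {y : W3}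

/-- The differential of a parametrisation. -/
def dF (F : W3 → M) (y : W3) : W3 →L[ℝ] E7 := mfderiv (𝓡 3) (𝓡 7) F y

theorem hasVelocity_comp_param {d : ℝ → W3} {s : ℝ} {w : W3}
    (hF : MDifferentiableAt (𝓡 3) (𝓡 7) F (d s)) (hd : HasDerivAt d w s) :
    HasVelocity (fun r => F (d r)) s (dF F (d s) w) := by
  have h2 := hasVelocity_of_hasMFDerivAt
    (L := (dF F (d s)).comp (.toSpanSingleton ℝ w))
    (HasMFDerivAt.comp s hF.hasMFDerivAt hd.hasFDerivAt.hasMFDerivAt)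
  refine h2.congr_vel ?_
  simp

theorem hasStrictFDerivAt_chart {x₀ : M} (hF : ContMDiffAt (𝓡 3) (𝓡 7) ∞ F y)
    (hx : F y ∈ (ch x₀).source) :
    HasStrictFDerivAt (fun z => ch x₀ (F z)) ((chD x₀ (F y)).comp (dF F y)) y := by
  have h1 : ContDiffAt ℝ ∞ (fun z => ch x₀ (F z)) y :=
    contMDiffAt_iff_contDiffAt.mp ((contMDiffAt_ch hx).comp y hF)
  have h2 : HasFDerivAt (fun z => ch x₀ (F z)) ((chD x₀ (F y)).comp (dF F y)) y :=
    HasMFDerivAt.hasFDerivAt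
      (HasMFDerivAt.comp y (hasMFDerivAt_ch hx) (hF.mdifferentiableAt (by simp)).hasMFDerivAt)
  have h3 := h1.hasStrictFDerivAt (by simp)
  rwa [h2.fderiv] at h3

theorem injective_chD_dF {x₀ : M} (hx : F y ∈ (ch x₀).source) (hi : Function.Injective (dF F y)) :
    Function.Injective ((chD x₀ (F y)).comp (dF F y)) :=
  (chEquiv hx).injective.comp hi

theorem exists_nhds_chart_norm_sub_le (hF : ContMDiffAt (𝓡 3) (𝓡 7) ∞ F y)
    (hi : Function.Injective (dF F y)) :
    ∃ K > 0, ∃ U ∈ 𝓝 y, (∀ z ∈ U, F z ∈ (ch (F y)).source) ∧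
      ∀ z ∈ U, ∀ w ∈ U, ‖z - w‖ ≤ K * ‖ch (F y) (F z) - ch (F y) (F w)‖ := by
  have hx : F y ∈ (ch (F y)).source := mem_extChartAt_source _
  obtain ⟨K, hK, U, hU, h⟩ := exists_nhds_norm_sub_le (hasStrictFDerivAt_chart hF hx)
    (injective_chD_dF hx hi)
  refine ⟨K, hK, U ∩ F ⁻¹' (ch (F y)).source,
    inter_mem hU (hF.continuousAt.preimage_mem_nhds ((isOpen_ch_source _).mem_nhds hx)),
    fun z hz => hz.2, fun z hz w hw => h z hz.1 w hw.1⟩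

/-- The lower Lipschitz bound in the chart gives injectivity and the continuity of the inverse in
one stroke. -/
theorem isEmbedding_domRestrict {Ω : Set W3} (hF : ContinuousOn F Ω) {x₀ : M} {K : ℝ}
    (hs : ∀ z ∈ Ω, F z ∈ (ch x₀).source)
    (h : ∀ z ∈ Ω, ∀ w ∈ Ω, ‖z - w‖ ≤ K * ‖ch x₀ (F z) - ch x₀ (F w)‖) :
    Topology.IsEmbedding (Ω.domRestrict F) := by
  have hcont : Continuous (Ω.domRestrict F) := continuousOn_iff_continuous_domRestrict.mp hF
  refine ⟨Topology.isInducing_iff_nhds.mpr fun z => le_antisymm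
    (map_le_iff_le_comap.mp hcont.continuousAt) ?_, ?_⟩
  · intro S hS
    obtain ⟨ε, hε, hb⟩ := Metric.mem_nhds_iff.mp hS
    have hzs := hs z z.2
    have hc : ContinuousAt (fun m => K * ‖ch x₀ m - ch x₀ (F z)‖) (F z) :=
      (((contMDiffAt_ch hzs).continuousAt.sub continuousAt_const).norm).const_mul K
    have hev : ∀ᶠ m in 𝓝 (F z), K * ‖ch x₀ m - ch x₀ (F z)‖ < ε :=
      hc.eventually_lt_const (by simpa using hε)
    refine ⟨_, hev, fun w hw => hb ?_⟩
    rw [Metric.mem_ball, Subtype.dist_eq, dist_eq_norm]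
    exact (h w w.2 z z.2).trans_lt hw
  · intro z w hzw
    have h1 := h z z.2 w w.2
    have h2 : F z = F w := hzw
    rw [h2, sub_self, norm_zero, mul_zero] at h1
    exact Subtype.ext (sub_eq_zero.mp (norm_le_zero_iff.mp h1))

end Param

/-! ### Preimages of integral curves are associative -/

section Flow

variable {M : Type*} [TopologicalSpace M] [ChartedSpace E7 M] [MulAction Grp M]
  [IsManifold (𝓡 7) ∞ M] [T2Space M]
  [ContMDiffSMul modelGrp (𝓡 7) ∞ Grp M] {A : AdaptedBasis} {φ : G2Structure M}
  {ν : M → ℝ} {μ : M → EuclideanSpace ℝ (Fin 3)} {γ : ℝ → TorusQuotient M} {J : Set ℝ} {t k : ℝ}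
  {c : ℝ → M} {y : W3}

/-- The torus orbits of the points of a curve, parametrised near `c t`. -/
def flowParam (A : AdaptedBasis) (c : ℝ → M) (t : ℝ) (y : W3) : M :=
  A.expG ((y 0, y 1), 0) • c (t + y 2)

theorem flowParam_zero : flowParam A c t 0 = c t := by
  simp only [flowParam, PiLp.zero_apply, add_zero]
  rw [show (((0 : ℝ), (0 : ℝ)), (0 : Fin 3 → ℝ)) = (0 : Par) from rfl, A.expG_zero, one_smul]

theorem contMDiffAt_flowParam (hc : ContMDiffAt 𝓘(ℝ, ℝ) (𝓡 7) ∞ c (t + y 2)) :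
    ContMDiffAt (𝓡 3) (𝓡 7) ∞ (flowParam A c t) y := by
  have hp : ContDiff ℝ ∞ (fun y : W3 => (((y 0, y 1), 0) : Par)) :=
    (((EuclideanSpace.proj (𝕜 := ℝ) 0 : W3 →L[ℝ] ℝ).contDiff).prodMk
      (EuclideanSpace.proj (𝕜 := ℝ) 1 : W3 →L[ℝ] ℝ).contDiff).prodMk contDiff_const
  have h2 : ContDiff ℝ ∞ (fun y : W3 => t + y 2) :=
    contDiff_const.add (EuclideanSpace.proj (𝕜 := ℝ) 2 : W3 →L[ℝ] ℝ).contDiff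
  exact ContMDiffAt.comp y (contMDiff_act A M).contMDiffAt
    (hp.contMDiff.contMDiffAt.prodMk
      (ContMDiffAt.comp (g := c) (f := fun y : W3 => t + y 2) y hc h2.contMDiff.contMDiffAt))

theorem dF_flowParam (hinv : φ.IsInvariant) (hc : IsZ φ A c J) (hJ : IsOpen J) (hy : t + y 2 ∈ J)
    (w : W3) : dF (flowParam A c t) y w =
      infT A (flowParam A c t y) (w 0, w 1) + w 2 • zf φ A (flowParam A c t y) := by
  have hd : HasDerivAt (fun r : ℝ => y + r • w) w 0 := by
    simpa using ((hasDerivAt_id (0 : ℝ)).smul_const w).const_add y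
  have h1 : HasVelocity (fun r : ℝ => flowParam A c t (y + r • w)) 0
      (dF (flowParam A c t) (y + (0 : ℝ) • w) w) := by
    refine hasVelocity_comp_param ?_ hd
    rw [zero_smul, add_zero]
    exact (contMDiffAt_flowParam (hc.contMDiffAt hJ hy)).mdifferentiableAt (by simp)
  rw [zero_smul, add_zero] at h1
  have hσ : HasDerivAt (fun r : ℝ => t + y 2 + r * w 2) (w 2) 0 := by
    simpa using ((hasDerivAt_id (0 : ℝ)).mul_const (w 2)).const_add (t + y 2)
  have h2 := (HasVelocity.comp (c := c) (σ := fun r : ℝ => t + y 2 + r * w 2)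
    (by simp only [zero_mul, add_zero]; exact hc _ hy) hσ).smul (A.expG ((y 0, y 1), 0))
  have hp : HasDerivAt (fun r : ℝ => r • (((w 0, w 1), 0) : Par)) ((w 0, w 1), 0) 0 := by
    simpa using (hasDerivAt_id (0 : ℝ)).smul_const (((w 0, w 1), 0) : Par)
  have h3 := h2.act A hp (zero_smul _ _)
  have hfun : (fun r : ℝ => A.expG (r • (((w 0, w 1), 0) : Par)) •
      A.expG ((y 0, y 1), 0) • (c ∘ fun r : ℝ => t + y 2 + r * w 2) r) =
      fun r : ℝ => flowParam A c t (y + r • w) := by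
    ext1 r
    simp only [flowParam, Function.comp, smul_smul, PiLp.add_apply, PiLp.smul_apply, smul_eq_mul]
    rw [show r • (((w 0, w 1), 0) : Par) = ((r * w 0, r * w 1), 0) by ext <;> simp,
      ← A.expG_torus_add, add_assoc]
    congr 3
    ext <;> simp [add_comm]
  rw [hfun] at h3
  rw [h1.unique h3]
  simp only [Function.comp, zero_mul, add_zero, map_smul, dact_zf A hinv]
  rfl

theorem injective_dF_flowParam (hS : MomentSetting A φ ν μ) (hc : IsZ φ A c J) (hJ : IsOpen J)
    (hy : t + y 2 ∈ J) (hx : c (t + y 2) ∈ principalSet M) :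
    Function.Injective (dF (flowParam A c t) y) := by
  refine (injective_iff_map_eq_zero _).mpr fun w hw => ?_
  have hx' : flowParam A c t y ∈ principalSet M := (smul_mem_principalSet_iff _).mpr hx
  rw [dF_flowParam hS.inv hc hJ hy] at hw
  have h2 : w 2 = 0 := by
    by_contra h
    refine zf_notMem_orbitTan hS hx' ?_
    have h3 : zf φ A (flowParam A c t y) =
        -((w 2)⁻¹ • infT A (flowParam A c t y) (w 0, w 1)) := by
      rw [← smul_neg, neg_eq_of_add_eq_zero_right hw, smul_smul, inv_mul_cancel₀ h, one_smul]
    rw [h3]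
    exact neg_mem <| Submodule.smul_mem _ _ (torusTan_le_orbitTan A _ ((mem_torusTan A).mpr ⟨_, rfl⟩))
  rw [h2, zero_smul, add_zero, infT_apply] at hw
  have h3 := (injective_iff_map_eq_zero _).mp (inf_injective hS.coh hx') _ hw
  have h4 := congrArg Prod.fst h3
  ext i
  fin_cases i
  · exact congrArg Prod.fst h4
  · exact congrArg Prod.snd h4
  · exact h2

end Flow

/-! ### Associative planes that contain the torus directions. -/

section Plane

variable {M : Type*} [TopologicalSpace M] [ChartedSpace E7 M] [MulAction Grp M]
  [IsManifold (𝓡 7) ∞ M] [T2Space M]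
  [ContMDiffSMul modelGrp (𝓡 7) ∞ Grp M] {A : AdaptedBasis} {φ : G2Structure M}
  {ν : M → ℝ} {μ : M → EuclideanSpace ℝ (Fin 3)} {γ : ℝ → TorusQuotient M} {J : Set ℝ} {t k : ℝ}
  {c : ℝ → M} {y : W3} {x : M}

/-- The associative plane spanned by the torus orbit and `U₁ × U₂`. -/
def assocTan (φ : G2Structure M) (A : AdaptedBasis) (x : M) : Submodule ℝ E7 :=
  torusTan A x ⊔ Submodule.span ℝ {zf φ A x}

theorem mem_assocTan {v : E7} :
    v ∈ assocTan φ A x ↔ ∃ k : ℝ, v - k • zf φ A x ∈ torusTan A x := by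
  rw [assocTan, Submodule.mem_sup]
  constructor
  · rintro ⟨a, ha, b, hb, rfl⟩
    obtain ⟨k, rfl⟩ := Submodule.mem_span_singleton.mp hb
    exact ⟨k, by simpa using ha⟩
  · rintro ⟨k, hk⟩
    exact ⟨_, hk, _, Submodule.smul_mem _ k (Submodule.mem_span_singleton_self _), by simp⟩

theorem assocTan_eq_map : assocTan φ A x =
    (assoc0 ((frameE φ x).symm (uv A 0 x)) ((frameE φ x).symm (uv A 1 x))).map
      ((frameE φ x : E7 →L[ℝ] E7) : E7 →ₗ[ℝ] E7) := by
  rw [assoc0, ← symm_zf, Submodule.map_span, assocTan, torusTan_eq_span, ← Submodule.span_union]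
  congr 1
  ext v
  simp only [mem_union, mem_range, Fin.exists_fin_two, mem_singleton_iff, mem_image,
    mem_insert_iff, ContinuousLinearMap.coe_coe]
  constructor
  · rintro ((rfl | rfl) | rfl)
    · exact ⟨_, Or.inl rfl, (frameE φ x).apply_symm_apply _⟩
    · exact ⟨_, Or.inr (Or.inl rfl), (frameE φ x).apply_symm_apply _⟩
    · exact ⟨_, Or.inr (Or.inr rfl), (frameE φ x).apply_symm_apply _⟩
  · rintro ⟨w, rfl | rfl | rfl, rfl⟩
    · exact Or.inl (Or.inl ((frameE φ x).apply_symm_apply _).symm)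
    · exact Or.inl (Or.inr ((frameE φ x).apply_symm_apply _).symm)
    · exact Or.inr ((frameE φ x).apply_symm_apply _)

variable (hcoh : CohomogeneityTwo M A) (hx : x ∈ principalSet M)
include hcoh hx

theorem isAssociativePlane_assocTan : φ.IsAssociativePlane x (assocTan φ A x) := by
  obtain ⟨e, he, hspan, hφ⟩ := exists_orthonormal_assoc0
    (linearIndependent_symm_uv (φ := φ) hcoh hx)
  refine ⟨fun i => frameE φ x (e i), fun i j => ?_, ?_, ?_⟩
  · rw [← he i j]
    change inner ℝ ((frameE φ x).symm (frameE φ x (e i)))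
      ((frameE φ x).symm (frameE φ x (e j))) = _
    rw [ContinuousLinearEquiv.symm_apply_apply, ContinuousLinearEquiv.symm_apply_apply]
  · have h1 : Submodule.span ℝ (range fun i => frameE φ x (e i)) = assocTan φ A x := by
      rw [assocTan_eq_map, ← hspan, Submodule.map_span, ← range_comp]
      rfl
    exact h1
  · exact (φ.form_frame x e).trans hφ

/-- In the frame this is `span_eq_assoc0`: two independent vectors of an associative plane determine
it through their cross product. -/
theorem eq_assocTan_of_isAssociativePlane {P : Submodule ℝ E7} (hP : φ.IsAssociativePlane x P)
    (hu : ∀ l, uv A l x ∈ P) : P = assocTan φ A x := by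
  obtain ⟨e, he, hspan, hφ⟩ := hP
  set e' : Fin 3 → E7 := fun i => (frameE φ x).symm (e i) with hed
  have hsp : (Submodule.span ℝ (range e')).map ((frameE φ x : E7 →L[ℝ] E7) : E7 →ₗ[ℝ] E7) = P := by
    rw [Submodule.map_span, ← range_comp]
    refine Eq.trans ?_ hspan
    congr 2
    ext1 i
    exact (frameE φ x).apply_symm_apply _
  have hu' : ∀ l, (frameE φ x).symm (uv A l x) ∈ Submodule.span ℝ (range e') := by
    intro l
    have h1 := hu l
    rw [← hsp] at h1
    obtain ⟨w, hw, hwl⟩ := h1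
    rw [← hwl]
    change (frameE φ x).symm (frameE φ x w) ∈ _
    rwa [ContinuousLinearEquiv.symm_apply_apply]
  have hφ' : phi0 e' = 1 := by
    rw [← hφ, ← φ.form_frame x e']
    congr 1
    ext1 i
    exact (frameE φ x).apply_symm_apply _
  have h2 := span_eq_assoc0 he hφ' (linearIndependent_symm_uv (φ := φ) hcoh hx) (hu' 0) (hu' 1)
  rw [assocTan_eq_map, ← hsp]
  exact congrArg _ h2

end Plane

/-! ### Associative submanifolds swept out by integral curves. -/

section Preimage

variable {M : Type*} [TopologicalSpace M] [ChartedSpace E7 M] [MulAction Grp M]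
  [IsManifold (𝓡 7) ∞ M] [T2Space M]
  [ContMDiffSMul modelGrp (𝓡 7) ∞ Grp M] {A : AdaptedBasis} {φ : G2Structure M}
  {ν : M → ℝ} {μ : M → EuclideanSpace ℝ (Fin 3)} {γ : ℝ → TorusQuotient M} {J : Set ℝ} {t k : ℝ}
  {c : ℝ → M} {y : W3} {x : M}

theorem range_dF_flowParam (hinv : φ.IsInvariant) (hc : IsZ φ A c J) (hJ : IsOpen J)
    (hy : t + y 2 ∈ J) : (dF (flowParam A c t) y).range = assocTan φ A (flowParam A c t y) := by
  ext v
  rw [mem_assocTan]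
  constructor
  · rintro ⟨w, rfl⟩
    exact ⟨w 2, (mem_torusTan A).mpr ⟨(w 0, w 1), eq_sub_of_add_eq
      (dF_flowParam hinv hc hJ hy w).symm⟩⟩
  · rintro ⟨k, hk⟩
    obtain ⟨a, ha⟩ := (mem_torusTan A).mp hk
    refine ⟨!₂[a.1, a.2, k], (dF_flowParam hinv hc hJ hy _).trans ?_⟩
    exact add_eq_of_eq_sub ha

variable (hS : MomentSetting A φ ν μ)
include hS

theorem IsZ.strictMonoOn_nu [ConnectedSpace M] (hc : IsZ φ A c J) (hJ : IsOpenInterval J)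
    (hp : ∀ s ∈ J, c s ∈ principalSet M) : StrictMonoOn (fun s => ν (c s)) J := by
  refine strictMonoOn_of_deriv_pos hJ.2.1.convex
    (fun s hs => (hc.hasDerivAt_nu hS hs).continuousAt.continuousWithinAt) fun s hs => ?_
  have hs' := interior_subset hs
  rw [(hc.hasDerivAt_nu hS hs').deriv]
  exact nz_pos hS.coh (hp s hs')

/-- The preimage of an integral curve is a torus-invariant associative submanifold. -/
theorem IsIntegralCurveT.isTorusInvariantAssociative [ConnectedSpace M]
    (hγ : IsIntegralCurveT φ A γ J) (hJ : IsOpenInterval J) :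
    IsTorusInvariantAssociative φ (toTorusQuotient ⁻¹' (γ '' J)) := by
  refine ⟨?_, fun a x hx => ?_, ?_⟩
  · rintro x ⟨t, ht, htx⟩
    rw [← toTorusQuotient_mem, ← htx]
    exact (hγ t ht).1
  · rw [mem_preimage, toTorusQuotient_smul]; exact hx
  rintro x ⟨t, ht, htx⟩
  obtain ⟨c, hct, hcZ, hcγ⟩ := hγ.exists_lift hS hJ ht htx.symm
  have hp : ∀ s ∈ J, c s ∈ principalSet M := fun s hs => by
    rw [← toTorusQuotient_mem, hcγ s hs]; exact (hγ s hs).1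
  set F := flowParam A c t with hF
  have hF0 : F 0 = x := flowParam_zero.trans hct
  have hFS : ∀ y : W3, t + y 2 ∈ J → F y ∈ toTorusQuotient ⁻¹' (γ '' J) := fun y hy =>
    ⟨t + y 2, hy, by rw [hF, flowParam, toTorusQuotient_expG, hcγ _ hy]⟩
  have ht0 : t + (0 : W3) 2 ∈ J := by simpa using ht
  have hsm : ∀ y : W3, t + y 2 ∈ J → ContMDiffAt (𝓡 3) (𝓡 7) ∞ F y := fun y hy =>
    contMDiffAt_flowParam (hcZ.contMDiffAt hJ.1 hy)
  obtain ⟨K, hK, U, hU, hUs, hUK⟩ := exists_nhds_chart_norm_sub_le (hsm 0 ht0)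
    (injective_dF_flowParam hS hcZ hJ.1 ht0 (hp _ ht0))
  have hcont2 : Continuous fun y : W3 => t + y 2 :=
    continuous_const.add (EuclideanSpace.proj (𝕜 := ℝ) 2 : W3 →L[ℝ] ℝ).continuous
  set Ω₀ : Set W3 := interior U ∩ (fun y : W3 => t + y 2) ⁻¹' J with hΩ₀
  have hΩ₀o : IsOpen Ω₀ := isOpen_interior.inter (hJ.1.preimage hcont2)
  have h0Ω₀ : (0 : W3) ∈ Ω₀ := ⟨mem_interior_iff_mem_nhds.mpr hU, ht0⟩
  -- small parameters lie in the domain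
  have hpar : Continuous fun p : (ℝ × ℝ) × ℝ => (!₂[p.1.1, p.1.2, p.2] : W3) := by
    refine (PiLp.continuous_toLp 2 _).comp (continuous_pi fun i => ?_)
    fin_cases i
    · exact continuous_fst.fst
    · exact continuous_fst.snd
    · exact continuous_snd
  have hpar0 : (!₂[((0 : (ℝ × ℝ) × ℝ)).1.1, (0 : (ℝ × ℝ) × ℝ).1.2, (0 : (ℝ × ℝ) × ℝ).2] : W3)
      = 0 := by
    ext i; fin_cases i <;> rfl
  obtain ⟨δ, hδ, hball⟩ := Metric.mem_nhds_iff.mp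
    (hpar.continuousAt.preimage_mem_nhds (x := 0) (by rw [hpar0]; exact hΩ₀o.mem_nhds h0Ω₀))
  have hsmall : ∀ (τ : ℝ × ℝ) (s : ℝ), ‖τ‖ < δ → |s| < δ → (!₂[τ.1, τ.2, s] : W3) ∈ Ω₀ := by
    intro τ s hτ hs
    have : (τ, s) ∈ Metric.ball (0 : (ℝ × ℝ) × ℝ) δ := by
      rw [mem_ball_zero_iff, Prod.norm_def]
      exact max_lt hτ hs
    exact hball this
  have hxp : x ∈ principalSet M := hct ▸ hp t ht
  obtain ⟨N, hN, htube⟩ := exists_tube hS hxp hδ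
  have hcN : ∀ᶠ s in 𝓝 t, c s ∈ N ∧ s ∈ J ∧ |s - t| < δ := by
    refine ((hcZ t ht).continuousAt.eventually (by rw [hct]; exact hN)).and
      ((hJ.1.eventually_mem ht).and ?_)
    exact (Metric.ball_mem_nhds t hδ)
  obtain ⟨η, hη, hηb⟩ := Metric.eventually_nhds_iff_ball.mp hcN
  rw [Real.ball_eq_Ioo] at hηb
  have h1 : t - η / 2 ∈ Ioo (t - η) (t + η) := ⟨by linarith, by linarith⟩
  have h2 : t + η / 2 ∈ Ioo (t - η) (t + η) := ⟨by linarith, by linarith⟩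
  have hmono := hcZ.strictMonoOn_nu hS hJ hp
  -- The slab in ν keeps away other parts of the preimage that return close to x. Since ν is
  -- strictly increasing along c, it forces the time of a point of the preimage in V to be near t;
  -- the tube N then makes the torus parameter small.
  set V : Set M := interior N ∩ ν ⁻¹' Ioo (ν (c (t - η / 2))) (ν (c (t + η / 2))) with hV
  have hVo : IsOpen V := isOpen_interior.inter (isOpen_Ioo.preimage hS.mm.smooth_nu.continuous)
  have hxV : x ∈ V := by
    refine ⟨mem_interior_iff_mem_nhds.mpr hN, ?_⟩
    rw [← hct]
    exact ⟨hmono (hηb _ h1).2.1 ht (by linarith), hmono ht (hηb _ h2).2.1 (by linarith)⟩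
  have hFc : ContinuousOn F Ω₀ := fun y hy => (hsm y hy.2).continuousAt.continuousWithinAt
  refine ⟨V, Ω₀ ∩ F ⁻¹' V, F, ⟨hVo, hFc.isOpen_inter_preimage hΩ₀o hVo,
    fun y hy => (hsm y hy.1.2).contMDiffWithinAt,
    fun y hy => injective_dF_flowParam hS hcZ hJ.1 hy.1.2 (hp _ hy.1.2), ?_, ?_⟩,
    0, ⟨h0Ω₀, by rw [mem_preimage, hF0]; exact hxV⟩, hF0, ?_⟩
  · refine Subset.antisymm ?_ ?_
    · rintro _ ⟨y, hy, rfl⟩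
      exact ⟨hFS y hy.1.2, hy.2⟩
    · rintro m ⟨⟨s, hs, hsm'⟩, hmV⟩
      obtain ⟨a, ha⟩ := toTorusQuotient_eq.mp (hsm'.symm.trans (hcγ s hs).symm)
      have hνm : ν m = ν (c s) := by rw [← ha, nu_smul hS.inv hS.mm]
      have hm2 := hmV.2
      rw [mem_preimage, hνm] at hm2
      have hs1 : t - η / 2 < s := (hmono.lt_iff_lt (hηb _ h1).2.1 hs).mp hm2.1
      have hs2 : s < t + η / 2 := (hmono.lt_iff_lt hs (hηb _ h2).2.1).mp hm2.2
      have hs3 := hηb s ⟨by linarith, by linarith⟩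
      obtain ⟨τ, hτ, hτm⟩ := htube (c s) hs3.1 a (by rw [ha]; exact interior_subset hmV.1)
      have hmF : F !₂[τ.1, τ.2, s - t] = m := by
        rw [← ha, ← hτm, hF, flowParam]
        change A.expG ((τ.1, τ.2), 0) • c (t + (s - t)) = _
        rw [add_sub_cancel]
      refine ⟨_, ⟨hsmall τ (s - t) hτ hs3.2.2, ?_⟩, hmF⟩
      rw [mem_preimage, hmF]; exact hmV
  · exact isEmbedding_domRestrict (hFc.mono inter_subset_left)
      (fun z hz => hUs z (interior_subset hz.1.1))
      (fun z hz w hw => hUK z (interior_subset hz.1.1) w (interior_subset hw.1.1))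
  · have h3 := isAssociativePlane_assocTan (φ := φ) (x := F 0) hS.coh (by rw [hF0]; exact hxp)
    rw [← range_dF_flowParam hS.inv hcZ hJ.1 ht0] at h3
    exact h3

end Preimage

/-! ### Curves in an embedded submanifold. -/

section LocalParam

variable {M : Type*} [TopologicalSpace M] [ChartedSpace E7 M] [IsManifold (𝓡 7) ∞ M]
  {S V : Set M} {Ω : Set W3} {F : W3 → M} {y₀ : W3}

/-- This is where embeddedness enters: points of S close to F y₀ in M have parameters close to y₀.
-/
theorem IsLocalParam.exists_nhds_mem (h : IsLocalParam S V Ω F) (hy : y₀ ∈ Ω) {U : Set W3}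
    (hU : U ∈ 𝓝 y₀) : ∃ N ∈ 𝓝 (F y₀), N ⊆ V ∧ ∀ m ∈ S ∩ N, ∃ z ∈ Ω ∩ U, F z = m := by
  have h1 : (Subtype.val : Ω → W3) ⁻¹' U ∈ 𝓝 (⟨y₀, hy⟩ : Ω) :=
    continuous_subtype_val.continuousAt.preimage_mem_nhds hU
  rw [h.embedding.isInducing.nhds_eq_comap] at h1
  obtain ⟨N, hN, hNU⟩ := h1
  have hV : V ∈ 𝓝 (F y₀) := h.isOpen_V.mem_nhds
    (h.image.subset (mem_image_of_mem F hy)).2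
  refine ⟨N ∩ V, inter_mem hN hV, inter_subset_right, fun m hm => ?_⟩
  obtain ⟨z, hz, rfl⟩ := h.image.superset ⟨hm.1, hm.2.2⟩
  exact ⟨z, ⟨hz, hNU (show (⟨z, hz⟩ : Ω) ∈ _ from hm.2.1)⟩, rfl⟩

/-- Velocities of curves in a submanifold are tangent to it. -/
theorem IsLocalParam.velocity_mem (h : IsLocalParam S V Ω F) (hy : y₀ ∈ Ω) {d : ℝ → M} {s : ℝ}
    {v : E7} (hd : HasVelocity d s v) (hds : d s = F y₀) (hS : ∀ᶠ r in 𝓝 s, d r ∈ S) :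
    v ∈ (dF F y₀).range := by
  classical
  have hFy := h.smooth.contMDiffAt (h.isOpen_Ω.mem_nhds hy)
  have hx : F y₀ ∈ (ch (F y₀)).source := mem_extChartAt_source _
  -- The parameter of d r, where there is one. The embedding property makes it continuous at s; its
  -- differentiability is not needed, since `mem_range_of_hasDerivAt_comp` does without it.
  set y : ℝ → W3 := fun r => if hr : ∃ z ∈ Ω, F z = d r then hr.choose else y₀ with hyd
  have hyspec : ∀ r, (∃ z ∈ Ω, F z = d r) → y r ∈ Ω ∧ F (y r) = d r := by
    intro r hr
    simp only [hyd, dif_pos hr]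
    exact hr.choose_spec
  have hinj : ∀ z ∈ Ω, ∀ z' ∈ Ω, F z = F z' → z = z' := fun z hz z' hz' hzz =>
    congrArg Subtype.val (@h.embedding.injective ⟨z, hz⟩ ⟨z', hz'⟩ hzz)
  have hys : y s = y₀ := by
    obtain ⟨h1, h2⟩ := hyspec s ⟨y₀, hy, hds.symm⟩
    exact hinj _ h1 _ hy (h2.trans hds)
  have hex : ∀ U ∈ 𝓝 y₀, ∀ᶠ r in 𝓝 s, y r ∈ U ∧ F (y r) = d r := by
    intro U hU
    obtain ⟨N, hN, -, hNU⟩ := h.exists_nhds_mem hy hU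
    filter_upwards [hS, hd.continuousAt.eventually (by rw [hds]; exact hN)] with r h1 h2
    obtain ⟨z, hz, hzr⟩ := hNU _ ⟨h1, h2⟩
    obtain ⟨h3, h4⟩ := hyspec r ⟨z, hz.1, hzr⟩
    rw [hinj _ h3 _ hz.1 (h4.trans hzr.symm)]
    exact ⟨hz.2, hzr⟩
  have hyc : ContinuousAt y s := by
    intro U hU
    rw [hys] at hU
    exact (hex U hU).mono fun r hr => hr.1
  have h1 : HasDerivAt (fun r => ch (F y₀) (F (y r))) (chD (F y₀) (d s) v) s := by
    refine (hd.chart (by rw [hds]; exact hx)).congr_of_eventuallyEq ?_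
    filter_upwards [hex univ univ_mem] with r hr
    exact congrArg _ hr.2
  have h2 : HasFDerivAt (fun z => ch (F y₀) (F z)) ((chD (F y₀) (F y₀)).comp (dF F y₀)) (y s) := by
    rw [hys]; exact (hasStrictFDerivAt_chart hFy hx).hasFDerivAt
  have h3 := mem_range_of_hasDerivAt_comp (injective_chD_dF hx (h.immersion y₀ hy)) h2 hyc h1
  obtain ⟨w, hw⟩ := h3
  rw [hds] at hw
  exact ⟨w, (chEquiv hx).injective hw⟩

end LocalParam

/-! ### Torus-invariant associatives are preimages of integral curves. -/

section Associative

variable {M : Type*} [TopologicalSpace M] [ChartedSpace E7 M] [MulAction Grp M]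
  [IsManifold (𝓡 7) ∞ M] [T2Space M]
  [ContMDiffSMul modelGrp (𝓡 7) ∞ Grp M] {A : AdaptedBasis} {φ : G2Structure M}
  {ν : M → ℝ} {μ : M → EuclideanSpace ℝ (Fin 3)} {γ : ℝ → TorusQuotient M} {J : Set ℝ} {t k : ℝ}
  {S : Set M} {x : M}

theorem IsTorusInvariantAssociative.expG_mem (h : IsTorusInvariantAssociative φ S) (hx : x ∈ S)
    (a : ℝ × ℝ) : A.expG (a, 0) • x ∈ S := by
  have h1 : A.expG (a, 0) = ((A.expG (a, 0)).1, 1) := Prod.ext rfl (A.expG_torus_snd a)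
  rw [h1]
  exact h.2.1 _ x hx

/-- The tangent spaces of torus-invariant associatives. -/
theorem IsTorusInvariantAssociative.exists_param (hcoh : CohomogeneityTwo M A)
    (h : IsTorusInvariantAssociative φ S) (hx : x ∈ S) :
    ∃ (V : Set M) (Ω : Set W3) (F : W3 → M) (y : W3), IsLocalParam S V Ω F ∧ y ∈ Ω ∧ F y = x ∧
      (dF F y).range = assocTan φ A x := by
  obtain ⟨V, Ω, F, hF, y, hy, rfl, hP⟩ := h.2.2 x hx
  refine ⟨V, Ω, F, y, hF, hy, rfl, ?_⟩
  refine eq_assocTan_of_isAssociativePlane hcoh (h.1 hx) hP fun l => ?_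
  have h1 := hasVelocity_expG A (F y) (A.u l, 0) 0
  rw [zero_smul, A.expG_zero, one_smul] at h1
  have h2 := hF.velocity_mem hy h1 (by rw [zero_smul, A.expG_zero, one_smul])
    (Eventually.of_forall fun r => by
      have := h.expG_mem (A := A) hx (r • A.u l)
      rwa [show ((r • A.u l, 0) : Par) = r • (A.u l, 0) by ext <;> simp] at this)
  rw [uv_eq]
  exact neg_mem h2

theorem IsTorusInvariantAssociative.velocity_mem (hcoh : CohomogeneityTwo M A)
    (h : IsTorusInvariantAssociative φ S) {d : ℝ → M} {s : ℝ} {v : E7} (hd : HasVelocity d s v)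
    (hS : ∀ᶠ r in 𝓝 s, d r ∈ S) : v ∈ assocTan φ A (d s) := by
  obtain ⟨V, Ω, F, y, hF, hy, hyx, hr⟩ := h.exists_param hcoh hS.self_of_nhds
  rw [← hr]
  exact hF.velocity_mem hy hd hyx.symm hS

theorem exists_hasSpeed_of_isTorusInvariantAssociative (hcoh : CohomogeneityTwo M A)
    (hJ : IsOpen J) (hγ : IsRegularCurveT A γ J)
    (h : IsTorusInvariantAssociative φ (toTorusQuotient ⁻¹' (γ '' J))) (ht : t ∈ J) :
    ∃ k ≠ 0, HasSpeed φ A γ t k := by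
  obtain ⟨-, c, hc, hne⟩ := hγ t ht
  obtain ⟨k, hk⟩ := mem_assocTan.mp (h.velocity_mem hcoh hc.hasVelocity (by
    filter_upwards [hc, hJ.eventually_mem ht] with s h1 h2 using ⟨s, h2, h1.2.symm⟩))
  refine ⟨k, ?_, c, hc, hk⟩
  rintro rfl
  rw [zero_smul, sub_zero] at hk
  exact hne ((Submodule.Quotient.mk_eq_zero _).mpr hk)

theorem IsZ.isIntegralCurveT {c : ℝ → M} (hc : IsZ φ A c J) (hJ : IsOpen J)
    (hp : ∀ s ∈ J, c s ∈ principalSet M) :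
    IsIntegralCurveT φ A (fun s => toTorusQuotient (c s)) J := by
  rw [isIntegralCurveT_iff]
  refine fun t ht => ⟨toTorusQuotient_mem.mpr (hp t ht), c, ?_, ?_⟩
  · filter_upwards [hJ.eventually_mem ht] with s hs using ⟨hc.contMDiffAt hJ hs, rfl⟩
  · rw [(hc t ht).vel_eq, one_smul, sub_self]
    exact zero_mem _

variable (hS : MomentSetting A φ ν μ)
include hS

/-- Z is tangent to S, but it is not yet known that its flow lines stay in S. A straight line in a
parametrisation, with initial velocity Z, lies in S and has velocity kZ modulo the torus, with k = 1
at the start. Its class in M/𝕋² reparametrises to an integral curve, and a lift of this to an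
integral curve of Z remains in S by torus invariance. -/
theorem IsTorusInvariantAssociative.exists_isZ (h : IsTorusInvariantAssociative φ S) (hx : x ∈ S)
    (t₀ : ℝ) : ∃ I e, IsOpenInterval I ∧ t₀ ∈ I ∧ e t₀ = x ∧ IsZ φ A e I ∧ ∀ s ∈ I, e s ∈ S := by
  obtain ⟨V, Ω, F, y, hF, hy, rfl, hr⟩ := h.exists_param hS.coh hx
  have hz : zf φ A (F y) ∈ (dF F y).range := by
    rw [hr, mem_assocTan]
    exact ⟨1, by rw [one_smul, sub_self]; exact zero_mem _⟩
  obtain ⟨w, hw⟩ := hz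
  have hline : ∀ s : ℝ, HasDerivAt (fun s : ℝ => y + s • w) w s := fun s => by
    simpa using ((hasDerivAt_id s).smul_const w).const_add y
  set c : ℝ → M := fun s => F (y + s • w) with hc
  have hlc : ContDiff ℝ ∞ (fun s : ℝ => y + s • w) :=
    contDiff_const.add (contDiff_id.smul contDiff_const)
  have hΩ : ∀ᶠ s in 𝓝 (0 : ℝ), y + s • w ∈ Ω :=
    (hline 0).continuousAt.eventually (by
      beta_reduce; rw [zero_smul, add_zero]; exact hF.isOpen_Ω.mem_nhds hy)
  obtain ⟨ε, hε, hb⟩ := Metric.eventually_nhds_iff_ball.mp hΩ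
  rw [Real.ball_eq_Ioo, zero_sub, zero_add] at hb
  have hcs : ∀ s ∈ Ioo (-ε) ε, ContMDiffAt 𝓘(ℝ, ℝ) (𝓡 7) ∞ c s := fun s hs =>
    ContMDiffAt.comp (g := F) (f := fun s : ℝ => y + s • w) s
      (hF.smooth.contMDiffAt (hF.isOpen_Ω.mem_nhds (hb s hs))) hlc.contMDiff.contMDiffAt
  have hcS : ∀ s ∈ Ioo (-ε) ε, c s ∈ S := fun s hs =>
    (hF.image.subset (mem_image_of_mem F (hb s hs))).1
  have hlift : ∀ s ∈ Ioo (-ε) ε,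
      IsLocalLift toTorusQuotient (fun s => toTorusQuotient (c s)) s c := fun s hs => by
    filter_upwards [isOpen_Ioo.eventually_mem hs] with r hr using ⟨hcs r hr, rfl⟩
  have hsp : ∀ s, ∃ k, s ∈ Ioo (-ε) ε →
      HasSpeed φ A (fun s => toTorusQuotient (c s)) s k := by
    intro s
    by_cases hs : s ∈ Ioo (-ε) ε
    · obtain ⟨k, hk⟩ := mem_assocTan.mp (h.velocity_mem hS.coh (hlift s hs).hasVelocity (by
        filter_upwards [isOpen_Ioo.eventually_mem hs] with r hr using hcS r hr))
      exact ⟨k, fun _ => ⟨c, hlift s hs, hk⟩⟩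
    · exact ⟨0, fun h' => absurd h' hs⟩
  choose k hk using hsp
  have hpr : ∀ s ∈ Ioo (-ε) ε, toTorusQuotient (c s) ∈ principalTorusQuotient M :=
    fun s hs => toTorusQuotient_mem.mpr (h.1 (hcS s hs))
  have h0 : (0 : ℝ) ∈ Ioo (-ε) ε := ⟨by linarith, hε⟩
  have hk0 : k 0 = 1 := by
    refine (hk 0 h0).unique hS (hpr 0 h0) ⟨c, hlift 0 h0, ?_⟩
    have h1 := hasVelocity_comp_param (F := F) (d := fun s : ℝ => y + s • w) (s := 0) (by
      rw [zero_smul, add_zero]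
      exact (hF.smooth.contMDiffAt (hF.isOpen_Ω.mem_nhds hy)).mdifferentiableAt (by simp)) (hline 0)
    have h2 : vel c 0 = zf φ A (c 0) := by
      rw [h1.vel_eq]
      simp only [hc, zero_smul, add_zero]
      exact hw
    rw [h2, one_smul, sub_self]
    exact zero_mem _
  have hkc : ContinuousAt k 0 := (contDiffAt_of_hasSpeed hS (by
    filter_upwards [isOpen_Ioo.eventually_mem h0] with s hs
      using ⟨hpr s hs, hk s hs⟩)).continuousAt
  obtain ⟨δ, hδ, hδb⟩ := Metric.eventually_nhds_iff_ball.mp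
    ((hkc.eventually_ne (by rw [hk0]; exact one_ne_zero)).and (isOpen_Ioo.eventually_mem h0))
  rw [Real.ball_eq_Ioo] at hδb
  obtain ⟨J', σ, θ, hJ', -, -, him, hint, -, hθ⟩ := isUnparamIntegralCurveT_of_hasSpeed hS
    (isOpenInterval_Ioo hδ) (fun t ht => (hδb t ht).1)
    (fun t ht => ⟨hpr t (hδb t ht).2, hk t (hδb t ht).2⟩)
  obtain ⟨hθ0, hσ0⟩ := hθ 0 ⟨by linarith, by linarith⟩
  obtain ⟨e, he, heZ, heS⟩ := hint.exists_lift hS hJ' hθ0 (x := F y) (by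
    rw [Function.comp, hσ0, hc]; simp)
  -- The shift of time moves the starting time from θ 0 to the prescribed t₀.
  refine ⟨(fun s => s + (θ 0 - t₀)) ⁻¹' J', fun s => e (s + (θ 0 - t₀)), ⟨?_, ?_, t₀, ?_⟩, ?_, ?_,
    ?_, ?_⟩
  · exact hJ'.1.preimage (continuous_add_const _)
  · exact hJ'.2.1.preimage_mono (fun a b hab => by simpa using hab)
  · simpa using hθ0
  · simpa using hθ0
  · simpa using he
  · exact heZ.comp_add _
  · intro s hs
    obtain ⟨a, ha⟩ := toTorusQuotient_eq.mp (heS _ hs)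
    change e (s + (θ 0 - t₀)) ∈ S
    rw [show e (s + (θ 0 - t₀)) = _ from ha.symm]
    exact h.2.1 a _ (hcS _ (hδb _ (him.subset (mem_image_of_mem σ hs))).2)

/-- A torus-invariant associative is locally the union of the torus orbits of the points of an
integral curve. -/
theorem IsTorusInvariantAssociative.exists_nhds_subset (h : IsTorusInvariantAssociative φ S)
    {e : ℝ → M} {I : Set ℝ} (hI : IsOpen I) {t₀ : ℝ} (ht₀ : t₀ ∈ I) (heZ : IsZ φ A e I)
    (heS : ∀ s ∈ I, e s ∈ S) : ∃ N ∈ 𝓝 (e t₀), ∀ m ∈ S ∩ N, ∃ s ∈ I, ∃ a : Torus,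
      ((a, 1) : Grp) • e s = m := by
  obtain ⟨V, Ω, F, y, hF, hy, hyx, hr⟩ := h.exists_param hS.coh (heS t₀ ht₀)
  set F' := flowParam A e t₀ with hF'
  have hF'0 : F' 0 = e t₀ := flowParam_zero
  have ht0 : t₀ + (0 : W3) 2 ∈ I := by simpa using ht₀
  have hsm' : ContMDiffAt (𝓡 3) (𝓡 7) ∞ F' 0 := contMDiffAt_flowParam (heZ.contMDiffAt hI ht0)
  have hsm : ContMDiffAt (𝓡 3) (𝓡 7) ∞ F y := hF.smooth.contMDiffAt (hF.isOpen_Ω.mem_nhds hy)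
  have hr' : (dF F' 0).range = assocTan φ A (e t₀) := by
    rw [← hF'0]; exact range_dF_flowParam hS.inv heZ hI ht0
  set x₀ := e t₀ with hx₀
  have hx : x₀ ∈ (ch x₀).source := mem_extChartAt_source _
  have hD := hasStrictFDerivAt_chart (x₀ := x₀) hsm (by rw [hyx]; exact hx)
  have hD' := hasStrictFDerivAt_chart (x₀ := x₀) hsm' (by rw [hF'0]; exact hx)
  rw [hyx] at hD
  rw [hF'0] at hD'
  set D := (chD x₀ x₀).comp (dF F y) with hDd
  set D' := (chD x₀ x₀).comp (dF F' 0) with hDd'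
  have hDi : Function.Injective D := (chEquiv hx).injective.comp (hF.immersion y hy)
  -- F and F' have the same tangent space at the common point. A left inverse L of D therefore makes
  -- L ∘ F locally injective and L ∘ F' locally onto.
  obtain ⟨l, hl⟩ := (D : W3 →ₗ[ℝ] E7).exists_leftInverse_of_injective
    (LinearMap.ker_eq_bot.mpr hDi)
  set L : E7 →L[ℝ] W3 := LinearMap.toContinuousLinearMap l with hL
  have hLD : ∀ w, L (D w) = w := fun w => LinearMap.congr_fun hl w
  have hf := L.hasStrictFDerivAt.comp y hD
  have hf' := L.hasStrictFDerivAt.comp 0 hD'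
  have hsurj : (L.comp D').range = ⊤ := by
    rw [LinearMap.range_eq_top]
    intro w
    have h1 : dF F y w ∈ (dF F' 0).range := by rw [hr', ← hr]; exact ⟨w, rfl⟩
    obtain ⟨w', hw'⟩ := h1
    refine ⟨w', ?_⟩
    change L (chD x₀ x₀ (dF F' 0 w')) = w
    rw [show dF F' 0 w' = dF F y w from hw']
    exact hLD w
  have hinj : Function.Injective (L.comp D) := fun w w' hww => by
    have : L (D w) = L (D w') := hww
    rwa [hLD, hLD] at this
  obtain ⟨K, hK, U, hU, hUK⟩ := exists_nhds_norm_sub_le hf hinj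
  obtain ⟨N, hN, hNV, hNU⟩ := hF.exists_nhds_mem hy hU
  rw [hyx] at hN
  have hF'c : ContinuousAt F' 0 := hsm'.continuousAt
  have hB : {z : W3 | F' z ∈ N ∧ t₀ + z 2 ∈ I} ∈ 𝓝 (0 : W3) := by
    refine inter_mem (hF'c.preimage_mem_nhds (by rw [hF'0]; exact hN)) ?_
    have hcont2 : Continuous fun y : W3 => t₀ + y 2 :=
      continuous_const.add (EuclideanSpace.proj (𝕜 := ℝ) 2 : W3 →L[ℝ] ℝ).continuous
    exact hcont2.continuousAt.preimage_mem_nhds (hI.mem_nhds ht0)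
  have himg := image_mem_map (m := fun z => L (ch x₀ (F' z))) hB
  have hmap : map (fun z => L (ch x₀ (F' z))) (𝓝 0) = 𝓝 (L (ch x₀ (F y))) := by
    have h1 : map (fun z => L (ch x₀ (F' z))) (𝓝 0) = 𝓝 (L (ch x₀ (F' 0))) :=
      hf'.map_nhds_eq_of_surj hsurj
    rw [h1, hF'0, hyx]
  rw [hmap] at himg
  have hU' : {z | L (ch x₀ (F z)) ∈
      (fun z => L (ch x₀ (F' z))) '' {z : W3 | F' z ∈ N ∧ t₀ + z 2 ∈ I}} ∩ U ∈ 𝓝 y :=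
    inter_mem (hf.continuousAt.preimage_mem_nhds himg) hU
  obtain ⟨N', hN', -, hNU'⟩ := hF.exists_nhds_mem hy hU'
  rw [hyx] at hN'
  refine ⟨N', hN', fun m hm => ?_⟩
  obtain ⟨z, ⟨-, ⟨z', ⟨hz'N, hz'I⟩, hzz'⟩, hzU⟩, rfl⟩ := hNU' m hm
  have hF'S : F' z' ∈ S := h.expG_mem (heS _ hz'I) _
  -- The point F' z' lies in S, so it equals F z''. Both z and z'' have the same image under L ∘ F,
  -- hence z = z'' and F z is on the swept-out surface.
  obtain ⟨z'', ⟨-, hz''U⟩, hz''⟩ := hNU _ ⟨hF'S, hz'N⟩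
  have h1 := hUK z hzU z'' hz''U
  simp only [hz''] at h1
  rw [← hzz', sub_self, norm_zero, mul_zero] at h1
  have h2 : z = z'' := sub_eq_zero.mp (norm_le_zero_iff.mp h1)
  refine ⟨_, hz'I, (A.expG ((z' 0, z' 1), 0)).1, ?_⟩
  rw [h2, hz'', hF', flowParam]
  congr 1
  exact Prod.ext rfl (A.expG_torus_snd _).symm

/-- Connected torus-invariant associatives are preimages of integral curves. -/
theorem IsTorusInvariantAssociative.exists_isIntegralCurveT (h : IsTorusInvariantAssociative φ S)
    (hc : IsConnected S) : ∃ (J : Set ℝ) (γ : ℝ → TorusQuotient M), IsOpenInterval J ∧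
      IsIntegralCurveT φ A γ J ∧ S = toTorusQuotient ⁻¹' (γ '' J) := by
  obtain ⟨x, hx⟩ := hc.nonempty
  -- A maximal integral curve of Z among those contained in S. It remains to show that its torus
  -- saturation S' is all of S.
  obtain ⟨J, c, hJ, h0, hc0, hcZ, hcS, hmax⟩ := exists_maximal_isZ (fun _ m => m ∈ S)
    (h.exists_isZ hS hx 0)
  refine ⟨J, _, hJ, hcZ.isIntegralCurveT hJ.1 fun s hs => h.1 (hcS s hs), ?_⟩
  have hmem : ∀ m, m ∈ toTorusQuotient ⁻¹' ((fun s => toTorusQuotient (c s)) '' J) ↔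
      ∃ s ∈ J, ∃ a : Torus, ((a, 1) : Grp) • c s = m := fun m =>
    exists_congr fun s => and_congr_right fun _ => eq_comm.trans toTorusQuotient_eq
  set S' := toTorusQuotient ⁻¹' ((fun s => toTorusQuotient (c s)) '' J) with hS'
  have hsub : S' ⊆ S := by
    intro m hm
    obtain ⟨s, hs, a, rfl⟩ := (hmem m).mp hm
    exact h.2.1 a _ (hcS s hs)
  refine Subset.antisymm ?_ hsub
  have : PreconnectedSpace S := isPreconnected_iff_preconnectedSpace.mp hc.isPreconnected
  -- Near a point of S', the submanifold consists of torus orbits of a translate of c, by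
  -- `exists_nhds_subset`.
  have hopen : IsOpen ((Subtype.val : S → M) ⁻¹' S') := by
    refine isOpen_iff_mem_nhds.mpr fun m hm => ?_
    obtain ⟨s, hs, a, ham⟩ := (hmem _).mp hm
    obtain ⟨N, hN, hNS⟩ := h.exists_nhds_subset hS hJ.1 hs (hcZ.smul hS.inv ((a, 1) : Grp))
      (fun r hr => h.2.1 a _ (hcS r hr))
    rw [ham] at hN
    filter_upwards [continuous_subtype_val.continuousAt.preimage_mem_nhds hN] with n hn
    obtain ⟨r, hr, b, hb⟩ := hNS n ⟨n.2, hn⟩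
    refine (hmem _).mpr ⟨r, hr, b * a, ?_⟩
    rw [← hb, smul_smul]
    congr 1
    exact Prod.ext rfl (mul_one _).symm
  have hclosed : IsClosed ((Subtype.val : S → M) ⁻¹' S') := by
    refine ⟨isOpen_iff_mem_nhds.mpr fun m hm => ?_⟩
    obtain ⟨I, e, hI, hI0, he0, heZ, heS⟩ := h.exists_isZ hS m.2 0
    obtain ⟨N, hN, hNS⟩ := h.exists_nhds_subset hS hI.1 hI0 heZ heS
    rw [he0] at hN
    filter_upwards [continuous_subtype_val.continuousAt.preimage_mem_nhds hN] with n hn hnS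
    obtain ⟨r, hr, a, hra⟩ := hNS n ⟨n.2, hn⟩
    obtain ⟨s, hs, b, hsb⟩ := (hmem _).mp hnS
    refine hm ((hmem _).mpr ?_)
    set g : Grp := ((b⁻¹ * a, 1) : Grp) with hg
    have hgr : g • e r = c s := by
      have h1 : g = ((b, 1) : Grp)⁻¹ * ((a, 1) : Grp) := Prod.ext rfl (by simp [hg])
      rw [h1, mul_smul, hra, inv_smul_eq_iff, hsb]
    -- If points of S' accumulate at m, the integral curve e through m meets S'. Translated by the
    -- torus and shifted in time it meets c, so maximality absorbs it and m itself lies in S'.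
    obtain ⟨hIJ, hIe⟩ := hmax (fun u => g • e (u + (r - s))) ((fun u => u + (r - s)) ⁻¹' I)
      ⟨hI.1.preimage (continuous_add_const _),
        hI.2.1.preimage_mono (fun a b hab => by simpa using hab), s, by simpa using hr⟩
      ((heZ.comp_add _).smul hS.inv g) (fun u hu => h.2.1 _ _ (heS _ hu)) s
      ⟨by simpa using hr, hs⟩ (by simpa using hgr)
    have h0I : s - r ∈ (fun u => u + (r - s)) ⁻¹' I := by simpa using hI0
    refine ⟨s - r, hIJ h0I, (b⁻¹ * a)⁻¹, ?_⟩
    have h2 := hIe h0I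
    simp only [sub_add_sub_cancel, sub_self, he0] at h2
    rw [← h2, smul_smul]
    have h3 : (((b⁻¹ * a)⁻¹, 1) : Grp) * g = 1 := Prod.ext (inv_mul_cancel _) (one_mul _)
    rw [h3, one_smul]
  have huniv := IsClopen.eq_univ ⟨hclosed, hopen⟩ ⟨⟨x, hx⟩, (hmem _).mpr ⟨0, h0, 1, by
    rw [hc0]; exact one_smul Grp x⟩⟩
  intro m hm
  exact (huniv.symm.subset (mem_univ (⟨m, hm⟩ : S)) :)

end Associative

/-! ### Uniqueness up to translation of time. -/

section Translation

variable {M : Type*} [TopologicalSpace M] [ChartedSpace E7 M] [MulAction Grp M]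
  [IsManifold (𝓡 7) ∞ M] [T2Space M] [ConnectedSpace M]
  [ContMDiffSMul modelGrp (𝓡 7) ∞ Grp M] {A : AdaptedBasis} {φ : G2Structure M}
  {ν : M → ℝ} {μ : M → EuclideanSpace ℝ (Fin 3)} {γ γ' : ℝ → TorusQuotient M} {J J' : Set ℝ}
  {t k : ℝ} {c : ℝ → M} {x : M}

theorem eq_of_hasDerivAt_zero_on {f : ℝ → ℝ} (hJ : IsOpenInterval J)
    (h : ∀ s ∈ J, HasDerivAt f 0 s) {s t : ℝ} (hs : s ∈ J) (ht : t ∈ J) : f s = f t :=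
  hJ.2.1.convex.is_const_of_fderivWithin_eq_zero
    (fun r hr => (h r hr).differentiableAt.differentiableWithinAt)
    (fun r hr => by
      rw [fderivWithin_of_isOpen hJ.1 hr, (h r hr).hasFDerivAt.fderiv]
      ext; simp) hs ht

theorem IsIntegralCurveT.congr (h : IsIntegralCurveT φ A γ J) (hJ : IsOpen J)
    (he : EqOn γ γ' J) : IsIntegralCurveT φ A γ' J := by
  rw [isIntegralCurveT_iff] at *
  refine fun t ht => ⟨he ht ▸ (h t ht).1, (h t ht).2.congr ?_⟩
  filter_upwards [hJ.eventually_mem ht] with s hs using he hs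

theorem image_eq_of_preimage_eq {P Q : Set (TorusQuotient M)}
    (h : (toTorusQuotient ⁻¹' P : Set M) = toTorusQuotient ⁻¹' Q) : P = Q :=
  toTorusQuotient_surjective.preimage_injective h

variable (hS : MomentSetting A φ ν μ)
include hS

theorem nu_of_toTorusQuotient_eq {x y : M}
    (h : (toTorusQuotient x : TorusQuotient M) = toTorusQuotient y) : ν x = ν y :=
  nu_of_toFullQuotient_eq hS (congrArg quotientProj h)

/-- An integral curve has a lift, along which `ν` is strictly increasing. -/
theorem IsIntegralCurveT.exists_lift_strictMonoOn (hγ : IsIntegralCurveT φ A γ J)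
    (hJ : IsOpenInterval J) : ∃ c : ℝ → M, IsZ φ A c J ∧
      (∀ s ∈ J, toTorusQuotient (c s) = γ s) ∧ (∀ s ∈ J, c s ∈ principalSet M) ∧
      StrictMonoOn (fun s => ν (c s)) J := by
  obtain ⟨t₀, ht₀⟩ := hJ.2.2
  obtain ⟨x, hx⟩ := toTorusQuotient_surjective (γ t₀)
  obtain ⟨c, -, hc, hcγ⟩ := hγ.exists_lift hS hJ ht₀ hx
  have hp : ∀ s ∈ J, c s ∈ principalSet M := fun s hs => by
    rw [← toTorusQuotient_mem, hcγ s hs]; exact (hγ s hs).1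
  exact ⟨c, hc, hcγ, hp, hc.strictMonoOn_nu hS hJ hp⟩

/-- Integral curves with the same image agree up to a translation of time. -/
theorem IsIntegralCurveT.exists_translation (hγ : IsIntegralCurveT φ A γ J)
    (hγ' : IsIntegralCurveT φ A γ' J') (hJ : IsOpenInterval J) (hJ' : IsOpenInterval J')
    (him : γ '' J = γ' '' J') : ∃ τ : ℝ, J' = (fun t => t + τ) '' J ∧ ∀ t ∈ J, γ' (t + τ) = γ t := by
  obtain ⟨c, hc, hcγ, hcp, hcm⟩ := hγ.exists_lift_strictMonoOn hS hJ
  obtain ⟨c', hc', hcγ', hcp', hcm'⟩ := hγ'.exists_lift_strictMonoOn hS hJ'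
  have hex : ∀ s, ∃ r, s ∈ J → r ∈ J' ∧ γ' r = γ s := by
    intro s
    by_cases hs : s ∈ J
    · obtain ⟨r, hr, h⟩ := him.subset (mem_image_of_mem γ hs)
      exact ⟨r, fun _ => ⟨hr, h⟩⟩
    · exact ⟨0, fun h => absurd h hs⟩
  choose θ hθ using hex
  have hor : ∀ s ∈ J, (toTorusQuotient (c' (θ s)) : TorusQuotient M) = toTorusQuotient (c s) :=
    fun s hs => by rw [hcγ' _ (hθ s hs).1, hcγ s hs, (hθ s hs).2]
  have hν : ∀ s ∈ J, ν (c' (θ s)) = ν (c s) := fun s hs => nu_of_toTorusQuotient_eq hS (hor s hs)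
  -- θ matches the times at which the two curves pass through the same orbit. As ν increases
  -- strictly along both lifts, θ preserves the order.
  have hmono : StrictMonoOn θ J := by
    intro a ha b hb hab
    refine (hcm'.lt_iff_lt (hθ a ha).1 (hθ b hb).1).mp ?_
    simp only [hν a ha, hν b hb]
    exact hcm ha hb hab
  have himθ : θ '' J = J' := by
    refine Subset.antisymm (image_subset_iff.mpr fun s hs => (hθ s hs).1) fun r hr => ?_
    obtain ⟨s, hs, h⟩ := him.superset (mem_image_of_mem γ' hr)
    refine ⟨s, hs, hcm'.injOn (hθ s hs).1 hr ?_⟩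
    refine nu_of_toTorusQuotient_eq hS ?_
    rw [hor s hs, hcγ s hs, hcγ' r hr, h]
  have hder : ∀ s ∈ J, HasDerivAt (fun s => θ s - s) 0 s := by
    intro s hs
    -- A monotone bijection between open intervals is continuous. The clock ν then gives derivative
    -- 1, because |Z|² agrees on the common orbits.
    have h1 : ContinuousAt θ s := hmono.continuousAt_of_image_mem_nhds (hJ.1.mem_nhds hs)
      (by rw [himθ]; exact hJ'.1.mem_nhds (hθ s hs).1)
    have hn : nz φ A (c' (θ s)) = nz φ A (c s) :=
      nz_of_toFullQuotient_eq hS (congrArg quotientProj (hor s hs))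
    have hn0 : nz φ A (c s) ≠ 0 := (nz_pos hS.coh (hcp s hs)).ne'
    have h2 := hasDerivAt_of_comp_eq h1 (hc'.hasStrictDerivAt_nu hS hJ'.1 (hθ s hs).1)
      (by rwa [hn]) (hc.hasDerivAt_nu hS hs) (by
        filter_upwards [hJ.1.eventually_mem hs] with r hr using hν r hr)
    rw [hn, inv_mul_cancel₀ hn0] at h2
    have h3 := h2.sub (hasDerivAt_id s)
    rw [sub_self] at h3
    exact h3
  obtain ⟨t₀, ht₀⟩ := hJ.2.2
  have hθτ : ∀ s ∈ J, θ s = s + (θ t₀ - t₀) := fun s hs => by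
    have := eq_of_hasDerivAt_zero_on hJ hder hs ht₀
    linarith
  refine ⟨θ t₀ - t₀, ?_, fun t ht => ?_⟩
  · rw [← himθ]
    exact image_congr hθτ
  · rw [← hθτ t ht]
    exact (hθ t ht).2

end Translation

/-! ### Level sets of `|μ|` -/

section Level

variable {M : Type*} [TopologicalSpace M] [ChartedSpace E7 M] [MulAction Grp M]
  [IsManifold (𝓡 7) ∞ M] [T2Space M] [ConnectedSpace M]
  [ContMDiffSMul modelGrp (𝓡 7) ∞ Grp M] {A : AdaptedBasis} {φ : G2Structure M}
  {ν : M → ℝ} {μ : M → EuclideanSpace ℝ (Fin 3)} {γ γ' : ℝ → TorusQuotient M} {J J' : Set ℝ}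
  {t k : ℝ} {c : ℝ → M} {x : M} {β : ℝ → FullQuotient M}

theorem isOpenMap_toFullQuotient : IsOpenMap (toFullQuotient : M → FullQuotient M) := by
  have := continuousSMul_grp M
  exact isOpenMap_quotient_mk'_mul

variable (hS : MomentSetting A φ ν μ)
include hS

/-- The image in the base of an integral curve is an open arc of a level set of `|μ|`. -/
theorem IsZ.exists_isOpen_image_eq (hc : IsZ φ A c J) (hJ : IsOpenInterval J)
    (hp : ∀ s ∈ J, c s ∈ principalSet M) : ∃ (r : ℝ) (O : Set (FullQuotient M)), IsOpen O ∧
      (fun s => toFullQuotient (c s)) '' J = O ∩ levelSetB μ r := by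
  obtain ⟨t₀, ht₀⟩ := hJ.2.2
  have hr : ∀ s ∈ J, ‖μ (c s)‖ = ‖μ (c t₀)‖ := fun s hs =>
    (pow_left_inj₀ (norm_nonneg _) (norm_nonneg _) two_ne_zero).mp
      (eq_of_hasDerivAt_zero_on hJ (fun s hs => hc.hasDerivAt_rho hS hs) hs ht₀)
  set r := ‖μ (c t₀)‖ with hrd
  set B := (fun s => (toFullQuotient (c s) : FullQuotient M)) '' J with hB
  -- The points near which the level |μ| = r projects into the arc. W is open by construction, and
  -- its image is open since the quotient map is.
  set W : Set M := {m | ∀ᶠ m' in 𝓝 m, ‖μ m'‖ = r → toFullQuotient m' ∈ B} with hW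
  refine ⟨r, toFullQuotient '' W, isOpenMap_toFullQuotient _ isOpen_setOfPred_eventually_nhds,
    Subset.antisymm ?_ ?_⟩
  · rintro _ ⟨s, hs, rfl⟩
    refine ⟨mem_image_of_mem _ ?_, c s, ⟨hp s hs, hr s hs⟩, rfl⟩
    obtain ⟨N, hN, hOC⟩ := exists_nhds_same_orbit hS (hp s hs)
    obtain ⟨ε, hε, hb⟩ := Metric.eventually_nhds_iff_ball.mp
      (((hc s hs).continuousAt.eventually hN).and (hJ.1.eventually_mem hs))
    rw [Real.ball_eq_Ioo] at hb
    have hsub : Icc (s - ε / 2) (s + ε / 2) ⊆ Ioo (s - ε) (s + ε) :=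
      fun u hu => ⟨by linarith [hu.1], by linarith [hu.2]⟩
    have h1 := hb _ (hsub (left_mem_Icc.mpr (by linarith)))
    have h2 := hb _ (hsub (right_mem_Icc.mpr (by linarith)))
    have hm := hc.strictMonoOn_nu hS hJ hp
    have hν : ∀ᶠ m in 𝓝 (c s), ν m ∈ Ioo (ν (c (s - ε / 2))) (ν (c (s + ε / 2))) :=
      hS.mm.smooth_nu.continuous.continuousAt.eventually
        (isOpen_Ioo.mem_nhds ⟨hm h1.2 hs (by linarith), hm hs h2.2 (by linarith)⟩)
    filter_upwards [hN, hν] with m hmN hmν hmr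
    have hcont : ContinuousOn (fun s => ν (c s)) (Icc (s - ε / 2) (s + ε / 2)) := fun u hu =>
      (hc.hasDerivAt_nu hS (hb u (hsub hu)).2).continuousAt.continuousWithinAt
    -- A nearby point of the same level has the same ν as some c u, by the intermediate value
    -- theorem. Then ν and |μ| agree, so both points lie on one orbit.
    obtain ⟨u, hu, huν⟩ := intermediate_value_Icc (by linarith) hcont (Ioo_subset_Icc_self hmν)
    obtain ⟨hu1, hu2⟩ := hb u (hsub hu)
    exact ⟨u, hu2, (toFullQuotient_eq.mpr (hOC m hmN (c u) hu1 huν.symm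
      (hmr.trans (hr u hu2).symm)))⟩
  · rintro _ ⟨⟨m, hm, rfl⟩, m', ⟨-, hm'⟩, h⟩
    exact hm.self_of_nhds ((norm_mu_of_toFullQuotient_eq hS h.symm).trans hm')

theorem isLevelSetCurveB_of_hasSpeed
    (h : ∀ t ∈ J, γ t ∈ principalTorusQuotient M ∧ ∃ k ≠ 0, HasSpeed φ A γ t k)
    (hu : IsUnparamIntegralCurveT φ A γ J) :
    IsLevelSetCurveB A μ (fun t => quotientProj (γ t)) J := by
  refine ⟨fun t ht => ?_, ?_⟩
  · obtain ⟨hp, k, hk, c, hc, hv⟩ := h t ht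
    have hx : c t ∈ principalSet M := by rw [← toTorusQuotient_mem, hc.self_of_nhds.2]; exact hp
    refine ⟨?_, c, ?_, fun h0 => ?_⟩
    · beta_reduce; rw [← hc.self_of_nhds.2]; exact toFullQuotient_mem.mpr hx
    · filter_upwards [hc] with s hs using ⟨hs.1, congrArg quotientProj hs.2⟩
    · have h1 : vel c t ∈ orbitTan A (c t) := (Submodule.Quotient.mk_eq_zero _).mp h0
      have h2 := sub_mem h1 (torusTan_le_orbitTan A _ hv)
      rw [sub_sub_cancel] at h2
      have h3 := Submodule.smul_mem _ k⁻¹ h2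
      rw [smul_smul, inv_mul_cancel₀ hk, one_smul] at h3
      exact zf_notMem_orbitTan hS hx h3
  · obtain ⟨J', σ, hJ', -, -, him, hint⟩ := hu
    obtain ⟨c, hc, hcγ, hcp, -⟩ := hint.exists_lift_strictMonoOn hS hJ'
    obtain ⟨r, O, hO, hrO⟩ := hc.exists_isOpen_image_eq hS hJ' hcp
    refine ⟨r, O, hO, ?_⟩
    rw [← hrO, ← him, image_image]
    exact image_congr fun s hs => (congrArg quotientProj (hcγ s hs)).symm

/-- Along the lift |μ| is constant. For k = dν(velocity)/|Z|², the difference of the velocity and kZ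
is killed by dν and d|μ|², hence vertical. It is also horizontal because Z is, so it vanishes modulo
the torus. Regularity excludes k = 0. -/
theorem exists_hasSpeed_of_isHorizontalLift {𝓗 : ∀ x : M, Submodule ℝ (QuotTangent A x)}
    (h𝓗 : IsPrincipalConnection A 𝓗)
    (hX : ∀ x ∈ principalSet M, (torusTangent A x).mkQ (crossField φ A x) ∈ 𝓗 x)
    (hJ : IsOpen J) (hγ : IsRegularCurveT A γ J) (hβ : IsLevelSetCurveB A μ β J)
    (hl : IsHorizontalLift A 𝓗 γ β J) (ht : t ∈ J) : ∃ k ≠ 0, HasSpeed φ A γ t k := by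
  obtain ⟨-, c, hc, hH⟩ := hl t ht
  obtain ⟨hp, c', hc', hne⟩ := hγ t ht
  obtain ⟨-, r, O, -, hO⟩ := hβ
  have hx : c t ∈ principalSet M := by rw [← toTorusQuotient_mem, hc.self_of_nhds.2]; exact hp
  have hρ : (fun s => ‖μ (c s)‖ ^ 2) =ᶠ[𝓝 t] fun _ => r ^ 2 := by
    filter_upwards [hc, hJ.eventually_mem ht] with s hs hsJ
    obtain ⟨m, ⟨-, hm⟩, hms⟩ := (hO.subset (mem_image_of_mem β hsJ)).2
    rw [← hm, norm_mu_of_toFullQuotient_eq hS]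
    rw [hms, ← (hl s hsJ).1, ← hs.2]
    rfl
  have h1 := (hasDerivAt_rho hS.mm hc.hasVelocity).unique
    ((hasDerivAt_const t (r ^ 2)).congr_of_eventuallyEq hρ)
  set k : ℝ := dnu φ A (c t) (vel c t) / nz φ A (c t) with hk
  have hnz := (nz_pos (φ := φ) hS.coh hx).ne'
  have h2 : vel c t - k • zf φ A (c t) ∈ orbitTan A (c t) := by
    refine mem_orbitTan_of_dnu_of_drho hS hx ?_ ?_
    · rw [map_sub, map_smul, smul_eq_mul]
      change _ - k * nz φ A (c t) = 0
      rw [hk, div_mul_cancel₀ _ hnz, sub_self]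
    · rw [map_sub, map_smul, dmu_zf, smul_zero, sub_zero]
      simpa using h1
  have h3 : (torusTangent A (c t)).mkQ (vel c t - k • zf φ A (c t)) ∈ 𝓗 (c t) := by
    have h4 : (torusTangent A (c t)).mkQ (vel c t - k • zf φ A (c t)) =
        (torusTangent A (c t)).mkQ (velocity c t) -
          k • (torusTangent A (c t)).mkQ (crossField φ A (c t)) := by
      rw [← map_smul, ← map_sub]; rfl
    rw [h4]
    exact sub_mem hH (Submodule.smul_mem _ _ (hX _ hx))
  have h5 := (Submodule.disjoint_def.mp (h𝓗.isCompl _ hx).disjoint) _ h3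
    (Submodule.mem_map_of_mem h2)
  have h6 : HasSpeed φ A γ t k := ⟨c, hc, (Submodule.Quotient.mk_eq_zero _).mp h5⟩
  refine ⟨k, fun h0 => ?_, h6⟩
  have h7 := h6.of_lift hS hp hc'
  rw [h0, zero_smul, sub_zero] at h7
  exact hne ((Submodule.Quotient.mk_eq_zero _).mpr h7)

end Level

/-! ### The action of `G^{SU(2)}` -/

section Family

variable {M : Type*} [TopologicalSpace M] [ChartedSpace E7 M] [MulAction Grp M]
  [IsManifold (𝓡 7) ∞ M] [T2Space M] [ConnectedSpace M]
  [ContMDiffSMul modelGrp (𝓡 7) ∞ Grp M] {A : AdaptedBasis} {φ : G2Structure M}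
  {ν : M → ℝ} {μ : M → EuclideanSpace ℝ (Fin 3)} {γ γ' : ℝ → TorusQuotient M} {J J' : Set ℝ}
  {t k : ℝ} {c : ℝ → M} {x : M} {β : ℝ → FullQuotient M}

theorem mk_smul_toTorusQuotient (b : SU2) (x : M) :
    ((b : GSU2 M) • (toTorusQuotient x : TorusQuotient M)) =
      toTorusQuotient (((1, b) : Grp) • x) := rfl

theorem quotientProj_smul (g : GSU2 M) (q : TorusQuotient M) :
    quotientProj (g • q) = quotientProj q := by
  induction g using QuotientGroup.induction_on with
  | H b =>
    obtain ⟨x, rfl⟩ := toTorusQuotient_surjective q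
    rw [mk_smul_toTorusQuotient, quotientProj_mk, quotientProj_mk, toFullQuotient_smul]

variable (hS : MomentSetting A φ ν μ)
include hS

/-- Freeness of the action: an element of G that fixes a principal point is in the kernel Γ, so its
SU(2)-component is in Γ̃₂. -/
theorem eq_of_smul_toTorusQuotient_eq (hx : x ∈ principalSet M) {g g' : GSU2 M}
    (h : g • (toTorusQuotient x : TorusQuotient M) = g' • toTorusQuotient x) : g = g' := by
  induction g using QuotientGroup.induction_on with
  | H b =>
    induction g' using QuotientGroup.induction_on with
    | H b' =>
      rw [mk_smul_toTorusQuotient, mk_smul_toTorusQuotient] at h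
      obtain ⟨a, ha⟩ := toTorusQuotient_eq.mp h
      rw [smul_smul] at ha
      have h1 : (((1, b) : Grp)⁻¹ * (((a, 1) : Grp) * ((1, b') : Grp))) • x = x := by
        rw [mul_smul, ha, inv_smul_smul]
      rw [QuotientGroup.eq]
      refine ⟨_, MonoidHom.mem_ker.mpr (Equiv.ext fun y => smul_eq_of_smul_eq hS hx h1 y), ?_⟩
      change b⁻¹ * (1 * b') = b⁻¹ * b'
      rw [one_mul]

theorem IsIntegralCurveT.smul (hγ : IsIntegralCurveT φ A γ J) (hJ : IsOpenInterval J)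
    (g : GSU2 M) : IsIntegralCurveT φ A (fun t => g • γ t) J := by
  obtain ⟨c, hc, hcγ, hcp, -⟩ := hγ.exists_lift_strictMonoOn hS hJ
  induction g using QuotientGroup.induction_on with
  | H b =>
    refine ((hc.smul hS.inv ((1, b) : Grp)).isIntegralCurveT hJ.1
      fun s hs => (smul_mem_principalSet_iff _).mpr (hcp s hs)).congr hJ.1 fun s hs => ?_
    simp only [← hcγ s hs]
    rfl

theorem IsIntegralCurveB.exists_isIntegralCurveT (hβ : IsIntegralCurveB φ A β J)
    (hJ : IsOpenInterval J) : ∃ γ : ℝ → TorusQuotient M,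
      IsIntegralCurveT φ A γ J ∧ ∀ t ∈ J, quotientProj (γ t) = β t := by
  obtain ⟨t₀, ht₀⟩ := hJ.2.2
  obtain ⟨x, hx⟩ := Quotient.mk''_surjective (β t₀)
  obtain ⟨c, -, hc, hcβ⟩ := hβ.exists_lift hS hJ ht₀ (x := x) hx
  exact ⟨_, hc.isIntegralCurveT hJ.1 fun s hs => by
    rw [← toFullQuotient_mem, hcβ s hs]; exact (hβ s hs).1, hcβ⟩

/-- Lifts of the two curves to M start on one G-orbit. The group element (a, b) that relates the
starting points relates the lifts at all times, by uniqueness of integral curves. In M/𝕋² only the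
class of b remains, and freeness makes it unique. -/
theorem IsIntegralCurveT.exists_smul_eq (hγ : IsIntegralCurveT φ A γ J)
    (hγ' : IsIntegralCurveT φ A γ' J) (hJ : IsOpenInterval J)
    (h : ∀ t ∈ J, quotientProj (γ t) = quotientProj (γ' t)) :
    ∃! g : GSU2 M, ∀ t ∈ J, γ' t = g • γ t := by
  obtain ⟨c, hc, hcγ, hcp, -⟩ := hγ.exists_lift_strictMonoOn hS hJ
  obtain ⟨c', hc', hcγ', -, -⟩ := hγ'.exists_lift_strictMonoOn hS hJ
  obtain ⟨t₀, ht₀⟩ := hJ.2.2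
  have h1 := h t₀ ht₀
  rw [← hcγ t₀ ht₀, ← hcγ' t₀ ht₀, quotientProj_mk, quotientProj_mk] at h1
  obtain ⟨⟨a, b⟩, hab⟩ := toFullQuotient_eq.mp h1.symm
  have h2 := IsZ.eqOn' hc' (hc.smul hS.inv ((a, b) : Grp)) hJ ht₀ hab.symm
  refine ⟨(b : GSU2 M), fun t ht => ?_, fun g hg => ?_⟩
  · rw [← hcγ t ht, ← hcγ' t ht, h2 ht, mk_smul_toTorusQuotient, toTorusQuotient_eq]
    refine ⟨a, ?_⟩
    rw [smul_smul]
    congr 1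
    exact Prod.ext (mul_one a) (one_mul b)
  · refine eq_of_smul_toTorusQuotient_eq hS (hcp t₀ ht₀) ?_
    rw [hcγ t₀ ht₀, ← hg t₀ ht₀, ← hcγ' t₀ ht₀, ← hcγ t₀ ht₀, h2 ht₀, mk_smul_toTorusQuotient,
      toTorusQuotient_eq]
    refine ⟨a, ?_⟩
    rw [smul_smul]
    congr 1
    exact Prod.ext (mul_one a) (one_mul b)

/-- The images under g and g' could only coincide with a change of time. But the action preserves
the projection to the base, where the values of ν identify the time; freeness then gives g = g'. -/
theorem IsIntegralCurveT.injective_preimage (hγ : IsIntegralCurveT φ A γ J)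
    (hJ : IsOpenInterval J) : Function.Injective fun g : GSU2 M =>
      (toTorusQuotient ⁻¹' ((fun t => g • γ t) '' J) : Set M) := by
  intro g g' h
  obtain ⟨c, hc, hcγ, hcp, hcm⟩ := hγ.exists_lift_strictMonoOn hS hJ
  obtain ⟨t₀, ht₀⟩ := hJ.2.2
  have h1 := image_eq_of_preimage_eq h
  obtain ⟨t₁, ht₁, h2⟩ := h1.subset (mem_image_of_mem _ ht₀)
  have h3 := congrArg quotientProj h2
  simp only [quotientProj_smul] at h3
  rw [← hcγ t₀ ht₀, ← hcγ t₁ ht₁] at h3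
  obtain rfl : t₁ = t₀ := hcm.injOn ht₁ ht₀ (nu_of_toFullQuotient_eq hS h3)
  simp only [← hcγ t₁ ht₁] at h2
  exact (eq_of_smul_toTorusQuotient_eq hS (hcp t₁ ht₁) h2).symm

theorem IsIntegralCurveT.isConnected_preimage (hγ : IsIntegralCurveT φ A γ J)
    (hJ : IsOpenInterval J) : IsConnected (toTorusQuotient ⁻¹' (γ '' J) : Set M) := by
  obtain ⟨c, hc, hcγ, -, -⟩ := hγ.exists_lift_strictMonoOn hS hJ
  have := continuousSMul_grp M
  have h1 : (toTorusQuotient ⁻¹' (γ '' J) : Set M) =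
      (fun p : (ℝ × ℝ) × ℝ => A.expG (p.1, 0) • c p.2) '' (univ ×ˢ J) := by
    ext m
    constructor
    · rintro ⟨s, hs, hsm⟩
      obtain ⟨a, ha⟩ := toTorusQuotient_eq.mp (hsm.symm.trans (hcγ s hs).symm)
      obtain ⟨b, hb⟩ := A.exists_expG_torus a
      exact ⟨(b, s), ⟨mem_univ _, hs⟩, by simp only [hb, ha]⟩
    · rintro ⟨⟨b, s⟩, ⟨-, hs⟩, rfl⟩
      exact ⟨s, hs, by rw [toTorusQuotient_expG, hcγ s hs]⟩
  rw [h1]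
  refine (isConnected_univ.prod ⟨hJ.2.2, hJ.2.1.isPreconnected⟩).image _ ?_
  have h2 : Continuous fun p : (ℝ × ℝ) × ℝ => A.expG (p.1, 0) :=
    A.contMDiff_expG.continuous.comp (continuous_fst.prodMk continuous_const)
  refine h2.continuousOn.smul (ContinuousOn.comp (g := c) (t := J) (fun s hs =>
    (hc s hs).continuousAt.continuousWithinAt) continuous_snd.continuousOn fun p hp => hp.2)

end Family

end AssocLevelSets

end

/-! ### The main theorem. -/

open AssocLevelSets in
theorem mainTheorem7 {M : Type*} [TopologicalSpace M] [T2Space M] [ConnectedSpace M]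
    [ChartedSpace E7 M] [IsManifold (𝓡 7) ∞ M]
    [MulAction Grp M] [ContMDiffSMul modelGrp (𝓡 7) ∞ Grp M]
    (A : AdaptedBasis) (hcoh : CohomogeneityTwo M A)
    (φ : G2Structure M) (htf : φ.IsTorsionFree) (hinv : φ.IsInvariant)
    (ν : M → ℝ) (μ : M → EuclideanSpace ℝ (Fin 3)) (hμν : IsMultiMoment φ A ν μ)
    (𝓗 : ∀ x : M, Submodule ℝ (QuotTangent A x)) (h𝓗 : IsPrincipalConnection A 𝓗)
    (hX : ∀ x ∈ principalSet M, (torusTangent A x).mkQ (crossField φ A x) ∈ 𝓗 x) :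
    -- the three conditions on a regular curve in `M_P/𝕋²` are equivalent
    (∀ (J : Set ℝ) (γ : ℝ → TorusQuotient M), IsOpenInterval J → IsRegularCurveT A γ J →
      List.TFAE
        [IsTorusInvariantAssociative φ (toTorusQuotient ⁻¹' (γ '' J)),
         IsUnparamIntegralCurveT φ A γ J,
         ∃ β : ℝ → FullQuotient M, IsLevelSetCurveB A μ β J ∧ IsHorizontalLift A 𝓗 γ β J]) ∧
    -- connected `𝕋²`-invariant associatives are exactly the preimages of integral curves
    (∀ S : Set M, (IsTorusInvariantAssociative φ S ∧ IsConnected S) ↔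
      ∃ (J : Set ℝ) (γ : ℝ → TorusQuotient M), IsOpenInterval J ∧ IsIntegralCurveT φ A γ J ∧
        S = toTorusQuotient ⁻¹' (γ '' J)) ∧
    -- and determine the integral curve, up to a translation of time
    (∀ (J J' : Set ℝ) (γ γ' : ℝ → TorusQuotient M), IsOpenInterval J → IsOpenInterval J' →
      IsIntegralCurveT φ A γ J → IsIntegralCurveT φ A γ' J' →
      (toTorusQuotient ⁻¹' (γ '' J) : Set M) = toTorusQuotient ⁻¹' (γ' '' J') →
      ∃ τ : ℝ, J' = (fun t => t + τ) '' J ∧ ∀ t ∈ J, γ' (t + τ) = γ t) ∧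
    -- the lifts of an integral curve in `B` to integral curves form a `G^{SU(2)}`-family
    (∀ (J : Set ℝ) (β : ℝ → FullQuotient M), IsOpenInterval J → IsIntegralCurveB φ A β J →
      (∃ γ : ℝ → TorusQuotient M,
        IsIntegralCurveT φ A γ J ∧ ∀ t ∈ J, quotientProj (γ t) = β t) ∧
      (∀ γ : ℝ → TorusQuotient M,
        IsIntegralCurveT φ A γ J → (∀ t ∈ J, quotientProj (γ t) = β t) →
        (∀ g : GSU2 M, IsIntegralCurveT φ A (fun t => g • γ t) J ∧
          ∀ t ∈ J, quotientProj (g • γ t) = β t) ∧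
        (∀ γ' : ℝ → TorusQuotient M,
          IsIntegralCurveT φ A γ' J → (∀ t ∈ J, quotientProj (γ' t) = β t) →
          ∃! g : GSU2 M, ∀ t ∈ J, γ' t = g • γ t) ∧
        (∀ g : GSU2 M, IsTorusInvariantAssociative φ
          (toTorusQuotient ⁻¹' ((fun t => g • γ t) '' J))) ∧
        Function.Injective fun g : GSU2 M =>
          (toTorusQuotient ⁻¹' ((fun t => g • γ t) '' J) : Set M))) := by
  have hS : MomentSetting A φ ν μ := ⟨hcoh, hinv, hμν⟩
  refine ⟨fun J γ hJ hγ => ?_, fun S => ⟨fun h => h.1.exists_isIntegralCurveT hS h.2, ?_⟩,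
    fun J J' γ γ' hJ hJ' hγ hγ' h =>
      hγ.exists_translation hS hγ' hJ hJ' (image_eq_of_preimage_eq h),
    fun J β hJ hβ => ⟨hβ.exists_isIntegralCurveT hS hJ, fun γ hγ hγβ =>
      ⟨fun g => ⟨hγ.smul hS hJ g, fun t ht => (quotientProj_smul g _).trans (hγβ t ht)⟩,
        fun γ' hγ' hγβ' => hγ.exists_smul_eq hS hγ' hJ
          fun t ht => (hγβ t ht).trans (hγβ' t ht).symm,
        fun g => (hγ.smul hS hJ g).isTorusInvariantAssociative hS hJ,
        hγ.injective_preimage hS hJ⟩⟩⟩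
  -- Conditions 1 and 3 both reach 2 through the same statement, that the velocity is everywhere a
  -- nonzero multiple of the field.
  · have key : (∀ t ∈ J, ∃ k ≠ 0, HasSpeed φ A γ t k) → IsUnparamIntegralCurveT φ A γ J := by
      intro h
      choose! k hk0 hk using h
      obtain ⟨J', σ, -, h1, h2, h3, h4, h5, -⟩ := isUnparamIntegralCurveT_of_hasSpeed hS hJ hk0
        fun t ht => ⟨(hγ t ht).1, hk t ht⟩
      exact ⟨J', σ, h1, h2, h3, h4, h5⟩
    tfae_have 1 → 2 := fun h => key fun t ht =>
      exists_hasSpeed_of_isTorusInvariantAssociative hcoh hJ.1 hγ h ht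
    tfae_have 2 → 1 := by
      rintro ⟨J', σ, hJ', -, -, rfl, hi⟩
      rw [← Set.image_comp]
      exact hi.isTorusInvariantAssociative hS hJ'
    tfae_have 2 → 3 := by
      intro h
      refine ⟨_, isLevelSetCurveB_of_hasSpeed hS
        (fun t ht => ⟨(hγ t ht).1, h.exists_hasSpeed ht⟩) h, fun t ht => ⟨rfl, ?_⟩⟩
      obtain ⟨k, -, c, hc, hv⟩ := h.exists_hasSpeed ht
      refine ⟨c, hc, ?_⟩
      have hx : c t ∈ principalSet M := by
        rw [← toTorusQuotient_mem, hc.self_of_nhds.2]; exact (hγ t ht).1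
      have h1 : (torusTangent A (c t)).mkQ (velocity c t) =
          k • (torusTangent A (c t)).mkQ (crossField φ A (c t)) := by
        rw [← map_smul]; exact (Submodule.Quotient.eq _).mpr hv
      rw [h1]
      exact Submodule.smul_mem _ _ (hX _ hx)
    tfae_have 3 → 2 := by
      rintro ⟨β, hβ, hl⟩
      exact key fun t ht => exists_hasSpeed_of_isHorizontalLift hS h𝓗 hX hJ.1 hγ hβ hl ht
    tfae_finish
  · rintro ⟨J, γ, hJ, hγ, rfl⟩
    exact ⟨hγ.isTorusInvariantAssociative hS hJ, hγ.isConnected_preimage hS hJ⟩
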